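/- **Birationality Theorem.** *Conventions.* A tt-category is a triangulated category $\mathcal K$ with a symmetric monoidal structure $(\otimes,\mathbb 1)$ that is exact in each variable and compatible with the suspension $\Sigma$ up to the usual signs; it is rigid if every object $X$ has a dual $X^\vee$. A thick $\otimes$-ideal is a triangulated subcategory closed under direct summands and under tensoring with arbitrary objects. It is prime if it is proper and if $X\otimes Y\in\mathcal P$ implies $X\in\mathcal P$ or $Y\in\mathcal P$. $\operatorname{Spc}\mathcal K$ is the set of prime ideals, $\operatorname{supp}(X)=\{\mathcal P\mid X\notin\mathcal P\}$, and the complements of the supports are a basis of open subsets of $\operatorname{Spc}\mathcal K$. For an open subset $U\subseteq\operatorname{Spc}\mathcal K$, the tt-category $\mathcal K(U)$ is the idempotent completion of the Verdier quotient of $\mathcal K$ by $\{X\mid \operatorname{supp}(X)\cap U=\varnothing\}$, and $\operatorname{res}_U\colon\mathcal K\to\mathcal K(U)$ is the canonical functor. *The stable category.* Let $\mathcal K$ be a rigid tt-category, $B$ an object of $\mathcal K$, and $$F_B\xrightarrow{\ \xi_B\ }\mathbb 1\xrightarrow{\ \mathrm{coev}\ }B^\vee\otimes B\to\Sigma F_B$$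 an exact triangle on the coevaluation. Let $\pi\colon\mathcal K\to\mathcal K/(B\otimes\mathcal K)$ be the additive quotient of $\mathcal K$ in which the morphisms that factor through a direct summand of some $B\otimes Z$ are set to zero, with the symmetric monoidal structure induced by that of $\mathcal K$ (so that $\pi$ is a symmetric monoidal functor). It is triangulated as follows. The suspension is $\Sigma_BX=\operatorname{cone}(\mathrm{coev})\otimes X$, the cofibre in $\mathcal K$ of $\eta_X=\mathrm{coev}\otimes X\colon X\to B^\vee\otimes B\otimes X$. A morphism $f\colon X\to Y$ of $\mathcal K$ gives, by homotopy pushout of $\eta_X$ along $f$, an exact triangle $Y\xrightarrow{g}Z\xrightarrow{h}\operatorname{cone}(\mathrm{coev})\otimes X\to\Sigma Y$ in $\mathcal K$, whose last morphism is the composite of $\operatorname{cone}(\mathrm{coev})\otimes X\to\Sigma X$ with $\Sigma f$. The distinguished triangles of $\mathcal K/(B\otimes\mathcal K)$ are those that are isomorphic to some $\pi X\xrightarrow{\pi f}\pi Y\xrightarrow{\pi g}\pi Z\xrightarrow{\pi h}\Sigma_B\,\pi X$. (In general $\pi$ is not an exact functor.) *Theorem.* Let $C$ be a cone in $\mathcal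 K$ of $\xi_B^{\otimes2}\colon F_B\otimes F_B\to\mathbb 1$. Let $U=\operatorname{Spc}(\mathcal K)\smallsetminus\operatorname{supp}(B)$ and $V=\operatorname{Spc}(\mathcal K/(B\otimes\mathcal K))\smallsetminus\operatorname{supp}(\pi C)$. Then there is a tensor-triangulated equivalence (an equivalence of categories that is exact and strong symmetric monoidal) $$E\colon\ \mathcal K(U)\xrightarrow{\ \cong\ }\bigl(\mathcal K/(B\otimes\mathcal K)\bigr)(V)$$ together with a monoidal isomorphism $E\circ\operatorname{res}_U\cong\operatorname{res}_V\circ\,\pi$. In particular, $U$ and $V$ are homeomorphic: the maps $\operatorname{Spc}(\mathcal K(U))\to U$ and $\operatorname{Spc}((\mathcal K/(B\otimes\mathcal K))(V))\to V$, given by taking preimages of primes under $\operatorname{res}_U$ and $\operatorname{res}_V$, are homeomorphisms, as is $\operatorname{Spc}(E)\colon\mathcal Q\mapsto E^{-1}(\mathcal Q)$, and under these identifications $\operatorname{Spc}(E)$ is a homeomorphism $V\xrightarrow{\cong}U$. -/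

import Mathlib

open CategoryTheory Category Limits MonoidalCategory Pretriangulated

universe v u

noncomputable section

namespace TTGeom

/-! ### Tensor-triangulated categories -/

/-- The compatibility between the tensor product and the triangulation in a tensor-triangulated
category (the category being already triangulated and symmetric monoidal):
isomorphisms `ΣX ⊗ Y ≅ Σ(X ⊗ Y)`, natural and compatible with the unit and the associativity
constraints, which make `- ⊗ Y` exact, and such that the two identifications
`ΣX ⊗ ΣY ≅ Σ²(X ⊗ Y)` agree up to the sign `-1`. The isomorphisms `X ⊗ ΣY ≅ Σ(X ⊗ Y)`, and the
exactness of `X ⊗ -`, are deduced from those by means of the symmetry. -/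
class TensorTriangulated (K : Type u) [Category.{v} K] [Preadditive K] [HasZeroObject K]
    [HasShift K ℤ] [∀ n : ℤ, (shiftFunctor K n).Additive] [Pretriangulated K]
    [MonoidalCategory K] [SymmetricCategory K] where
  /-- `ΣX ⊗ Y ≅ Σ(X ⊗ Y)` -/
  shiftTensor (X Y : K) : X⟦(1 : ℤ)⟧ ⊗ Y ≅ (X ⊗ Y)⟦(1 : ℤ)⟧
  shiftTensor_natural_left {X X' : K} (f : X ⟶ X') (Y : K) :
    f⟦(1 : ℤ)⟧' ▷ Y ≫ (shiftTensor X' Y).hom = (shiftTensor X Y).hom ≫ (f ▷ Y)⟦(1 : ℤ)⟧'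
  shiftTensor_natural_right (X : K) {Y Y' : K} (g : Y ⟶ Y') :
    X⟦(1 : ℤ)⟧ ◁ g ≫ (shiftTensor X Y').hom = (shiftTensor X Y).hom ≫ (X ◁ g)⟦(1 : ℤ)⟧'
  shiftTensor_unit (X : K) :
    (shiftTensor X (𝟙_ K)).hom ≫ (ρ_ X).hom⟦(1 : ℤ)⟧' = (ρ_ (X⟦(1 : ℤ)⟧)).hom
  shiftTensor_assoc (X Y Z : K) :
    (shiftTensor X Y).hom ▷ Z ≫ (shiftTensor (X ⊗ Y) Z).hom ≫ (α_ X Y Z).hom⟦(1 : ℤ)⟧' =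
      (α_ (X⟦(1 : ℤ)⟧) Y Z).hom ≫ (shiftTensor X (Y ⊗ Z)).hom
  tensor_distinguished (T : Triangle K) (hT : T ∈ distTriang K) (Y : K) :
    Triangle.mk (T.mor₁ ▷ Y) (T.mor₂ ▷ Y) (T.mor₃ ▷ Y ≫ (shiftTensor T.obj₁ Y).hom) ∈
      distTriang K
  /-- Here `(β_ X Σ Y) ≫ shiftTensor Y X ≫ Σ(β_ Y X)` is the isomorphism
  `X ⊗ ΣY ≅ Σ(X ⊗ Y)`. -/
  shiftTensor_sign (X Y : K) :
    (shiftTensor X (Y⟦(1 : ℤ)⟧)).hom ≫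
        ((β_ X (Y⟦(1 : ℤ)⟧)).hom ≫ (shiftTensor Y X).hom ≫ (β_ Y X).hom⟦(1 : ℤ)⟧')⟦(1 : ℤ)⟧' =
      -(((β_ (X⟦(1 : ℤ)⟧) (Y⟦(1 : ℤ)⟧)).hom ≫ (shiftTensor Y (X⟦(1 : ℤ)⟧)).hom ≫
          (β_ Y (X⟦(1 : ℤ)⟧)).hom⟦(1 : ℤ)⟧') ≫ (shiftTensor X Y).hom⟦(1 : ℤ)⟧')

/-! ### Suspensions and distinguished triangles

The categories derived from a tensor-triangulated category (stable categories, Verdier quotients,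
idempotent completions) are equipped with an explicit suspension functor and an explicit class
of distinguished triangles `X ⟶ Y ⟶ Z ⟶ ΣX`. -/

/-- A suspension functor and a class of (distinguished) triangles. -/
class TriangleStructure (C : Type*) [Category* C] where
  /-- the suspension functor -/
  susp : C ⥤ C
  /-- the class of distinguished triangles -/
  dist {X Y Z : C} (f : X ⟶ Y) (g : Y ⟶ Z) (h : Z ⟶ susp.obj X) : Prop

open TriangleStructure

/-- The suspension and the distinguished triangles of a triangulated category. -/
instance (K : Type u) [Category.{v} K] [Preadditive K] [HasZeroObject K]
    [HasShift K ℤ] [∀ n : ℤ, (shiftFunctor K n).Additive] [Pretriangulated K] :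
    TriangleStructure K where
  susp := shiftFunctor K (1 : ℤ)
  dist f g h := Triangle.mk f g h ∈ distTriang K

/-- The elementary stability properties of distinguished triangles that allow
to define the suspension and the tensor product on Verdier quotients. -/
class TensorStable (C : Type*) [Category* C] [MonoidalCategory C] [TriangleStructure C] :
    Prop where
  dist_of_iso {X Y Z X' Y' Z' : C} {f : X ⟶ Y} {g : Y ⟶ Z} {h : Z ⟶ susp.obj X}
    {f' : X' ⟶ Y'} {g' : Y' ⟶ Z'} {h' : Z' ⟶ susp.obj X'} (a : X ≅ X') (b : Y ≅ Y') (c : Z ≅ Z')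
    (hf : f ≫ b.hom = a.hom ≫ f') (hg : g ≫ c.hom = b.hom ≫ g')
    (hh : h ≫ susp.map a.hom = c.hom ≫ h') : dist f g h → dist f' g' h'
  dist_susp {X Y Z : C} {f : X ⟶ Y} {g : Y ⟶ Z} {h : Z ⟶ susp.obj X} : dist f g h →
    ∃ h', dist (susp.map f) (susp.map g) h'
  dist_whiskerRight {X Y Z : C} {f : X ⟶ Y} {g : Y ⟶ Z} {h : Z ⟶ susp.obj X} (A : C) :
    dist f g h → ∃ h', dist (f ▷ A) (g ▷ A) h'

instance (K : Type u) [Category.{v} K] [Preadditive K] [HasZeroObject K]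
    [HasShift K ℤ] [∀ n : ℤ, (shiftFunctor K n).Additive] [Pretriangulated K]
    [MonoidalCategory K] [SymmetricCategory K] [TensorTriangulated K] : TensorStable K where
  dist_of_iso {X Y Z X' Y' Z' f g h f' g' h'} a b c hf hg hh hd :=
    isomorphic_distinguished _ hd _
      (Triangle.isoMk (Triangle.mk f g h) (Triangle.mk f' g' h') a b c hf hg hh).symm
  dist_susp {X Y Z f g h} hd := ⟨-h⟦(1 : ℤ)⟧', by
    have := rot_of_distTriang _ (rot_of_distTriang _ (rot_of_distTriang _ hd))
    refine isomorphic_distinguished _ this _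
      (Triangle.isoMk _ _ (Iso.refl _)
        (show Y⟦(1 : ℤ)⟧ ≅ Y⟦(1 : ℤ)⟧ from
          { hom := -𝟙 _, inv := -𝟙 _, hom_inv_id := by simp, inv_hom_id := by simp })
        (Iso.refl _) ?_ ?_ ?_)
    · change f⟦(1 : ℤ)⟧' ≫ (-𝟙 (Y⟦(1 : ℤ)⟧)) = 𝟙 (X⟦(1 : ℤ)⟧) ≫ (-f⟦(1 : ℤ)⟧')
      simp
    · change g⟦(1 : ℤ)⟧' ≫ 𝟙 (Z⟦(1 : ℤ)⟧) = (-𝟙 (Y⟦(1 : ℤ)⟧)) ≫ (-g⟦(1 : ℤ)⟧')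
      simp
    · change (-h⟦(1 : ℤ)⟧') ≫ (𝟙 (X⟦(1 : ℤ)⟧))⟦(1 : ℤ)⟧' = 𝟙 (Z⟦(1 : ℤ)⟧) ≫ (-h⟦(1 : ℤ)⟧')
      exact (congrArg _ (CategoryTheory.Functor.map_id _ _)).trans
        ((comp_id _).trans (id_comp _).symm)⟩
  dist_whiskerRight A hd := ⟨_, TensorTriangulated.tensor_distinguished _ hd A⟩

/-! ### Thick tensor-ideals, the spectrum, supports -/

section Spectrum

variable (C : Type*) [Category* C] [MonoidalCategory C] [TriangleStructure C]

/-- Thick tensor-ideals: (full, replete) triangulated subcategories that are closed under direct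
summands and under tensoring with any object. -/
structure IsThickTensorIdeal (J : ObjectProperty C) : Prop where
  zero (X : C) : IsZero X → J X
  susp_iff (X : C) : J (susp.obj X) ↔ J X
  two_of_three₁ {X Y Z : C} {f : X ⟶ Y} {g : Y ⟶ Z} {h : Z ⟶ susp.obj X} :
    dist f g h → J Y → J Z → J X
  two_of_three₂ {X Y Z : C} {f : X ⟶ Y} {g : Y ⟶ Z} {h : Z ⟶ susp.obj X} :
    dist f g h → J X → J Z → J Y
  two_of_three₃ {X Y Z : C} {f : X ⟶ Y} {g : Y ⟶ Z} {h : Z ⟶ susp.obj X} :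
    dist f g h → J X → J Y → J Z
  retract {X Y : C} : Retract X Y → J Y → J X
  tensor_left (A X : C) : J X → J (A ⊗ X)
  tensor_right (X A : C) : J X → J (X ⊗ A)

/-- Prime ideals: proper thick tensor-ideals such that `X ⊗ Y ∈ P` implies `X ∈ P` or `Y ∈ P`. -/
structure IsPrimeIdeal (P : ObjectProperty C) : Prop extends IsThickTensorIdeal C P where
  proper : ∃ X, ¬ P X
  prime (X Y : C) : P (X ⊗ Y) → P X ∨ P Y

/-- The spectrum of a tensor-triangulated category: its set of prime ideals. -/
def Spc := { P : ObjectProperty C // IsPrimeIdeal C P }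

variable {C}

/-- The support of an object: the set of primes that do not contain it. -/
def supp (X : C) : Set (Spc C) := { P | ¬ P.1 X }

/-- The topology on the spectrum: the complements of the supports of
objects are a basis of open subsets. -/
instance : TopologicalSpace (Spc C) :=
  TopologicalSpace.generateFrom (Set.range fun X : C => (supp X)ᶜ)

variable (C) in
/-- Bundled thick tensor-ideals. -/
structure ThickTensorIdeal where
  /-- the underlying class of objects -/
  obj : ObjectProperty C
  isThickTensorIdeal : IsThickTensorIdeal C obj

/-- The thick tensor-ideal `C_Z` of the objects supported on a subset `Z` of the spectrum. -/
def supportedOn (Z : Set (Spc C)) : ThickTensorIdeal C where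
  obj X := supp X ⊆ Z
  isThickTensorIdeal := by
    have key : ∀ X : C, supp X ⊆ Z ↔ ∀ P : Spc C, P ∉ Z → P.1 X := fun X =>
      ⟨fun h P hP => by_contra fun hX => hP (h hX), fun h P hX => by_contra fun hP => hX (h P hP)⟩
    simp only [key]
    exact {
      zero := fun X hX P _ => P.2.zero X hX
      susp_iff := fun X => forall₂_congr fun P _ => P.2.susp_iff X
      two_of_three₁ := fun hd h₁ h₂ P hP => P.2.two_of_three₁ hd (h₁ P hP) (h₂ P hP)
      two_of_three₂ := fun hd h₁ h₂ P hP => P.2.two_of_three₂ hd (h₁ P hP) (h₂ P hP)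
      two_of_three₃ := fun hd h₁ h₂ P hP => P.2.two_of_three₃ hd (h₁ P hP) (h₂ P hP)
      retract := fun r h P hP => P.2.retract r (h P hP)
      tensor_left := fun A X h P hP => P.2.tensor_left A X (h P hP)
      tensor_right := fun X A h P hP => P.2.tensor_right X A (h P hP) }

end Spectrum

/-! ### Verdier quotients -/

section Verdier

variable {C : Type*} [Category* C] [MonoidalCategory C] [TriangleStructure C]

/-- The morphisms with cone in `J`. -/
def coneIn (J : ThickTensorIdeal C) : MorphismProperty C := fun X Y f =>
  ∃ (Z : C) (g : Y ⟶ Z) (h : Z ⟶ susp.obj X), dist f g h ∧ J.obj Z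

/-- The morphisms inverted in the Verdier quotient by `J`: the composites of morphisms with
cone in `J`. (In a triangulated category, those composites have again their cone in `J`, by
the octahedral axiom.) -/
abbrev verdierW (J : ThickTensorIdeal C) : MorphismProperty C :=
  (coneIn J).multiplicativeClosure

variable [TensorStable C]

lemma coneIn_whiskerRight (J : ThickTensorIdeal C) {X Y : C} (f : X ⟶ Y) (hf : coneIn J f)
    (A : C) : coneIn J (f ▷ A) := by
  obtain ⟨Z, g, h, hd, hZ⟩ := hf
  obtain ⟨h', hd'⟩ := TensorStable.dist_whiskerRight A hd
  exact ⟨_, _, h', hd', J.isThickTensorIdeal.tensor_right Z A hZ⟩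

lemma coneIn_susp (J : ThickTensorIdeal C) {X Y : C} (f : X ⟶ Y)
    (hf : coneIn J f) : coneIn J (susp.map f) := by
  obtain ⟨Z, g, h, hd, hZ⟩ := hf
  obtain ⟨h', hd'⟩ := TensorStable.dist_susp hd
  exact ⟨_, _, h', hd', (J.isThickTensorIdeal.susp_iff Z).2 hZ⟩

lemma coneIn_whiskerLeft [SymmetricCategory C] (J : ThickTensorIdeal C) (A : C) {X Y : C} (f : X ⟶ Y)
    (hf : coneIn J f) : coneIn J (A ◁ f) := by
  obtain ⟨Z, g, h, hd, hZ⟩ := coneIn_whiskerRight J f hf A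
  refine ⟨Z, (β_ A Y).hom ≫ g, h ≫ susp.map (β_ X A).hom, ?_, hZ⟩
  refine TensorStable.dist_of_iso (β_ X A) (β_ Y A) (Iso.refl Z) ?_ ?_ ?_ hd
  · simp
  · simp
  · simp

variable [SymmetricCategory C]

instance (J : ThickTensorIdeal C) : (verdierW J).IsMonoidal where
  whiskerLeft A _ _ f hf := by
    induction hf with
    | of f hf => exact .of _ (coneIn_whiskerLeft J A f hf)
    | id X => simpa using .id _
    | comp_of f g _ hg ih => simpa using .comp_of _ _ ih (coneIn_whiskerLeft J A g hg)
  whiskerRight f hf A := by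
    induction hf with
    | of f hf => exact .of _ (coneIn_whiskerRight J f hf A)
    | id X => simpa using .id _
    | comp_of f g _ hg ih => simpa using .comp_of _ _ ih (coneIn_whiskerRight J g hg A)

/-- The Verdier quotient of `C` by `J`, with its symmetric monoidal structure. -/
abbrev VerdierQuotient (J : ThickTensorIdeal C) :=
  LocalizedMonoidal (verdierW J).Q (verdierW J) (Iso.refl _)

/-- The symmetric monoidal localization functor to the Verdier quotient. -/
abbrev verdierFunctor (J : ThickTensorIdeal C) : C ⥤ VerdierQuotient J :=
  Localization.Monoidal.toMonoidalCategory (verdierW J).Q (verdierW J) (Iso.refl _)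

lemma verdierW_susp (J : ThickTensorIdeal C) :
    (verdierW J).IsInvertedBy (susp ⋙ verdierFunctor J) := by
  intro X Y f hf
  refine Localization.inverts (verdierFunctor J) (verdierW J) _ ?_
  induction hf with
  | of f hf => exact .of _ (coneIn_susp J f hf)
  | id X => simpa using .id _
  | comp_of f g _ hg ih => simpa using .comp_of _ _ ih (coneIn_susp J g hg)

/-- The suspension induced on the Verdier quotient. -/
def verdierSusp (J : ThickTensorIdeal C) : VerdierQuotient J ⥤ VerdierQuotient J :=
  Localization.lift _ (verdierW_susp J) (verdierFunctor J)

/-- The localization functor commutes with the suspensions. -/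
def verdierSuspIso (J : ThickTensorIdeal C) :
    verdierFunctor J ⋙ verdierSusp J ≅ susp ⋙ verdierFunctor J :=
  Localization.fac _ (verdierW_susp J) (verdierFunctor J)

/-- The distinguished triangles in the Verdier quotient are the triangles that are isomorphic to
the image of a distinguished triangle. -/
instance (J : ThickTensorIdeal C) : TriangleStructure (VerdierQuotient J) where
  susp := verdierSusp J
  dist {X Y Z} f g h :=
    ∃ (X₀ Y₀ Z₀ : C) (f₀ : X₀ ⟶ Y₀) (g₀ : Y₀ ⟶ Z₀) (h₀ : Z₀ ⟶ susp.obj X₀)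
      (a : (verdierFunctor J).obj X₀ ≅ X) (b : (verdierFunctor J).obj Y₀ ≅ Y)
      (c : (verdierFunctor J).obj Z₀ ≅ Z),
      dist f₀ g₀ h₀ ∧ (verdierFunctor J).map f₀ ≫ b.hom = a.hom ≫ f ∧
        (verdierFunctor J).map g₀ ≫ c.hom = b.hom ≫ g ∧
        (verdierFunctor J).map h₀ ≫ (verdierSuspIso J).inv.app X₀ ≫ (verdierSusp J).map a.hom =
          c.hom ≫ h

end Verdier

/-! ### Idempotent completions -/

section IdempotentCompletion

open Idempotents

variable {C : Type*} [Category* C]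

section Monoidal

variable [MonoidalCategory C]

/-- The tensor product on the idempotent completion is induced by that of `C`. -/
instance : MonoidalCategoryStruct (Karoubi C) where
  tensorObj P Q :=
    { X := P.X ⊗ Q.X
      p := P.p ⊗ₘ Q.p
      idem := by simp only [tensorHom_comp_tensorHom, Karoubi.idem] }
  tensorHom f g :=
    { f := f.f ⊗ₘ g.f
      comm := by simp only [tensorHom_comp_tensorHom, Karoubi.p_comp, Karoubi.comp_p] }
  whiskerLeft P _ _ g :=
    { f := P.p ⊗ₘ g.f
      comm := by simp only [tensorHom_comp_tensorHom, Karoubi.p_comp, Karoubi.comp_p,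
        Karoubi.idem] }
  whiskerRight f Q :=
    { f := f.f ⊗ₘ Q.p
      comm := by simp only [tensorHom_comp_tensorHom, Karoubi.p_comp, Karoubi.comp_p,
        Karoubi.idem] }
  tensorUnit := (toKaroubi C).obj (𝟙_ C)
  associator P Q R :=
    { hom :=
        { f := (α_ P.X Q.X R.X).hom ≫ (P.p ⊗ₘ (Q.p ⊗ₘ R.p))
          comm := by simp only [associator_naturality_assoc, assoc, tensorHom_comp_tensorHom,
            Karoubi.idem] }
      inv :=
        { f := (α_ P.X Q.X R.X).inv ≫ ((P.p ⊗ₘ Q.p) ⊗ₘ R.p)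
          comm := by simp only [associator_inv_naturality_assoc, assoc, tensorHom_comp_tensorHom,
            Karoubi.idem] }
      hom_inv_id := by
        ext
        simp only [Karoubi.comp_f, Karoubi.id_f, assoc, associator_inv_naturality_assoc,
          Iso.hom_inv_id_assoc, tensorHom_comp_tensorHom, Karoubi.idem]
      inv_hom_id := by
        ext
        simp only [Karoubi.comp_f, Karoubi.id_f, assoc, associator_naturality_assoc,
          Iso.inv_hom_id_assoc, tensorHom_comp_tensorHom, Karoubi.idem] }
  leftUnitor P :=
    { hom :=
        { f := (λ_ P.X).hom ≫ P.p
          comm := by simp }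
      inv :=
        { f := P.p ≫ (λ_ P.X).inv
          comm := by simp }
      hom_inv_id := by ext; simp
      inv_hom_id := by ext; simp }
  rightUnitor P :=
    { hom :=
        { f := (ρ_ P.X).hom ≫ P.p
          comm := by simp }
      inv :=
        { f := P.p ≫ (ρ_ P.X).inv
          comm := by simp }
      hom_inv_id := by ext; simp
      inv_hom_id := by ext; simp }

@[simp] lemma karoubi_tensorObj_X (P Q : Karoubi C) : (P ⊗ Q).X = P.X ⊗ Q.X := rfl
@[simp] lemma karoubi_tensorObj_p (P Q : Karoubi C) : (P ⊗ Q).p = P.p ⊗ₘ Q.p := rfl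
@[simp] lemma karoubi_tensorHom_f {P Q P' Q' : Karoubi C} (f : P ⟶ P') (g : Q ⟶ Q') :
    (f ⊗ₘ g).f = f.f ⊗ₘ g.f := rfl
@[simp] lemma karoubi_whiskerLeft_f (P : Karoubi C) {Q Q' : Karoubi C} (g : Q ⟶ Q') :
    (P ◁ g).f = P.p ⊗ₘ g.f := rfl
@[simp] lemma karoubi_whiskerRight_f {P P' : Karoubi C} (f : P ⟶ P') (Q : Karoubi C) :
    (f ▷ Q).f = f.f ⊗ₘ Q.p := rfl
@[simp] lemma karoubi_associator_hom_f (P Q R : Karoubi C) :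
    (α_ P Q R).hom.f = (α_ P.X Q.X R.X).hom ≫ (P.p ⊗ₘ (Q.p ⊗ₘ R.p)) := rfl
@[simp] lemma karoubi_associator_inv_f (P Q R : Karoubi C) :
    (α_ P Q R).inv.f = (α_ P.X Q.X R.X).inv ≫ ((P.p ⊗ₘ Q.p) ⊗ₘ R.p) := rfl
@[simp] lemma karoubi_leftUnitor_hom_f (P : Karoubi C) :
    (λ_ P).hom.f = (λ_ P.X).hom ≫ P.p := rfl
@[simp] lemma karoubi_rightUnitor_hom_f (P : Karoubi C) :
    (ρ_ P).hom.f = (ρ_ P.X).hom ≫ P.p := rfl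
@[simp] lemma karoubi_tensorUnit_X : (𝟙_ (Karoubi C)).X = 𝟙_ C := rfl
@[simp] lemma karoubi_tensorUnit_p : (𝟙_ (Karoubi C)).p = 𝟙 (𝟙_ C) := rfl

instance : MonoidalCategory (Karoubi C) :=
  .ofTensorHom
    (id_tensorHom_id := fun _ _ => rfl)
    (id_tensorHom := fun _ _ _ _ => rfl)
    (tensorHom_id := fun _ _ => rfl)
    (tensorHom_comp_tensorHom := fun _ _ _ _ => by ext; simp)
    (associator_naturality := fun f₁ f₂ f₃ => by
      ext
      simp only [Karoubi.comp_f, karoubi_tensorHom_f, karoubi_associator_hom_f,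
        associator_naturality_assoc, tensorHom_comp_tensorHom, Karoubi.comp_p, Karoubi.p_comp,
        assoc])
    (leftUnitor_naturality := fun f => by
      ext
      simp)
    (rightUnitor_naturality := fun f => by
      ext
      simp)
    (pentagon := fun W X Y Z => by
      ext
      have h₁ : ((α_ W.X X.X Y.X).hom ≫ (W.p ⊗ₘ (X.p ⊗ₘ Y.p))) ⊗ₘ Z.p =
          (α_ W.X X.X Y.X).hom ▷ Z.X ≫ ((W.p ⊗ₘ (X.p ⊗ₘ Y.p)) ⊗ₘ Z.p) := by
        rw [← tensorHom_id, tensorHom_comp_tensorHom, id_comp]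
      have h₂ : W.p ⊗ₘ ((α_ X.X Y.X Z.X).hom ≫ (X.p ⊗ₘ (Y.p ⊗ₘ Z.p))) =
          W.X ◁ (α_ X.X Y.X Z.X).hom ≫ (W.p ⊗ₘ (X.p ⊗ₘ (Y.p ⊗ₘ Z.p))) := by
        rw [← id_tensorHom, tensorHom_comp_tensorHom, id_comp]
      have h₃ : (W.p ⊗ₘ ((X.p ⊗ₘ Y.p) ⊗ₘ Z.p)) ≫ W.X ◁ (α_ X.X Y.X Z.X).hom =
          W.X ◁ (α_ X.X Y.X Z.X).hom ≫ (W.p ⊗ₘ (X.p ⊗ₘ (Y.p ⊗ₘ Z.p))) := by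
        rw [← id_tensorHom, tensorHom_comp_tensorHom, tensorHom_comp_tensorHom,
          associator_naturality, id_comp, comp_id]
      simp only [Karoubi.comp_f, karoubi_tensorHom_f, karoubi_associator_hom_f,
        Karoubi.id_f, karoubi_tensorObj_p, karoubi_tensorObj_X, assoc, h₁, h₂,
        associator_naturality_assoc, tensorHom_comp_tensorHom,
        Karoubi.idem, reassoc_of% h₃, pentagon_assoc])
    (triangle := fun X Y => by
      ext
      have h₁ : X.p ⊗ₘ ((λ_ Y.X).hom ≫ Y.p) = X.X ◁ (λ_ Y.X).hom ≫ (X.p ⊗ₘ Y.p) := by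
        rw [← id_tensorHom, tensorHom_comp_tensorHom, id_comp]
      have h₂ : ((ρ_ X.X).hom ≫ X.p) ⊗ₘ Y.p = (ρ_ X.X).hom ▷ Y.X ≫ (X.p ⊗ₘ Y.p) := by
        rw [← tensorHom_id, tensorHom_comp_tensorHom, id_comp]
      have h₃ : (X.p ⊗ₘ (𝟙 (𝟙_ C) ⊗ₘ Y.p)) ≫ X.X ◁ (λ_ Y.X).hom =
          X.X ◁ (λ_ Y.X).hom ≫ (X.p ⊗ₘ Y.p) := by
        rw [← id_tensorHom, tensorHom_comp_tensorHom, id_tensorHom (𝟙_ C),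
          leftUnitor_naturality, tensorHom_comp_tensorHom, id_comp, comp_id]
      simp only [Karoubi.comp_f, karoubi_tensorHom_f, karoubi_associator_hom_f,
        Karoubi.id_f, karoubi_leftUnitor_hom_f, karoubi_rightUnitor_hom_f,
        karoubi_tensorUnit_p, karoubi_tensorUnit_X, assoc, h₁, h₂, reassoc_of% h₃,
        triangle_assoc, tensorHom_comp_tensorHom, Karoubi.idem])

/-- The braiding on the idempotent completion is induced by that of `C`. -/
def karoubiBraiding [BraidedCategory C] (P Q : Karoubi C) : P ⊗ Q ≅ Q ⊗ P where
  hom :=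
    { f := (β_ P.X Q.X).hom ≫ (Q.p ⊗ₘ P.p)
      comm := by
        simp only [karoubi_tensorObj_p, assoc, BraidedCategory.braiding_naturality_assoc,
          tensorHom_comp_tensorHom, Karoubi.idem] }
  inv :=
    { f := (β_ P.X Q.X).inv ≫ (P.p ⊗ₘ Q.p)
      comm := by
        simp only [karoubi_tensorObj_p, assoc, BraidedCategory.braiding_inv_naturality_assoc,
          tensorHom_comp_tensorHom, Karoubi.idem] }
  hom_inv_id := by
    ext
    simp only [Karoubi.comp_f, Karoubi.id_f, karoubi_tensorObj_p, assoc,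
      BraidedCategory.braiding_inv_naturality_assoc, Iso.hom_inv_id_assoc,
      tensorHom_comp_tensorHom, Karoubi.idem]
  inv_hom_id := by
    ext
    simp only [Karoubi.comp_f, Karoubi.id_f, karoubi_tensorObj_p, assoc,
      BraidedCategory.braiding_naturality_assoc, Iso.inv_hom_id_assoc,
      tensorHom_comp_tensorHom, Karoubi.idem]

lemma karoubiBraiding_hom_f [BraidedCategory C] (P Q : Karoubi C) :
    (karoubiBraiding P Q).hom.f = (β_ P.X Q.X).hom ≫ (Q.p ⊗ₘ P.p) := rfl

lemma comp_tensorHom' {X X' X'' Y Y' : C} (f : X ⟶ X') (f' : X' ⟶ X'') (g : Y ⟶ Y') :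
    (f ≫ f') ⊗ₘ g = f ▷ Y ≫ (f' ⊗ₘ g) := by
  rw [← tensorHom_id, tensorHom_comp_tensorHom, id_comp]

lemma tensorHom_comp' {X X' Y Y' Y'' : C} (f : X ⟶ X') (g : Y ⟶ Y') (g' : Y' ⟶ Y'') :
    f ⊗ₘ (g ≫ g') = X ◁ g ≫ (f ⊗ₘ g') := by
  rw [← id_tensorHom, tensorHom_comp_tensorHom, id_comp]

instance [BraidedCategory C] : BraidedCategory (Karoubi C) where
  braiding := karoubiBraiding
  braiding_naturality_right P Q Q' f := by
    ext
    simp only [Karoubi.comp_f, karoubi_whiskerLeft_f, karoubi_whiskerRight_f,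
      karoubiBraiding_hom_f, BraidedCategory.braiding_naturality_assoc, assoc,
      tensorHom_comp_tensorHom, Karoubi.idem, Karoubi.comp_p, Karoubi.p_comp]
  braiding_naturality_left f Q := by
    ext
    simp only [Karoubi.comp_f, karoubi_whiskerLeft_f, karoubi_whiskerRight_f,
      karoubiBraiding_hom_f, BraidedCategory.braiding_naturality_assoc, assoc,
      tensorHom_comp_tensorHom, Karoubi.idem, Karoubi.comp_p, Karoubi.p_comp]
  hexagon_forward P Q R := by
    ext
    have h : (Q.p ⊗ₘ (P.p ⊗ₘ R.p)) ≫ Q.X ◁ (β_ P.X R.X).hom =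
        Q.X ◁ (β_ P.X R.X).hom ≫ (Q.p ⊗ₘ (R.p ⊗ₘ P.p)) := by
      rw [← id_tensorHom, tensorHom_comp_tensorHom, tensorHom_comp_tensorHom,
        BraidedCategory.braiding_naturality, id_comp, comp_id]
    simp only [Karoubi.comp_f, karoubi_whiskerLeft_f, karoubi_whiskerRight_f,
      karoubiBraiding_hom_f, karoubi_associator_hom_f, karoubi_tensorObj_p, karoubi_tensorObj_X,
      BraidedCategory.braiding_naturality_assoc, associator_naturality_assoc, assoc,
      tensorHom_comp_tensorHom, Karoubi.idem, comp_tensorHom', tensorHom_comp',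
      reassoc_of% h, BraidedCategory.hexagon_forward_assoc]
  hexagon_reverse P Q R := by
    ext
    have h : ((P.p ⊗ₘ R.p) ⊗ₘ Q.p) ≫ (β_ P.X R.X).hom ▷ Q.X =
        (β_ P.X R.X).hom ▷ Q.X ≫ ((R.p ⊗ₘ P.p) ⊗ₘ Q.p) := by
      rw [← tensorHom_id, tensorHom_comp_tensorHom, tensorHom_comp_tensorHom,
        BraidedCategory.braiding_naturality, id_comp, comp_id]
    simp only [Karoubi.comp_f, karoubi_whiskerLeft_f, karoubi_whiskerRight_f,
      karoubiBraiding_hom_f, karoubi_associator_inv_f, karoubi_tensorObj_p, karoubi_tensorObj_X,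
      BraidedCategory.braiding_naturality_assoc, associator_inv_naturality_assoc, assoc,
      tensorHom_comp_tensorHom, Karoubi.idem, comp_tensorHom', tensorHom_comp',
      reassoc_of% h, BraidedCategory.hexagon_reverse_assoc]

/-- The symmetry on the idempotent completion. -/
instance [SymmetricCategory C] : SymmetricCategory (Karoubi C) where
  symmetry P Q := by
    ext
    change ((β_ P.X Q.X).hom ≫ (Q.p ⊗ₘ P.p)) ≫ (β_ Q.X P.X).hom ≫ (P.p ⊗ₘ Q.p) = P.p ⊗ₘ Q.p
    simp only [assoc, BraidedCategory.braiding_naturality_assoc, tensorHom_comp_tensorHom,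
      Karoubi.idem, SymmetricCategory.symmetry_assoc]

/-- The canonical functor to the idempotent completion is symmetric monoidal. -/
instance : (toKaroubi C).Monoidal :=
  Functor.CoreMonoidal.toMonoidal
    { εIso := Iso.refl _
      μIso := fun X Y =>
        { hom := { f := 𝟙 _ }
          inv := { f := 𝟙 _ } } }

instance [SymmetricCategory C] : (toKaroubi C).Braided where
  braided X Y := by
    ext
    change 𝟙 _ ≫ (β_ X Y).hom = ((β_ X Y).hom ≫ (𝟙 _ ⊗ₘ 𝟙 _)) ≫ 𝟙 _
    simp

end Monoidal

/-- The suspension on the idempotent completion is induced by that of `C`, and its distinguished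
triangles are the direct summands of distinguished triangles of `C`. -/
instance [TriangleStructure C] : TriangleStructure (Karoubi C) where
  susp := (functorExtension₂ C C).obj susp
  dist {X Y Z} f g h :=
    ∃ (X₀ Y₀ Z₀ : C) (f₀ : X₀ ⟶ Y₀) (g₀ : Y₀ ⟶ Z₀) (h₀ : Z₀ ⟶ susp.obj X₀)
      (a : Retract X ((toKaroubi C).obj X₀)) (b : Retract Y ((toKaroubi C).obj Y₀))
      (c : Retract Z ((toKaroubi C).obj Z₀)),
      dist f₀ g₀ h₀ ∧
        f.f ≫ b.i.f = a.i.f ≫ f₀ ∧ f₀ ≫ b.r.f = a.r.f ≫ f.f ∧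
        g.f ≫ c.i.f = b.i.f ≫ g₀ ∧ g₀ ≫ c.r.f = b.r.f ≫ g.f ∧
        h.f ≫ susp.map a.i.f = c.i.f ≫ h₀ ∧ h₀ ≫ susp.map a.r.f = c.r.f ≫ h.f

end IdempotentCompletion

/-! ### The tensor-triangulated category `C(U)` -/

section Local

variable {C : Type*} [Category* C] [MonoidalCategory C] [SymmetricCategory C]
  [TriangleStructure C] [TensorStable C]

/-- The tensor-triangulated category `C(U)`, for a subset `U` of the spectrum of `C`: the idempotent
completion of the Verdier quotient of `C` by the objects supported on the complement of `U`. -/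
abbrev LocalCategory (U : Set (Spc C)) := Idempotents.Karoubi (VerdierQuotient (supportedOn Uᶜ))

/-- The restriction functor `C ⥤ C(U)`. -/
abbrev res (U : Set (Spc C)) : C ⥤ LocalCategory U :=
  verdierFunctor (supportedOn Uᶜ) ⋙ Idempotents.toKaroubi _

end Local

/-! ### Tensor-triangulated equivalences and induced maps on spectra -/

/-- A tensor-triangulated equivalence: an equivalence of categories which is (strong) symmetric
monoidal, commutes with the suspensions, and identifies the distinguished triangles. -/
structure TTEquivalence (C D : Type*) [Category* C] [Category* D] [MonoidalCategory C]
    [MonoidalCategory D] [SymmetricCategory C] [SymmetricCategory D] [TriangleStructure C]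
    [TriangleStructure D] where
  /-- the underlying functor -/
  functor : C ⥤ D
  isEquivalence : functor.IsEquivalence
  [braided : functor.Braided]
  /-- the commutation with the suspensions -/
  suspIso : susp ⋙ functor ≅ functor ⋙ susp
  dist_iff {X Y Z : C} (f : X ⟶ Y) (g : Y ⟶ Z) (h : Z ⟶ susp.obj X) :
    dist (functor.map f) (functor.map g) (functor.map h ≫ suspIso.hom.app X) ↔ dist f g h

attribute [instance] TTEquivalence.braided

/-- The map `φ` is the map `Spc(F) : P ↦ F⁻¹(P)` induced on the spectra by a functor `F`. -/
def IsSpcMap {C D : Type*} [Category* C] [Category* D] [MonoidalCategory C]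
    [MonoidalCategory D] [TriangleStructure C] [TriangleStructure D]
    (F : C ⥤ D) (φ : Spc D → Spc C) : Prop :=
  ∀ (P : Spc D) (X : C), (φ P).1 X ↔ P.1 (F.obj X)

/-! ### Relative stable categories -/

section Coevaluation

variable {K : Type u} [Category.{v} K] [Preadditive K] [MonoidalCategory K] [HasZeroObject K]
  [HasShift K ℤ] [∀ n : ℤ, (shiftFunctor K n).Additive] [Pretriangulated K] (B : K) [HasLeftDual B]

/-- The coevaluation `𝟙 ⟶ B^∨ ⊗ B`. -/
abbrev coev : 𝟙_ K ⟶ HasLeftDual.leftDual B ⊗ B :=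
  ExactPairing.coevaluation (HasLeftDual.leftDual B) B

/-- The cone of the coevaluation. -/
def coevCone : K := (distinguished_cocone_triangle (coev B)).choose

/-- The second morphism of a distinguished triangle on the coevaluation. -/
def coevConeIn : HasLeftDual.leftDual B ⊗ B ⟶ coevCone B :=
  (distinguished_cocone_triangle (coev B)).choose_spec.choose

/-- The third morphism of a distinguished triangle on the coevaluation. -/
def coevConeOut : coevCone B ⟶ (𝟙_ K)⟦(1 : ℤ)⟧ :=
  (distinguished_cocone_triangle (coev B)).choose_spec.choose_spec.choose

lemma coevCone_distinguished :
    Triangle.mk (coev B) (coevConeIn B) (coevConeOut B) ∈ distTriang K :=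
  (distinguished_cocone_triangle (coev B)).choose_spec.choose_spec.choose_spec

variable [SymmetricCategory K] [TensorTriangulated K]

/-- The preenvelope `X ⟶ (B^∨ ⊗ B) ⊗ X` of `X` in `add(B ⊗ K)`, relative to the triangles that
are split by `B ⊗ -`. -/
def preenvelope (X : K) : X ⟶ (HasLeftDual.leftDual B ⊗ B) ⊗ X :=
  (λ_ X).inv ≫ coev B ▷ X

/-- After tensoring with `B`, the preenvelope of `X` becomes a split monomorphism. -/
lemma preenvelope_split (X : K) :
    ∃ r : B ⊗ ((HasLeftDual.leftDual B ⊗ B) ⊗ X) ⟶ B ⊗ X, B ◁ preenvelope B X ≫ r = 𝟙 _ := by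
  refine ⟨(α_ _ _ _).inv ≫ ((α_ _ _ _).inv ≫ ExactPairing.evaluation _ B ▷ B ≫
    (λ_ B).hom) ▷ X, ?_⟩
  have h := ExactPairing.coevaluation_evaluation (HasLeftDual.leftDual B) B
  have h' : (B ◁ coev B ≫ (α_ _ _ _).inv ≫ ExactPairing.evaluation _ B ▷ B ≫ (λ_ B).hom) =
      (ρ_ B).hom := by
    rw [reassoc_of% h, Iso.inv_hom_id, comp_id]
  rw [preenvelope, MonoidalCategory.whiskerLeft_comp, assoc,
    associator_inv_naturality_middle_assoc, ← comp_whiskerRight, h']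
  simp

/-- The connecting morphism of the distinguished triangle on the preenvelope of `X`,
whose cofibre is `cone(coev) ⊗ X`. -/
def preenvelopeConn (X : K) : coevCone B ⊗ X ⟶ X⟦(1 : ℤ)⟧ :=
  coevConeOut B ▷ X ≫ (TensorTriangulated.shiftTensor (𝟙_ K) X).hom ≫ (λ_ X).hom⟦(1 : ℤ)⟧'

lemma preenvelope_distinguished (X : K) :
    Triangle.mk (preenvelope B X) (coevConeIn B ▷ X) (preenvelopeConn B X) ∈ distTriang K := by
  refine isomorphic_distinguished _
    (TensorTriangulated.tensor_distinguished _ (coevCone_distinguished B) X) _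
    (Triangle.isoMk _ _ (λ_ X).symm (Iso.refl _) (Iso.refl _) ?_ ?_ ?_)
  · exact (comp_id _).trans rfl
  · exact (comp_id _).trans (id_comp _).symm
  · change (coevConeOut B ▷ X ≫ (TensorTriangulated.shiftTensor (𝟙_ K) X).hom ≫
      (λ_ X).hom⟦(1 : ℤ)⟧') ≫ (λ_ X).inv⟦(1 : ℤ)⟧' =
        𝟙 _ ≫ coevConeOut B ▷ X ≫ (TensorTriangulated.shiftTensor (𝟙_ K) X).hom
    rw [assoc, assoc, ← Functor.map_comp, Iso.hom_inv_id, CategoryTheory.Functor.map_id, comp_id, id_comp]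

lemma preenvelopeConn_whiskerRight (X A : K) :
    preenvelopeConn B X ▷ A ≫ (TensorTriangulated.shiftTensor X A).hom =
      (α_ _ X A).hom ≫ preenvelopeConn B (X ⊗ A) := by
  have h := TensorTriangulated.shiftTensor_assoc (𝟙_ K) X A
  have h' : (λ_ (X ⊗ A)).hom = (α_ (𝟙_ K) X A).inv ≫ (λ_ X).hom ▷ A := by simp
  simp only [preenvelopeConn, comp_whiskerRight, assoc,
    TensorTriangulated.shiftTensor_natural_left, h', Functor.map_comp]
  rw [← associator_naturality_left_assoc, ← reassoc_of% h, ← Functor.map_comp_assoc,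
    Iso.hom_inv_id, CategoryTheory.Functor.map_id, id_comp]

end Coevaluation

section Stable

variable {K : Type u} [Category.{v} K] [Preadditive K] [MonoidalCategory K]

/-- `add(B ⊗ K)`: the direct summands of the objects `B ⊗ X` (the objects `B ⊗ X` are already
stable under finite direct sums). -/
def addTensor (B : K) : ObjectProperty K := fun P => ∃ X : K, Nonempty (Retract P (B ⊗ X))

/-- Two parallel morphisms are identified in the stable category if their difference factors
through an object of `add(B ⊗ K)`. -/
def stableRel (B : K) : HomRel K := fun X Y f g =>
  ∃ (P : K) (a : X ⟶ P) (b : P ⟶ Y), addTensor B P ∧ a ≫ b = f - g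

/-- The stable category of `K` relative to `B`: the additive quotient `K / add(B ⊗ K)`. -/
abbrev StableCategory (B : K) := CategoryTheory.Quotient (stableRel B)

/-- The quotient functor `π`. -/
abbrev stableFunctor (B : K) : K ⥤ StableCategory B := CategoryTheory.Quotient.functor (stableRel B)

lemma stableRel_iff (B : K) {X Y : K} (f g : X ⟶ Y) :
    stableRel B f g ↔ ∃ (Z : K) (a : X ⟶ B ⊗ Z) (b : B ⊗ Z ⟶ Y), a ≫ b = f - g := by
  constructor
  · rintro ⟨P, a, b, ⟨Z, ⟨r⟩⟩, h⟩
    exact ⟨Z, a ≫ r.i, r.r ≫ b, by simp [h]⟩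
  · rintro ⟨Z, a, b, h⟩
    exact ⟨_, a, b, ⟨Z, ⟨Retract.refl _⟩⟩, h⟩

variable [MonoidalPreadditive K]

instance [HasBinaryBiproducts K] (B : K) : Congruence (stableRel B) where
  equivalence :=
    { refl := fun f => (stableRel_iff B _ _).2 ⟨𝟙_ K, 0, 0, by simp⟩
      symm := fun {f g} h => by
        obtain ⟨Z, a, b, h⟩ := (stableRel_iff B _ _).1 h
        exact (stableRel_iff B _ _).2 ⟨Z, a, -b, by simp [h]⟩
      trans := fun {f g k} h h' => by
        obtain ⟨Z, a, b, h⟩ := (stableRel_iff B _ _).1 h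
        obtain ⟨Z', a', b', h'⟩ := (stableRel_iff B _ _).1 h'
        refine (stableRel_iff B _ _).2 ⟨Z ⊞ Z', a ≫ B ◁ biprod.inl + a' ≫ B ◁ biprod.inr,
          B ◁ biprod.fst ≫ b + B ◁ biprod.snd ≫ b', ?_⟩
        simp [← MonoidalCategory.whiskerLeft_comp_assoc, h, h'] }
  comp_left f g g' h := by
    obtain ⟨Z, a, b, h⟩ := (stableRel_iff B _ _).1 h
    exact (stableRel_iff B _ _).2 ⟨Z, f ≫ a, b, by simp [h]⟩
  comp_right g h := by
    obtain ⟨Z, a, b, h⟩ := (stableRel_iff B _ _).1 h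
    exact (stableRel_iff B _ _).2 ⟨Z, a, b ≫ g, by simp [reassoc_of% h]⟩

lemma stableRel_whiskerRight (B : K) {X Y : K} {f g : X ⟶ Y} (h : stableRel B f g) (A : K) :
    stableRel B (f ▷ A) (g ▷ A) := by
  obtain ⟨Z, a, b, h⟩ := (stableRel_iff B _ _).1 h
  exact (stableRel_iff B _ _).2 ⟨Z ⊗ A, a ▷ A ≫ (α_ _ _ _).hom, (α_ _ _ _).inv ≫ b ▷ A, by
    rw [assoc, Iso.hom_inv_id_assoc, ← comp_whiskerRight, h]
    exact (tensorRight A).map_sub⟩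

lemma stableRel_whiskerLeft [BraidedCategory K] (B : K) {X Y : K} {f g : X ⟶ Y}
    (h : stableRel B f g) (A : K) : stableRel B (A ◁ f) (A ◁ g) := by
  obtain ⟨Z, a, b, h⟩ := (stableRel_iff B _ _).1 (stableRel_whiskerRight B h A)
  exact (stableRel_iff B _ _).2 ⟨Z, (β_ A X).hom ≫ a, b ≫ (β_ A Y).inv, by
    simp [reassoc_of% h]⟩

section Monoidal

variable [SymmetricCategory K] (B : K)

/-- The tensor product on the stable category is induced by that of `K`. -/
instance : MonoidalCategoryStruct (StableCategory B) where
  tensorObj X Y := (stableFunctor B).obj (X.as ⊗ Y.as)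
  whiskerLeft X _ _ g :=
    (CategoryTheory.Quotient.lift (stableRel B) (tensorLeft X.as ⋙ stableFunctor B)
      (fun _ _ _ _ h => CategoryTheory.Quotient.sound _ (stableRel_whiskerLeft B h X.as))).map g
  whiskerRight f Y :=
    (CategoryTheory.Quotient.lift (stableRel B) (tensorRight Y.as ⋙ stableFunctor B)
      (fun _ _ _ _ h => CategoryTheory.Quotient.sound _ (stableRel_whiskerRight B h Y.as))).map f
  tensorHom {_ Y₁ X₂ _} f g :=
    (CategoryTheory.Quotient.lift (stableRel B) (tensorRight X₂.as ⋙ stableFunctor B)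
      (fun _ _ _ _ h => CategoryTheory.Quotient.sound _
        (stableRel_whiskerRight B h X₂.as))).map f ≫
    (CategoryTheory.Quotient.lift (stableRel B) (tensorLeft Y₁.as ⋙ stableFunctor B)
      (fun _ _ _ _ h => CategoryTheory.Quotient.sound _ (stableRel_whiskerLeft B h Y₁.as))).map g
  tensorUnit := (stableFunctor B).obj (𝟙_ K)
  associator X Y Z := (stableFunctor B).mapIso (α_ X.as Y.as Z.as)
  leftUnitor X := (stableFunctor B).mapIso (λ_ X.as)
  rightUnitor X := (stableFunctor B).mapIso (ρ_ X.as)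

instance : MonoidalCategory (StableCategory B) where
  tensorHom_def _ _ := rfl
  id_tensorHom_id X Y := congrArg (stableFunctor B).map
    ((MonoidalCategory.tensorHom_def (𝟙 X.as) (𝟙 Y.as)).symm.trans (id_tensorHom_id X.as Y.as))
  tensorHom_comp_tensorHom := by
    rintro ⟨X₁⟩ ⟨Y₁⟩ ⟨Z₁⟩ ⟨X₂⟩ ⟨Y₂⟩ ⟨Z₂⟩ ⟨f₁⟩ ⟨f₂⟩ ⟨g₁⟩ ⟨g₂⟩
    exact congrArg (stableFunctor B).map
      (show (f₁ ▷ X₂ ≫ Y₁ ◁ f₂) ≫ g₁ ▷ Y₂ ≫ Z₁ ◁ g₂ = (f₁ ≫ g₁) ▷ X₂ ≫ Z₁ ◁ (f₂ ≫ g₂) by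
        simp only [← MonoidalCategory.tensorHom_def, tensorHom_comp_tensorHom])
  whiskerLeft_id X Y := congrArg (stableFunctor B).map (whiskerLeft_id X.as Y.as)
  id_whiskerRight X Y := congrArg (stableFunctor B).map (id_whiskerRight X.as Y.as)
  associator_naturality := by
    rintro ⟨X₁⟩ ⟨X₂⟩ ⟨X₃⟩ ⟨Y₁⟩ ⟨Y₂⟩ ⟨Y₃⟩ ⟨f₁⟩ ⟨f₂⟩ ⟨f₃⟩
    exact congrArg (stableFunctor B).map
      (show ((f₁ ▷ X₂ ≫ Y₁ ◁ f₂) ▷ X₃ ≫ (Y₁ ⊗ Y₂) ◁ f₃) ≫ (α_ Y₁ Y₂ Y₃).hom =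
        (α_ X₁ X₂ X₃).hom ≫ f₁ ▷ (X₂ ⊗ X₃) ≫ Y₁ ◁ (f₂ ▷ X₃ ≫ Y₂ ◁ f₃) by
        simp only [← MonoidalCategory.tensorHom_def, associator_naturality])
  leftUnitor_naturality := by
    rintro ⟨X⟩ ⟨Y⟩ ⟨f⟩
    exact congrArg (stableFunctor B).map (leftUnitor_naturality f)
  rightUnitor_naturality := by
    rintro ⟨X⟩ ⟨Y⟩ ⟨f⟩
    exact congrArg (stableFunctor B).map (rightUnitor_naturality f)
  pentagon W X Y Z := congrArg (stableFunctor B).map (pentagon W.as X.as Y.as Z.as)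
  triangle X Y := congrArg (stableFunctor B).map (triangle X.as Y.as)

/-- The symmetry on the stable category is induced by that of `K`. -/
instance : SymmetricCategory (StableCategory B) where
  braiding X Y :=
    { hom := (stableFunctor B).map (β_ X.as Y.as).hom
      inv := (stableFunctor B).map (β_ X.as Y.as).inv
      hom_inv_id := congrArg (stableFunctor B).map (β_ X.as Y.as).hom_inv_id
      inv_hom_id := congrArg (stableFunctor B).map (β_ X.as Y.as).inv_hom_id }
  braiding_naturality_right := by
    rintro ⟨X⟩ ⟨Y⟩ ⟨Z⟩ ⟨f⟩
    exact congrArg (stableFunctor B).map (BraidedCategory.braiding_naturality_right X f)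
  braiding_naturality_left := by
    rintro ⟨X⟩ ⟨Y⟩ ⟨f⟩ ⟨Z⟩
    exact congrArg (stableFunctor B).map (BraidedCategory.braiding_naturality_left f Z)
  hexagon_forward X Y Z := congrArg (stableFunctor B).map
    (BraidedCategory.hexagon_forward X.as Y.as Z.as)
  hexagon_reverse X Y Z := congrArg (stableFunctor B).map
    (BraidedCategory.hexagon_reverse X.as Y.as Z.as)
  symmetry X Y := congrArg (stableFunctor B).map (SymmetricCategory.symmetry X.as Y.as)

/-- The quotient functor is symmetric monoidal. -/
instance : (stableFunctor B).Monoidal :=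
  Functor.CoreMonoidal.toMonoidal
    { εIso := Iso.refl _
      μIso := fun X Y => Iso.refl ((stableFunctor B).obj (X ⊗ Y))
      μIso_hom_natural_left := fun _ _ => (comp_id _).trans (id_comp _).symm
      μIso_hom_natural_right := fun _ _ => (comp_id _).trans (id_comp _).symm
      associativity := fun X Y Z => congrArg (stableFunctor B).map
        (show 𝟙 (X ⊗ Y) ▷ Z ≫ 𝟙 ((X ⊗ Y) ⊗ Z) ≫ (α_ X Y Z).hom =
          (α_ X Y Z).hom ≫ X ◁ 𝟙 (Y ⊗ Z) ≫ 𝟙 (X ⊗ (Y ⊗ Z)) by simp)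
      left_unitality := fun X => congrArg (stableFunctor B).map
        (show (λ_ X).hom = 𝟙 (𝟙_ K) ▷ X ≫ 𝟙 (𝟙_ K ⊗ X) ≫ (λ_ X).hom by simp)
      right_unitality := fun X => congrArg (stableFunctor B).map
        (show (ρ_ X).hom = X ◁ 𝟙 (𝟙_ K) ≫ 𝟙 (X ⊗ 𝟙_ K) ≫ (ρ_ X).hom by simp) }

instance : (stableFunctor B).Braided where
  braided _ _ := (id_comp _).trans (comp_id _).symm

end Monoidal

section Triangles

variable [HasZeroObject K] [HasShift K ℤ] [∀ n : ℤ, (shiftFunctor K n).Additive]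
  [Pretriangulated K] [SymmetricCategory K] [TensorTriangulated K] (B : K) [HasLeftDual B]

/-- The triangulation of the stable category. The suspension of `X` is the cofibre in `K` of its
preenvelope `X ⟶ (B^∨ ⊗ B) ⊗ X`, that is, `cone(coev) ⊗ X`. The basic distinguished triangle
`X ⟶ Y ⟶ Z ⟶ cone(coev) ⊗ X` over `f : X ⟶ Y` is given by the homotopy pushout of the preenvelope
of `X` along `f`. This means that `Y ⟶ Z ⟶ cone(coev) ⊗ X ⟶ ΣY` is the distinguished triangle
in `K` whose last morphism is the composite of `Σf` with the connecting morphism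
`cone(coev) ⊗ X ⟶ ΣX` of the distinguished triangle on the preenvelope of `X`.
The distinguished triangles are those that are isomorphic in the stable category to a basic one. -/
instance : TriangleStructure (StableCategory B) where
  susp := tensorLeft ((stableFunctor B).obj (coevCone B))
  dist {X Y Z} f g h :=
    ∃ (X₀ Y₀ Z₀ : K) (f₀ : X₀ ⟶ Y₀) (g₀ : Y₀ ⟶ Z₀) (h₀ : Z₀ ⟶ coevCone B ⊗ X₀)
      (a : (stableFunctor B).obj X₀ ≅ X) (b : (stableFunctor B).obj Y₀ ≅ Y)
      (c : (stableFunctor B).obj Z₀ ≅ Z),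
      Triangle.mk g₀ h₀ (preenvelopeConn B X₀ ≫ f₀⟦(1 : ℤ)⟧') ∈ distTriang K ∧
        (stableFunctor B).map f₀ ≫ b.hom = a.hom ≫ f ∧
        (stableFunctor B).map g₀ ≫ c.hom = b.hom ≫ g ∧
        (stableFunctor B).map h₀ ≫ (stableFunctor B).obj (coevCone B) ◁ a.hom = c.hom ≫ h

instance : TensorStable (StableCategory B) := by
  have hiso : ∀ {X Y Z X' Y' Z' : StableCategory B} {f : X ⟶ Y} {g : Y ⟶ Z}
      {h : Z ⟶ susp.obj X} {f' : X' ⟶ Y'} {g' : Y' ⟶ Z'} {h' : Z' ⟶ susp.obj X'}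
      (a : X ≅ X') (b : Y ≅ Y') (c : Z ≅ Z')
      (_ : f ≫ b.hom = a.hom ≫ f') (_ : g ≫ c.hom = b.hom ≫ g')
      (_ : h ≫ susp.map a.hom = c.hom ≫ h'), dist f g h → dist f' g' h' := by
    rintro X Y Z X' Y' Z' f g h f' g' h' a b c hf hg hh
      ⟨X₀, Y₀, Z₀, f₀, g₀, h₀, a₀, b₀, c₀, hd, hf₀, hg₀, hh₀⟩
    refine ⟨X₀, Y₀, Z₀, f₀, g₀, h₀, a₀ ≪≫ a, b₀ ≪≫ b, c₀ ≪≫ c, hd, ?_, ?_, ?_⟩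
    · simp only [Iso.trans_hom, assoc, reassoc_of% hf₀, hf]
    · simp only [Iso.trans_hom, assoc, reassoc_of% hg₀, hg]
    · rw [Iso.trans_hom, MonoidalCategory.whiskerLeft_comp, Iso.trans_hom, assoc, ← hh,
        ← assoc, hh₀, assoc]
      rfl
  have hwhisker : ∀ {X Y Z : StableCategory B} {f : X ⟶ Y} {g : Y ⟶ Z}
      {h : Z ⟶ susp.obj X} (A : StableCategory B), dist f g h →
        ∃ h', dist (f ▷ A) (g ▷ A) h' := by
    rintro X Y Z f g h A ⟨X₀, Y₀, Z₀, f₀, g₀, h₀, a, b, c, hd, hf, hg, hh⟩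
    let h₁ : Z₀ ⊗ A.as ⟶ coevCone B ⊗ (X₀ ⊗ A.as) := h₀ ▷ A.as ≫ (α_ _ _ _).hom
    refine ⟨(whiskerRightIso c A).inv ≫ (stableFunctor B).map h₁ ≫
      (stableFunctor B).obj (coevCone B) ◁ (whiskerRightIso a A).hom,
      X₀ ⊗ A.as, Y₀ ⊗ A.as, Z₀ ⊗ A.as, f₀ ▷ A.as, g₀ ▷ A.as, h₁,
      whiskerRightIso a A, whiskerRightIso b A, whiskerRightIso c A, ?_, ?_, ?_, ?_⟩
    · refine isomorphic_distinguished _ (TensorTriangulated.tensor_distinguished _ hd A.as) _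
        (Triangle.isoMk _ _ (Iso.refl _) (Iso.refl _) (α_ _ _ _).symm ?_ ?_ ?_)
      · exact (comp_id _).trans (id_comp _).symm
      · change (h₀ ▷ A.as ≫ (α_ _ _ _).hom) ≫ (α_ _ _ _).inv = 𝟙 _ ≫ h₀ ▷ A.as
        simp
      · change (preenvelopeConn B (X₀ ⊗ A.as) ≫ (f₀ ▷ A.as)⟦(1 : ℤ)⟧') ≫ (𝟙 _)⟦(1 : ℤ)⟧' =
          (α_ _ _ _).inv ≫ (preenvelopeConn B X₀ ≫ f₀⟦(1 : ℤ)⟧') ▷ A.as ≫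
            (TensorTriangulated.shiftTensor Y₀ A.as).hom
        rw [CategoryTheory.Functor.map_id, comp_id, comp_whiskerRight, assoc,
          TensorTriangulated.shiftTensor_natural_left, ← assoc (preenvelopeConn B X₀ ▷ A.as),
          preenvelopeConn_whiskerRight, assoc, Iso.inv_hom_id_assoc]
    · change (stableFunctor B).map f₀ ▷ A ≫ b.hom ▷ A = a.hom ▷ A ≫ f ▷ A
      rw [← comp_whiskerRight, hf, comp_whiskerRight]
    · change (stableFunctor B).map g₀ ▷ A ≫ c.hom ▷ A = b.hom ▷ A ≫ g ▷ A
      rw [← comp_whiskerRight, hg, comp_whiskerRight]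
    · rw [Iso.hom_inv_id_assoc]
  exact
    { dist_of_iso := hiso
      dist_whiskerRight := hwhisker
      dist_susp := fun {X Y Z f g h} hd => by
        obtain ⟨h', hd'⟩ := hwhisker ((stableFunctor B).obj (coevCone B)) hd
        exact ⟨(β_ Z _).inv ≫ h' ≫ susp.map (β_ X _).hom,
          hiso (β_ X _) (β_ Y _) (β_ Z _) (by simp [susp]) (by simp [susp])
            (by simp) hd'⟩ }

end Triangles

end Stable

end TTGeom

/-! Write `I(X)` for the envelope `(B^∨ ⊗ B) ⊗ X`. The functor `π` is not exact, because the cone of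
`π f` is represented by the homotopy pushout of `X ⟶ I(X)` along `f`, not by the cone of `f` in `K`.
The octahedral axiom measures the defect (`exists_pushout_comparison`): there is a distinguished
triangle `I(X) ⟶ Z' ⟶ Z ⟶` in `K` that joins the stable cone `Z'` to the cone `Z`. So `Z'` and `Z`
agree modulo any thick tensor-ideal containing `B`.

The object `C` controls this defect inside the stable category. Since `B ⊗ coev` is a split
monomorphism, `B ⊗ ξ = 0`. An extension of two objects annihilated by `ξ` is annihilated by `ξ ⊗ ξ`,
which explains the tensor square, and an object `N` annihilated by `ξ ⊗ ξ` is a direct summand of `C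
⊗ N`. Therefore, if the cone of `f` in `K` is annihilated by `ξ`, the stable cone of `f` lies in
every thick tensor-ideal of the stable category that contains `π C` (`mem_iff_of_cone_annihilated`).
This applies to the comparison maps between stable cones and cones, and between the two suspensions.
Hence ideals containing `π C` pull back to thick tensor-ideals of `K`. Conversely, ideals of `K`
containing `B` descend to the stable category, and they contain `C` because `C` is an extension of
`B^∨ ⊗ B` by `(B^∨ ⊗ B) ⊗ F`. This gives the homeomorphism between `V` and `U`
(`exists_stableSpc_homeomorph`).

It follows that the ideals `J` and `J'` of objects supported off `U` and off `V` correspond under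
`π`. In `K / J` every map factoring through `B ⊗ Z` vanishes, and stable cones lie in `J'` exactly
when the corresponding cones lie in `J`; so `π` induces an equivalence `K / J ≌ (K / (B ⊗ K)) / J'`
(`verdierEquivalence`), which then extends to idempotent completions.

The identification of `Spc K(U)` with `U` is proved for `K` only (`exists_local_homeomorph`). An
object `Z` of the idempotent completion is controlled by `Z ⊕ ΣZ`, which comes from `K`. The
corresponding statement for `V` is transported along the equivalence. -/

namespace TTGeom

open TriangleStructure Idempotents

/-! ### Homotopy pushouts and fibres -/

section Pretriangulated

variable {K : Type u} [Category.{v} K] [Preadditive K] [HasZeroObject K]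
  [HasShift K ℤ] [∀ n : ℤ, (shiftFunctor K n).Additive] [Pretriangulated K]

/-- The distinguished triangle that starts at a fibre of `a`, once rotated, is isomorphic to the
given one. The sign in the formula for `c` is the sign of the rotation. -/
lemma exists_fibre {X Y Z : K} {a : X ⟶ Y} {b : Y ⟶ Z} {c : Z ⟶ X⟦(1 : ℤ)⟧}
    (hT : Triangle.mk a b c ∈ distTriang K) :
    ∃ (X' : K) (u : X' ⟶ X) (e : Z ≅ X'⟦(1 : ℤ)⟧),
      Triangle.mk u a (b ≫ e.hom) ∈ distTriang K ∧ c = -(e.hom ≫ u⟦(1 : ℤ)⟧') := by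
  obtain ⟨X', u, h, H⟩ := distinguished_cocone_triangle₁ a
  have H' := rot_of_distTriang _ H
  let φ := isoTriangleOfIso₁₂ _ _ hT H' (Iso.refl _) (Iso.refl _)
    ((comp_id _).trans (id_comp _).symm)
  obtain ⟨e, rfl, rfl⟩ : ∃ e : Z ≅ X'⟦(1 : ℤ)⟧, b ≫ e.hom = h ∧ c = e.hom ≫ (-u⟦(1 : ℤ)⟧') :=
    ⟨Triangle.π₃.mapIso φ, φ.hom.comm₂.trans (id_comp _),
      ((comp_id _).symm.trans (congrArg (c ≫ ·) (CategoryTheory.Functor.map_id _ _).symm)).trans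
        φ.hom.comm₃⟩
  exact ⟨X', u, e, H, Preadditive.comp_neg _ _⟩

/-- Octahedral comparison between the cone of `f : X ⟶ Y` and its homotopy pushout along
a morphism `a : X ⟶ I`. -/
lemma exists_pushout_comparison [IsTriangulated K] {X Y Z Z' I S : K} {f : X ⟶ Y} {g : Y ⟶ Z}
    {h : Z ⟶ X⟦(1 : ℤ)⟧} {g' : Y ⟶ Z'} {h' : Z' ⟶ S} {a : X ⟶ I} {b : I ⟶ S}
    {c : S ⟶ X⟦(1 : ℤ)⟧} (hf : Triangle.mk f g h ∈ distTriang K)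
    (ha : Triangle.mk a b c ∈ distTriang K)
    (hd : Triangle.mk g' h' (c ≫ f⟦(1 : ℤ)⟧') ∈ distTriang K) :
    ∃ (m : I ⟶ Z') (v : Z' ⟶ Z), g' ≫ v = g ∧ v ≫ h = -(h' ≫ c) ∧
      Triangle.mk m v (h ≫ a⟦(1 : ℤ)⟧') ∈ distTriang K := by
  obtain ⟨X', u, e, hu, rfl⟩ := exists_fibre ha
  -- With `S` replaced by `ΣX'`, the morphism `c ≫ Σf` becomes `-Σ(u ≫ f)`: the homotopy pushout is
  -- a cone of `u ≫ f`.
  have hd' : Triangle.mk (u ≫ f) g' (h' ≫ e.hom) ∈ distTriang K := by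
    rw [rotate_distinguished_triangle]
    refine isomorphic_distinguished _ hd _ (Triangle.isoMk _ _ (Iso.refl _) (Iso.refl _) e.symm
      ?_ ?_ ?_)
    · exact (comp_id _).trans (id_comp _).symm
    · change (h' ≫ e.hom) ≫ e.inv = 𝟙 _ ≫ h'
      simp
    · change (-(u ≫ f)⟦(1 : ℤ)⟧') ≫ (𝟙 Y)⟦(1 : ℤ)⟧' =
        e.inv ≫ (-(e.hom ≫ u⟦(1 : ℤ)⟧')) ≫ f⟦(1 : ℤ)⟧'
      simp
  -- The cones of `u`, `f` and `u ≫ f` are `I`, `Z` and `Z'`.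
  let o := Triangulated.someOctahedron rfl hu hf hd'
  refine ⟨o.m₁, o.m₃, o.comm₃, ?_, o.mem⟩
  rw [Preadditive.comp_neg, neg_neg, ← assoc]
  exact o.comm₄.symm

end Pretriangulated

/-! ### Thick tensor-ideals -/

section Thick

lemma IsThickTensorIdeal.of_iso {C : Type*} [Category* C] [MonoidalCategory C]
    [TriangleStructure C] {J : ObjectProperty C} (hJ : IsThickTensorIdeal C J) {X Y : C}
    (e : X ≅ Y) (h : J X) : J Y :=
  hJ.retract (⟨e.inv, e.hom, e.inv_hom_id⟩ : Retract Y X) h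

lemma IsThickTensorIdeal.iso_iff {C : Type*} [Category* C] [MonoidalCategory C]
    [TriangleStructure C] {J : ObjectProperty C} (hJ : IsThickTensorIdeal C J) {X Y : C}
    (e : X ≅ Y) : J X ↔ J Y :=
  ⟨hJ.of_iso e, hJ.of_iso e.symm⟩

variable {K : Type u} [Category.{v} K] [Preadditive K] [HasZeroObject K]
  [HasShift K ℤ] [∀ n : ℤ, (shiftFunctor K n).Additive] [Pretriangulated K]
  [MonoidalCategory K]

/-- Stability under all shifts follows from `susp_iff` by induction in both directions. This makes
the calculus of fractions available for Verdier quotients of `K`. -/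
lemma IsThickTensorIdeal.isTriangulated {J : ObjectProperty K} (hJ : IsThickTensorIdeal K J) :
    J.IsTriangulated where
  exists_zero := ⟨_, isZero_zero K, hJ.zero _ (isZero_zero K)⟩
  isStableUnderShiftBy n := ⟨by
    have key : ∀ (n : ℤ) (X : K), J (X⟦n⟧) ↔ J X := by
      intro n
      induction n using Int.induction_on with
      | zero => exact fun X => hJ.iso_iff ((shiftFunctorZero K ℤ).app X)
      | succ n ih =>
        intro X
        rw [hJ.iso_iff ((shiftFunctorAdd K (n : ℤ) 1).app X)]
        exact (hJ.susp_iff _).trans (ih X)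
      | pred n ih =>
        intro X
        rw [← ih X, hJ.iso_iff ((shiftFunctorAdd' K (-(n : ℤ) - 1) 1 (-n) (by lia)).app X)]
        exact (hJ.susp_iff _).symm
    exact fun X hX => (key n X).2 hX⟩
  ext₂' _ hT h₁ h₃ := J.le_isoClosure _ (hJ.two_of_three₂ hT h₁ h₃)

lemma IsThickTensorIdeal.biprod {J : ObjectProperty K} (hJ : IsThickTensorIdeal K J) {X Y : K}
    (hX : J X) (hY : J Y) : J (X ⊞ Y) :=
  hJ.two_of_three₂ (binaryBiproductTriangle_distinguished X Y) hX hY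

end Thick

/-! ### Objects annihilated by a morphism to the unit -/

section Annihilated

set_option linter.unusedSectionVars false

variable {K : Type u} [Category.{v} K] [Preadditive K] [MonoidalCategory K]

/-- The objects `X` such that `X ⊗ ξ` vanishes, for a morphism `ξ`. -/
def annihilatedBy {F G : K} (ξ : F ⟶ G) : ObjectProperty K := fun X => X ◁ ξ = 0

lemma annihilatedBy_retract {F G : K} {ξ : F ⟶ G} {X Y : K} (r : Retract X Y)
    (h : annihilatedBy ξ Y) : annihilatedBy ξ X := by
  change X ◁ ξ = 0
  have h' : Y ◁ ξ = 0 := h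
  have := whisker_exchange r.i ξ
  rw [h', comp_zero] at this
  rw [← comp_id (X ◁ ξ), ← id_whiskerRight, ← r.retract, comp_whiskerRight, reassoc_of% this,
    zero_comp]

lemma annihilatedBy_tensor_left [MonoidalPreadditive K] {F G : K} {ξ : F ⟶ G} {X : K} (A : K)
    (h : annihilatedBy ξ X) : annihilatedBy ξ (A ⊗ X) := by
  change (A ⊗ X) ◁ ξ = 0
  have h' : X ◁ ξ = 0 := h
  rw [tensor_whiskerLeft, h', MonoidalPreadditive.whiskerLeft_zero, zero_comp, comp_zero]

lemma annihilatedBy_tensor_right [MonoidalPreadditive K] [BraidedCategory K] {F G : K}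
    {ξ : F ⟶ G} {X : K} (A : K) (h : annihilatedBy ξ X) : annihilatedBy ξ (X ⊗ A) :=
  annihilatedBy_retract ⟨(β_ X A).hom, (β_ X A).inv, (β_ X A).hom_inv_id⟩
    (annihilatedBy_tensor_left A h)

lemma annihilatedBy_shift [HasZeroObject K] [HasShift K ℤ]
    [∀ n : ℤ, (shiftFunctor K n).Additive] [Pretriangulated K] [SymmetricCategory K]
    [TensorTriangulated K] {F G : K} {ξ : F ⟶ G} {X : K} (h : annihilatedBy ξ X) :
    annihilatedBy ξ (X⟦(1 : ℤ)⟧) := by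
  change X⟦(1 : ℤ)⟧ ◁ ξ = 0
  have h' : X ◁ ξ = 0 := h
  rw [← cancel_mono (TensorTriangulated.shiftTensor X G).hom,
    TensorTriangulated.shiftTensor_natural_right, h', Functor.map_zero, comp_zero, zero_comp]

/-- An extension of two objects annihilated by `ξ : F ⟶ 𝟙` is annihilated by `ξ ⊗ ξ`. -/
lemma annihilatedBy_of_distinguished [MonoidalPreadditive K] [HasZeroObject K] [HasShift K ℤ]
    [∀ n : ℤ, (shiftFunctor K n).Additive] [Pretriangulated K] {F : K} {ξ : F ⟶ 𝟙_ K}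
    {T : Triangle K} (hT : T ∈ distTriang K) (h₁ : annihilatedBy ξ T.obj₁)
    (h₃ : annihilatedBy ξ T.obj₃) :
    annihilatedBy ((ξ ⊗ₘ ξ) ≫ (λ_ (𝟙_ K)).hom) T.obj₂ := by
  obtain ⟨P, N, R, m, v, d⟩ := T
  dsimp only at h₁ h₃ ⊢
  have nat {X Y : K} (f : X ⟶ Y) : f ▷ F ≫ Y ◁ ξ ≫ (ρ_ Y).hom = (X ◁ ξ ≫ (ρ_ X).hom) ≫ f := by
    rw [← whisker_exchange_assoc, assoc, rightUnitor_naturality]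
  have h₁' : P ◁ ξ = 0 := h₁
  have h₃' : R ◁ ξ = 0 := h₃
  -- Followed by `v`, the map `N ⊗ ξ` factors through `R ⊗ ξ = 0`, so it lifts to `P`.
  obtain ⟨w, hw⟩ : ∃ w : N ⊗ F ⟶ P, N ◁ ξ ≫ (ρ_ N).hom = w ≫ m :=
    Triangle.coyoneda_exact₂ _ hT (N ◁ ξ ≫ (ρ_ N).hom)
      ((nat v).symm.trans (by rw [h₃', zero_comp, comp_zero]))
  -- A second copy of `ξ` can be moved past the lift `w`, where it becomes `P ⊗ ξ = 0`.
  have key : ((N ⊗ F) ◁ ξ ≫ (ρ_ (N ⊗ F)).hom) ≫ N ◁ ξ ≫ (ρ_ N).hom = 0 := by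
    rw [hw, ← assoc, ← nat w, h₁', zero_comp, comp_zero, zero_comp]
  change N ◁ ((ξ ⊗ₘ ξ) ≫ (λ_ (𝟙_ K)).hom) = 0
  rw [← cancel_epi (α_ N F F).hom, ← cancel_mono (ρ_ N).hom, comp_zero, zero_comp, ← key]
  simp [MonoidalCategory.tensorHom_def', unitors_equal]

/-- An object `N` annihilated by `ζ : G ⟶ 𝟙` is a direct summand of `cone(ζ) ⊗ N`. -/
lemma retract_of_annihilatedBy [HasZeroObject K] [HasShift K ℤ]
    [∀ n : ℤ, (shiftFunctor K n).Additive] [Pretriangulated K] [SymmetricCategory K]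
    [TensorTriangulated K] {G C : K} {ζ : G ⟶ 𝟙_ K} {c : 𝟙_ K ⟶ C}
    {d : C ⟶ G⟦(1 : ℤ)⟧} (hT : Triangle.mk ζ c d ∈ distTriang K) {N : K}
    (h : annihilatedBy ζ N) : Nonempty (Retract N (C ⊗ N)) := by
  have h' : N ◁ ζ = 0 := h
  have h₀ : ζ ▷ N = 0 := by
    rw [← cancel_mono (β_ _ _).hom, BraidedCategory.braiding_naturality_left, h', comp_zero,
      zero_comp]
  -- As `ζ ⊗ N = 0`, the identity of `𝟙 ⊗ N` extends along `c ⊗ N`.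
  obtain ⟨r, hr⟩ : ∃ r : C ⊗ N ⟶ 𝟙_ K ⊗ N, 𝟙 _ = c ▷ N ≫ r :=
    Triangle.yoneda_exact₂ _ (TensorTriangulated.tensor_distinguished _ hT N) (𝟙 (𝟙_ K ⊗ N))
      ((comp_id _).trans h₀)
  exact ⟨⟨(λ_ N).inv ≫ c ▷ N, r ≫ (λ_ N).hom, by
    rw [assoc, ← reassoc_of% hr, Iso.inv_hom_id]⟩⟩

/-- By the triangle identity, `B ⊗ coev` is a split monomorphism; it kills `B ⊗ ξ`, which is
therefore zero. -/
lemma annihilatedBy_of_coev [MonoidalPreadditive K] [HasZeroObject K] [HasShift K ℤ]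
    [∀ n : ℤ, (shiftFunctor K n).Additive] [Pretriangulated K] {B : K} [HasLeftDual B] {F : K}
    {ξ : F ⟶ 𝟙_ K} (h : ξ ≫ coev B = 0) : annihilatedBy ξ B := by
  change B ◁ ξ = 0
  have h' : (B ◁ coev B ≫ (α_ _ _ _).inv ≫ ExactPairing.evaluation _ B ▷ B ≫ (λ_ B).hom) =
      (ρ_ B).hom := by
    rw [reassoc_of% ExactPairing.coevaluation_evaluation (HasLeftDual.leftDual B) B,
      Iso.inv_hom_id, comp_id]
  rw [← cancel_mono (ρ_ B).hom, ← h', ← MonoidalCategory.whiskerLeft_comp_assoc, h,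
    MonoidalPreadditive.whiskerLeft_zero, zero_comp, zero_comp]

end Annihilated

/-! ### Thick tensor-ideals of the stable category -/

section Stable

set_option linter.unusedSectionVars false

variable {K : Type u} [Category.{v} K] [Preadditive K] [MonoidalCategory K]
  [MonoidalPreadditive K] [HasZeroObject K] [HasShift K ℤ]
  [∀ n : ℤ, (shiftFunctor K n).Additive] [Pretriangulated K] [SymmetricCategory K]
  [TensorTriangulated K] {B : K}

/-- Every morphism of the stable category lifts to `K`, and composing with an identity that is
identified with `0` identifies it with `0`. -/
lemma isZero_stableFunctor_obj {X : K} (h : stableRel B (𝟙 X) 0) :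
    IsZero ((stableFunctor B).obj X) := by
  have h' : (stableFunctor B).map (𝟙 X) = (stableFunctor B).map 0 :=
    CategoryTheory.Quotient.sound _ h
  have h₁ {Y : K} (f : X ⟶ Y) : (stableFunctor B).map f = (stableFunctor B).map 0 := by
    rw [← id_comp f, Functor.map_comp, h', ← Functor.map_comp, zero_comp]
  have h₂ {Y : K} (f : Y ⟶ X) : (stableFunctor B).map f = (stableFunctor B).map 0 := by
    rw [← comp_id f, Functor.map_comp, h', ← Functor.map_comp, comp_zero]
  refine ⟨fun ⟨Y⟩ => ⟨⟨⟨(stableFunctor B).map 0⟩, fun f => ?_⟩⟩,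
    fun ⟨Y⟩ => ⟨⟨⟨(stableFunctor B).map 0⟩, fun f => ?_⟩⟩⟩
  · obtain ⟨f, rfl⟩ := (stableFunctor B).map_surjective (X := X) (Y := Y) f
    exact h₁ f
  · obtain ⟨f, rfl⟩ := (stableFunctor B).map_surjective (X := Y) (Y := X) f
    exact h₂ f

lemma isZero_stableFunctor_obj_of_isZero {X : K} (h : IsZero X) :
    IsZero ((stableFunctor B).obj X) :=
  isZero_stableFunctor_obj
    ((stableRel_iff B _ _).2 ⟨𝟙_ K, 0, 0, h.eq_of_src _ _⟩)

lemma isZero_stableFunctor_obj_self : IsZero ((stableFunctor B).obj B) :=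
  isZero_stableFunctor_obj ((stableRel_iff B _ _).2
    ⟨𝟙_ K, (ρ_ B).inv, (ρ_ B).hom, by simp⟩)

/-- A direct summand `X` of `Y` in the stable category is a direct summand of some
`Y ⊞ (B ⊗ Z)` in `K`. -/
lemma exists_retract_of_stable {X Y : K}
    (r : Retract ((stableFunctor B).obj X) ((stableFunctor B).obj Y)) :
    ∃ Z : K, Nonempty (Retract X (Y ⊞ (B ⊗ Z))) := by
  obtain ⟨i, hi⟩ := (stableFunctor B).map_surjective r.i
  obtain ⟨s, hs⟩ := (stableFunctor B).map_surjective r.r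
  have h : (stableFunctor B).map (𝟙 X) = (stableFunctor B).map (i ≫ s) := by
    rw [Functor.map_comp, hi, hs, r.retract]
    rfl
  obtain ⟨Z, a, b, hab⟩ := (stableRel_iff B _ _).1
    ((CategoryTheory.Quotient.functor_map_eq_iff _ _ _).1 h)
  exact ⟨Z, ⟨⟨biprod.lift i a, biprod.desc s b, by simp [hab]⟩⟩⟩

section

variable (B) [HasLeftDual B]

lemma exists_stable_cone {X Y : K} (f : X ⟶ Y) :
    ∃ (Z : K) (g : Y ⟶ Z) (h : Z ⟶ coevCone B ⊗ X),
      Triangle.mk g h (preenvelopeConn B X ≫ f⟦(1 : ℤ)⟧') ∈ distTriang K :=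
  distinguished_cocone_triangle₂ _

end

section

variable [HasLeftDual B]

lemma stable_dist {X Y Z : K} {f : X ⟶ Y} {g : Y ⟶ Z} {h : Z ⟶ coevCone B ⊗ X}
    (hd : Triangle.mk g h (preenvelopeConn B X ≫ f⟦(1 : ℤ)⟧') ∈ distTriang K) :
    dist (C := StableCategory B) ((stableFunctor B).map f) ((stableFunctor B).map g)
      ((stableFunctor B).map h) := by
  refine ⟨X, Y, Z, f, g, h, Iso.refl _, Iso.refl _, Iso.refl _, hd, ?_, ?_, ?_⟩
  · exact (comp_id _).trans (id_comp _).symm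
  · exact (comp_id _).trans (id_comp _).symm
  · have := MonoidalCategory.whiskerLeft_id ((stableFunctor B).obj (coevCone B))
      ((stableFunctor B).obj X)
    exact ((congrArg ((stableFunctor B).map h ≫ ·) this).trans (comp_id _)).trans (id_comp _).symm

lemma annihilatedBy_envelope {F : K} {ξ : F ⟶ 𝟙_ K} (h : annihilatedBy ξ B) (X : K) :
    annihilatedBy ξ ((HasLeftDual.leftDual B ⊗ B) ⊗ X) :=
  annihilatedBy_tensor_right X (annihilatedBy_tensor_left _ h)

variable [IsTriangulated K] {F C : K} {ξ : F ⟶ 𝟙_ K} {c : 𝟙_ K ⟶ C}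
    {d : C ⟶ (F ⊗ F)⟦(1 : ℤ)⟧} (hB : annihilatedBy ξ B)
    (hC : Triangle.mk ((ξ ⊗ₘ ξ) ≫ (λ_ (𝟙_ K)).hom) c d ∈ distTriang K)
    {Q : ObjectProperty (StableCategory B)} (hQ : IsThickTensorIdeal (StableCategory B) Q)
    (hQC : Q ((stableFunctor B).obj C))

include hB hC hQ hQC

/-- The stable cone `N` of `M' ⟶ M` is an extension of `P` by an envelope, both annihilated by `ξ`.
So `ξ ⊗ ξ` annihilates `N`, and `N` is a summand of `C ⊗ N`, which is in `Q`. In general `N` is not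
zero in the stable category, hence the condition that `Q` contains `π C`. -/
lemma mem_iff_of_cone_annihilated {T : Triangle K} (hT : T ∈ distTriang K)
    (h₃ : annihilatedBy ξ T.obj₃) :
    Q ((stableFunctor B).obj T.obj₁) ↔ Q ((stableFunctor B).obj T.obj₂) := by
  obtain ⟨M', M, P, f, p, q⟩ := T
  obtain ⟨N, g, h, hd⟩ := exists_stable_cone B f
  obtain ⟨m, w, -, -, hm⟩ := exists_pushout_comparison hT (preenvelope_distinguished B M') hd
  have hN : annihilatedBy ((ξ ⊗ₘ ξ) ≫ (λ_ (𝟙_ K)).hom) N :=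
    annihilatedBy_of_distinguished hm (annihilatedBy_envelope hB M') h₃
  obtain ⟨r⟩ := retract_of_annihilatedBy hC hN
  have hQN : Q ((stableFunctor B).obj N) :=
    hQ.retract (r.map (stableFunctor B))
      (hQ.tensor_right ((stableFunctor B).obj C) ((stableFunctor B).obj N) hQC)
  exact ⟨fun h => hQ.two_of_three₂ (stable_dist hd) h hQN,
    fun h => hQ.two_of_three₁ (stable_dist hd) h hQN⟩

/-- Thick tensor-ideals of the stable category that contain `C` restrict to thick
tensor-ideals of `K`. -/
lemma isThickTensorIdeal_comap : IsThickTensorIdeal K (Q.inverseImage (stableFunctor B)) := by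
  -- The connecting morphism from the stable suspension `cone(coev) ⊗ X` to `ΣX` has as cone the
  -- suspension of an envelope, which `ξ` annihilates.
  have hsusp (X : K) : Q ((stableFunctor B).obj (X⟦(1 : ℤ)⟧)) ↔ Q ((stableFunctor B).obj X) :=
    (mem_iff_of_cone_annihilated hB hC hQ hQC
      (rot_of_distTriang _ (rot_of_distTriang _ (preenvelope_distinguished B X)))
      (annihilatedBy_shift (annihilatedBy_envelope hB X))).symm.trans
        (hQ.susp_iff ((stableFunctor B).obj X))
  -- Likewise, the comparison from the stable cone of `f` to its cone in `K` has as cone the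
  -- suspension of an envelope.
  have h₃ {X Y Z : K} {f : X ⟶ Y} {g : Y ⟶ Z} {h : Z ⟶ X⟦(1 : ℤ)⟧}
      (hT : Triangle.mk f g h ∈ distTriang K) (hX : Q ((stableFunctor B).obj X))
      (hY : Q ((stableFunctor B).obj Y)) : Q ((stableFunctor B).obj Z) := by
    obtain ⟨Z', g', h', hd⟩ := exists_stable_cone B f
    obtain ⟨m, w, -, -, hm⟩ := exists_pushout_comparison hT (preenvelope_distinguished B X) hd
    exact (mem_iff_of_cone_annihilated hB hC hQ hQC (rot_of_distTriang _ hm)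
      (annihilatedBy_shift (annihilatedBy_envelope hB X))).1
        (hQ.two_of_three₃ (stable_dist hd) hX hY)
  exact {
    zero := fun X hX => hQ.zero _ (isZero_stableFunctor_obj_of_isZero hX)
    susp_iff := hsusp
    two_of_three₁ := fun {X Y Z f g h} hT hY hZ =>
      (hsusp X).1 (h₃ (rot_of_distTriang _ hT) hY hZ)
    two_of_three₂ := fun {X Y Z f g h} hT hX hZ =>
      (hsusp Y).1 (h₃ (rot_of_distTriang _ (rot_of_distTriang _ hT)) hZ ((hsusp X).2 hX))
    two_of_three₃ := h₃
    retract := fun r h => hQ.retract (r.map (stableFunctor B)) h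
    tensor_left := fun A X h => hQ.tensor_left ((stableFunctor B).obj A) _ h
    tensor_right := fun X A h => hQ.tensor_right _ ((stableFunctor B).obj A) h }

end

/-- A thick tensor-ideal of `K` that contains `B` also contains the cone `C` of `ξ ⊗ ξ`. -/
lemma cone_mem [IsTriangulated K] [HasLeftDual B] {F C : K} {ξ : F ⟶ 𝟙_ K} {c : 𝟙_ K ⟶ C}
    {κ : HasLeftDual.leftDual B ⊗ B ⟶ F⟦(1 : ℤ)⟧}
    (hξ : Triangle.mk ξ (coev B) κ ∈ distTriang K) {d : C ⟶ (F ⊗ F)⟦(1 : ℤ)⟧}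
    (hC : Triangle.mk ((ξ ⊗ₘ ξ) ≫ (λ_ (𝟙_ K)).hom) c d ∈ distTriang K)
    {P : ObjectProperty K} (hP : IsThickTensorIdeal K P) (hB : P B) : P C := by
  obtain ⟨Z, g, h, hZ⟩ := distinguished_cocone_triangle (ξ ▷ F ≫ (λ_ F).hom)
  -- Factor `ξ ⊗ ξ` as `ξ ⊗ F` followed by `ξ`. The cones of the factors are `(B^∨ ⊗ B) ⊗ F` and
  -- `B^∨ ⊗ B`, and `C` is an extension of the second by the first.
  let o := Triangulated.someOctahedron (u₁₃ := (ξ ⊗ₘ ξ) ≫ (λ_ (𝟙_ K)).hom)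
    (by rw [MonoidalCategory.tensorHom_def, assoc, assoc, leftUnitor_naturality]) hZ hξ hC
  have hBB : P (HasLeftDual.leftDual B ⊗ B) := hP.tensor_left _ _ hB
  have e := isoTriangleOfIso₁₂ _ _ (TensorTriangulated.tensor_distinguished _ hξ F) hZ
    (Iso.refl _) (λ_ F) (id_comp _).symm
  have hPZ : P Z := hP.of_iso (Triangle.π₃.mapIso e) (hP.tensor_right _ F hBB)
  exact hP.two_of_three₂ o.mem hPZ hBB

variable [HasLeftDual B]

/-- Thick tensor-ideals of `K` that contain `B` induce thick tensor-ideals of the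
stable category. -/
lemma isThickTensorIdeal_map {P : ObjectProperty K} (hP : IsThickTensorIdeal K P) (hB : P B) :
    IsThickTensorIdeal (StableCategory B) (fun X => P X.as) := by
  have hBB : P (HasLeftDual.leftDual B ⊗ B) := hP.tensor_left _ _ hB
  have hret {X Y : StableCategory B} (r : Retract X Y) (h : P Y.as) : P X.as := by
    obtain ⟨Z, ⟨r'⟩⟩ := exists_retract_of_stable r
    exact hP.retract r' (hP.biprod h (hP.tensor_right _ _ hB))
  have hiso {X Y : StableCategory B} (e : X ≅ Y) : P X.as ↔ P Y.as :=
    ⟨hret ⟨e.inv, e.hom, e.inv_hom_id⟩, hret ⟨e.hom, e.inv, e.hom_inv_id⟩⟩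
  have hsusp (X : K) : P (coevCone B ⊗ X) ↔ P X :=
    ⟨fun h => hP.two_of_three₁ (preenvelope_distinguished B X) (hP.tensor_right _ X hBB) h,
      fun h => hP.two_of_three₃ (preenvelope_distinguished B X) h (hP.tensor_right _ X hBB)⟩
  exact {
    -- A zero object of the stable category need not be zero in `K`, but it is a stable direct
    -- summand of `B`.
    zero := fun X hX => hret (Y := (stableFunctor B).obj B) ⟨hX.to_ _, hX.from_ _, hX.eq_of_src _ _⟩
      hB
    susp_iff := fun X => hsusp X.as
    -- A basic stable triangle is a triangle `Y₀ ⟶ Z₀ ⟶ cone(coev) ⊗ X₀` of `K`, and `cone(coev) ⊗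
    -- X₀` belongs to `P` exactly when `X₀` does. The rotation shifts the two-of-three properties by
    -- one place.
    two_of_three₁ := by
      rintro X Y Z f g h ⟨X₀, Y₀, Z₀, f₀, g₀, h₀, a, b, c, hd, -, -, -⟩ hY hZ
      exact (hiso a).1 ((hsusp X₀).1 (hP.two_of_three₃ hd ((hiso b).2 hY) ((hiso c).2 hZ)))
    two_of_three₂ := by
      rintro X Y Z f g h ⟨X₀, Y₀, Z₀, f₀, g₀, h₀, a, b, c, hd, -, -, -⟩ hX hZ
      exact (hiso b).1 (hP.two_of_three₁ hd ((hiso c).2 hZ) ((hsusp X₀).2 ((hiso a).2 hX)))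
    two_of_three₃ := by
      rintro X Y Z f g h ⟨X₀, Y₀, Z₀, f₀, g₀, h₀, a, b, c, hd, -, -, -⟩ hX hY
      exact (hiso c).1 (hP.two_of_three₂ hd ((hiso b).2 hY) ((hsusp X₀).2 ((hiso a).2 hX)))
    retract := hret
    tensor_left := fun A X h => hP.tensor_left A.as X.as h
    tensor_right := fun X A h => hP.tensor_right X.as A.as h }

end Stable

/-! ### Spectra of the stable category and of `K` -/

lemma supportedOn_compl_iff {C : Type*} [Category* C] [MonoidalCategory C] [TriangleStructure C]
    (U : Set (Spc C)) (X : C) : (supportedOn Uᶜ).obj X ↔ ∀ P ∈ U, P.1 X :=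
  ⟨fun h _ hP => by_contra fun hX => h hX hP, fun h P hX hP => hX (h P hP)⟩

lemma isOpen_supp_compl {C : Type*} [Category* C] [MonoidalCategory C] [TriangleStructure C]
    (X : C) : IsOpen (supp X)ᶜ :=
  TopologicalSpace.isOpen_generateFrom_of_mem ⟨X, rfl⟩

section Stable

variable {K : Type u} [Category.{v} K] [Preadditive K] [HasZeroObject K]
  [HasShift K ℤ] [∀ n : ℤ, (shiftFunctor K n).Additive] [Pretriangulated K]
  [MonoidalCategory K] [MonoidalPreadditive K] [SymmetricCategory K]
  [TensorTriangulated K] {B : K} [HasLeftDual B]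

/-- Both categories have the same objects, and both maps leave the underlying class of objects
unchanged. They are therefore mutually inverse and continuous; the content lies in the ideals being
thick on either side. -/
lemma exists_stableSpc_homeomorph [IsTriangulated K]
    {F : K} {ξ : F ⟶ 𝟙_ K} {κ : HasLeftDual.leftDual B ⊗ B ⟶ F⟦(1 : ℤ)⟧}
    (hξ : Triangle.mk ξ (coev B) κ ∈ distTriang K)
    {C : K} {c : 𝟙_ K ⟶ C} {d : C ⟶ (F ⊗ F)⟦(1 : ℤ)⟧}
    (hC : Triangle.mk ((ξ ⊗ₘ ξ) ≫ (λ_ (𝟙_ K)).hom) c d ∈ distTriang K) :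
    ∃ φ : ((supp ((stableFunctor B).obj C))ᶜ : Set (Spc (StableCategory B))) ≃ₜ
        ((supp B)ᶜ : Set (Spc K)),
      ∀ Q X, (φ Q).1.1 X ↔ Q.1.1 ((stableFunctor B).obj X) := by
  have hB : annihilatedBy ξ B := annihilatedBy_of_coev (comp_distTriang_mor_zero₁₂ _ hξ)
  have hcomap {Q : ObjectProperty (StableCategory B)} (hQ : IsPrimeIdeal (StableCategory B) Q)
      (hQC : Q ((stableFunctor B).obj C)) : IsPrimeIdeal K (Q.inverseImage (stableFunctor B)) :=
    { isThickTensorIdeal_comap hB hC hQ.toIsThickTensorIdeal hQC with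
      proper := hQ.proper.imp' (fun X : StableCategory B => X.as) fun _ h => h
      prime := fun X Y => hQ.prime ((stableFunctor B).obj X) ((stableFunctor B).obj Y) }
  have hmap {P : ObjectProperty K} (hP : IsPrimeIdeal K P) (hPB : P B) :
      IsPrimeIdeal (StableCategory B) (fun X => P X.as) :=
    { isThickTensorIdeal_map hP.toIsThickTensorIdeal hPB with
      proper := hP.proper.imp' (fun X => (stableFunctor B).obj X) fun _ h => h
      prime := fun X Y => hP.prime X.as Y.as }
  have hV {Q : Spc (StableCategory B)} (hQ : Q ∈ (supp ((stableFunctor B).obj C))ᶜ) :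
      Q.1 ((stableFunctor B).obj C) := not_not.1 hQ
  have hU {P : Spc K} (hP : P ∈ (supp B)ᶜ) : P.1 B := not_not.1 hP
  refine ⟨{
    toFun := fun Q => ⟨⟨_, hcomap Q.1.2 (hV Q.2)⟩,
      not_not.2 (Q.1.2.zero _ isZero_stableFunctor_obj_self)⟩
    invFun := fun P => ⟨⟨_, hmap P.1.2 (hU P.2)⟩,
      not_not.2 (cone_mem hξ hC P.1.2.toIsThickTensorIdeal (hU P.2))⟩
    left_inv := fun Q => rfl
    right_inv := fun P => rfl
    continuous_toFun := ?_
    continuous_invFun := ?_ }, fun Q X => Iff.rfl⟩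
  · refine continuous_induced_rng.2 (continuous_generateFrom_iff.2 ?_)
    rintro _ ⟨X, rfl⟩
    exact (isOpen_supp_compl ((stableFunctor B).obj X)).preimage continuous_subtype_val
  · refine continuous_induced_rng.2 (continuous_generateFrom_iff.2 ?_)
    rintro _ ⟨X, rfl⟩
    exact (isOpen_supp_compl X.as).preimage continuous_subtype_val

end Stable

/-! ### Isomorphisms of triangles -/

section TriangleIso

variable {C : Type*} [Category* C] [TriangleStructure C]

/-- Two triangles are isomorphic. -/
def TriangleIso {X Y Z X' Y' Z' : C} (f : X ⟶ Y) (g : Y ⟶ Z) (h : Z ⟶ susp.obj X)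
    (f' : X' ⟶ Y') (g' : Y' ⟶ Z') (h' : Z' ⟶ susp.obj X') : Prop :=
  ∃ (a : X ≅ X') (b : Y ≅ Y') (c : Z ≅ Z'), f ≫ b.hom = a.hom ≫ f' ∧ g ≫ c.hom = b.hom ≫ g' ∧
    h ≫ susp.map a.hom = c.hom ≫ h'

variable {X Y Z X' Y' Z' X'' Y'' Z'' : C} {f : X ⟶ Y} {g : Y ⟶ Z} {h : Z ⟶ susp.obj X}
  {f' : X' ⟶ Y'} {g' : Y' ⟶ Z'} {h' : Z' ⟶ susp.obj X'}
  {f'' : X'' ⟶ Y''} {g'' : Y'' ⟶ Z''} {h'' : Z'' ⟶ susp.obj X''}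

lemma TriangleIso.symm (H : TriangleIso f g h f' g' h') : TriangleIso f' g' h' f g h := by
  obtain ⟨a, b, c, hf, hg, hh⟩ := H
  refine ⟨a.symm, b.symm, c.symm, ?_, ?_, ?_⟩
  · rw [Iso.symm_hom, Iso.symm_hom, Iso.comp_inv_eq, assoc, hf, Iso.inv_hom_id_assoc]
  · rw [Iso.symm_hom, Iso.symm_hom, Iso.comp_inv_eq, assoc, hg, Iso.inv_hom_id_assoc]
  · rw [← cancel_epi c.hom, ← reassoc_of% hh, ← Functor.map_comp]
    simp

lemma TriangleIso.trans (H : TriangleIso f g h f' g' h') (H' : TriangleIso f' g' h' f'' g'' h'') :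
    TriangleIso f g h f'' g'' h'' := by
  obtain ⟨a, b, c, hf, hg, hh⟩ := H
  obtain ⟨a', b', c', hf', hg', hh'⟩ := H'
  exact ⟨a ≪≫ a', b ≪≫ b', c ≪≫ c', by simp [reassoc_of% hf, hf'], by simp [reassoc_of% hg, hg'],
    by simp [reassoc_of% hh, hh']⟩

lemma TriangleIso.map {D : Type*} [Category* D] [TriangleStructure D] (E : C ⥤ D)
    (s : susp ⋙ E ⟶ E ⋙ susp) (H : TriangleIso f g h f' g' h') :
    TriangleIso (E.map f) (E.map g) (E.map h ≫ s.app X) (E.map f') (E.map g')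
      (E.map h' ≫ s.app X') := by
  obtain ⟨a, b, c, hf, hg, hh⟩ := H
  refine ⟨E.mapIso a, E.mapIso b, E.mapIso c, by simp [← Functor.map_comp, hf],
    by simp [← Functor.map_comp, hg], ?_⟩
  have := s.naturality a.hom
  dsimp at this ⊢
  rw [assoc, ← this, ← Functor.map_comp_assoc, hh, Functor.map_comp_assoc]

lemma TriangleIso.of_map {D : Type*} [Category* D] [TriangleStructure D] (E : C ⥤ D)
    [E.Full] [E.Faithful] (s : susp ⋙ E ≅ E ⋙ susp)
    (H : TriangleIso (E.map f) (E.map g) (E.map h ≫ s.hom.app X) (E.map f') (E.map g')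
      (E.map h' ≫ s.hom.app X')) : TriangleIso f g h f' g' h' := by
  obtain ⟨a, b, c, hf, hg, hh⟩ := H
  refine ⟨E.preimageIso a, E.preimageIso b, E.preimageIso c, E.map_injective (by simpa using hf),
    E.map_injective (by simpa using hg), E.map_injective ?_⟩
  have := s.hom.naturality (E.preimageIso a).hom
  dsimp at this
  rw [← cancel_mono (s.hom.app X'), Functor.map_comp, Functor.map_comp, assoc, assoc, this]
  simpa using hh

end TriangleIso

/-! ### Distinguished triangles of a Verdier quotient, up to isomorphism. -/

section Verdier

variable {C : Type*} [Category* C] [MonoidalCategory C] [TriangleStructure C] [TensorStable C]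
  [SymmetricCategory C] (J : ThickTensorIdeal C)

lemma verdier_dist_iff {X Y Z : VerdierQuotient J} (f : X ⟶ Y) (g : Y ⟶ Z)
    (h : Z ⟶ susp.obj X) :
    dist f g h ↔ ∃ (X₀ Y₀ Z₀ : C) (f₀ : X₀ ⟶ Y₀) (g₀ : Y₀ ⟶ Z₀) (h₀ : Z₀ ⟶ susp.obj X₀),
      dist f₀ g₀ h₀ ∧ TriangleIso ((verdierFunctor J).map f₀) ((verdierFunctor J).map g₀)
        ((verdierFunctor J).map h₀ ≫ (verdierSuspIso J).inv.app X₀) f g h := by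
  constructor
  · rintro ⟨X₀, Y₀, Z₀, f₀, g₀, h₀, a, b, c, hd, hf, hg, hh⟩
    exact ⟨X₀, Y₀, Z₀, f₀, g₀, h₀, hd, a, b, c, hf, hg, (assoc _ _ _).trans hh⟩
  · rintro ⟨X₀, Y₀, Z₀, f₀, g₀, h₀, hd, a, b, c, hf, hg, hh⟩
    exact ⟨X₀, Y₀, Z₀, f₀, g₀, h₀, a, b, c, hd, hf, hg, (assoc _ _ _).symm.trans hh⟩

lemma verdier_dist_of_iso {X Y Z X' Y' Z' : VerdierQuotient J} {f : X ⟶ Y} {g : Y ⟶ Z}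
    {h : Z ⟶ susp.obj X} {f' : X' ⟶ Y'} {g' : Y' ⟶ Z'} {h' : Z' ⟶ susp.obj X'}
    (hd : dist f g h) (H : TriangleIso f g h f' g' h') : dist f' g' h' := by
  rw [verdier_dist_iff] at hd ⊢
  obtain ⟨X₀, Y₀, Z₀, f₀, g₀, h₀, hd, H'⟩ := hd
  exact ⟨X₀, Y₀, Z₀, f₀, g₀, h₀, hd, H'.trans H⟩

end Verdier

/-! ### Comparison of Verdier quotients of `K` and of the stable category -/

section Comparison

set_option linter.unusedSectionVars false

variable {K : Type u} [Category.{v} K] [Preadditive K] [HasZeroObject K]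
  [HasShift K ℤ] [∀ n : ℤ, (shiftFunctor K n).Additive] [Pretriangulated K]
  [MonoidalCategory K] [MonoidalPreadditive K] [SymmetricCategory K]
  [TensorTriangulated K] {B : K} [HasLeftDual B]

variable {J : ThickTensorIdeal K}

lemma envelope_mem (hB : J.obj B) (X : K) : J.obj ((HasLeftDual.leftDual B ⊗ B) ⊗ X) :=
  J.isThickTensorIdeal.tensor_right _ _ (J.isThickTensorIdeal.tensor_left _ _ hB)

variable (J) in
-- The inclusion `Y ⟶ Y ⊞ (B ⊗ Z)` has its cone in `J`, so it becomes invertible, and all its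
-- retractions become equal. Now `f` and `g` are obtained from the single map `(g, a)` by composing
-- with the retractions `(1, b)` and `(1, 0)`.
lemma verdierFunctor_map_eq (hB : J.obj B) {X Y : K} {f g : X ⟶ Y} (h : stableRel B f g) :
    (verdierFunctor J).map f = (verdierFunctor J).map g := by
  obtain ⟨Z, a, b, hab⟩ := (stableRel_iff B _ _).1 h
  have hW : verdierW J (biprod.inl : Y ⟶ Y ⊞ (B ⊗ Z)) :=
    .of _ ⟨_, _, _, binaryBiproductTriangle_distinguished _ _,
      J.isThickTensorIdeal.tensor_right _ _ hB⟩
  have := Localization.inverts (verdierFunctor J) (verdierW J) _ hW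
  have key : (verdierFunctor J).map (biprod.desc (𝟙 Y) b) =
      (verdierFunctor J).map (biprod.desc (𝟙 Y) 0) := by
    rw [← cancel_epi ((verdierFunctor J).map biprod.inl), ← Functor.map_comp, ← Functor.map_comp,
      biprod.inl_desc, biprod.inl_desc]
  calc (verdierFunctor J).map f
      = (verdierFunctor J).map (biprod.lift g a ≫ biprod.desc (𝟙 Y) b) := by simp [hab]
    _ = (verdierFunctor J).map (biprod.lift g a ≫ biprod.desc (𝟙 Y) 0) := by
      rw [Functor.map_comp, Functor.map_comp, key]
    _ = (verdierFunctor J).map g := by simp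

lemma coneIn_neg {X Y : K} {f : X ⟶ Y} (hf : coneIn J f) : coneIn J (-f) := by
  obtain ⟨Z, g, h, hd, hZ⟩ := hf
  let n : X ≅ X := { hom := -𝟙 X, inv := -𝟙 X, hom_inv_id := by simp, inv_hom_id := by simp }
  refine ⟨Z, g, -h, TensorStable.dist_of_iso n (Iso.refl _) (Iso.refl _) ?_ ?_ ?_ hd, hZ⟩
  · simp [n]
  · simp
  · change h ≫ (-𝟙 X)⟦(1 : ℤ)⟧' = 𝟙 Z ≫ (-h)
    simp only [Functor.map_neg, CategoryTheory.Functor.map_id, Preadditive.comp_neg, id_comp]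
    exact congrArg _ (comp_id h)

/-- The cone is the suspension of an envelope, up to isomorphism. The sign is the one in the
relation `v ≫ h = -(h' ≫ c)` of `exists_pushout_comparison`. -/
lemma neg_preenvelopeConn_mem (hB : J.obj B) (X : K) : coneIn J (-preenvelopeConn B X) :=
  coneIn_neg ⟨_, _, _, rot_of_distTriang _ (rot_of_distTriang _ (preenvelope_distinguished B X)),
    (J.isThickTensorIdeal.susp_iff _).2 (envelope_mem hB X)⟩

variable [IsTriangulated K] {J' : ThickTensorIdeal (StableCategory B)}

/-- The stable cone of `f` is an extension of the cone of `f` by an envelope. If the cone is in `J`,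
so is the stable cone. -/
lemma verdierW_stable_inverted (hB : J.obj B)
    (hJ : ∀ X, J'.obj ((stableFunctor B).obj X) ↔ J.obj X) :
    (verdierW J).IsInvertedBy (stableFunctor B ⋙ verdierFunctor J') := by
  have key ⦃X Y : K⦄ (f : X ⟶ Y) (hf : coneIn J f) :
      IsIso ((verdierFunctor J').map ((stableFunctor B).map f)) := by
    obtain ⟨Z, g, h, hd, hZ⟩ := hf
    obtain ⟨Z', g', h', hd'⟩ := exists_stable_cone B f
    obtain ⟨m, w, -, -, hm⟩ := exists_pushout_comparison hd (preenvelope_distinguished B X) hd'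
    have hZ' : J.obj Z' := J.isThickTensorIdeal.two_of_three₂ hm (envelope_mem hB X) hZ
    exact Localization.inverts (verdierFunctor J') (verdierW J') _
      (.of _ ⟨_, _, _, stable_dist hd', (hJ Z').2 hZ'⟩)
  intro X Y f hf
  induction hf with
  | of f hf => exact key f hf
  | id X => infer_instance
  | comp_of f g _ hg ih =>
    have := key g hg
    have := ih
    rw [Functor.map_comp]
    exact IsIso.comp_isIso' ih (key g hg)

variable (J) in
/-- The functor from the stable category to a Verdier quotient of `K` in which `B` vanishes. -/
def stableToVerdier (hB : J.obj B) : StableCategory B ⥤ VerdierQuotient J :=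
  CategoryTheory.Quotient.lift _ (verdierFunctor J) fun _ _ _ _ h => verdierFunctor_map_eq J hB h

/-- The triangle joining an envelope, the stable cone and the cone is now read in the other
direction: a stable cone in `J'` forces the cone in `K` to lie in `J`. -/
lemma stableToVerdier_inverts (hB : J.obj B)
    (hJ : ∀ X, J'.obj ((stableFunctor B).obj X) ↔ J.obj X) :
    (verdierW J').IsInvertedBy (stableToVerdier J hB) := by
  have key ⦃X Y : StableCategory B⦄ (f : X ⟶ Y) (hf : coneIn J' f) :
      IsIso ((stableToVerdier J hB).map f) := by
    obtain ⟨Z, g, h, ⟨X₀, Y₀, Z₀, f₀, g₀, h₀, a, b, c, hd, hf, -, -⟩, hZ⟩ := hf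
    obtain ⟨Z₁, g₁, h₁, hd₁⟩ := distinguished_cocone_triangle f₀
    obtain ⟨m, w, -, -, hm⟩ := exists_pushout_comparison hd₁ (preenvelope_distinguished B X₀) hd
    have hZ₀ : J.obj Z₀ := (hJ Z₀).1 (J'.isThickTensorIdeal.of_iso c.symm hZ)
    have hZ₁ : J.obj Z₁ := J.isThickTensorIdeal.two_of_three₃ hm (envelope_mem hB X₀) hZ₀
    have h₀ : IsIso ((stableToVerdier J hB).map ((stableFunctor B).map f₀)) :=
      Localization.inverts (verdierFunctor J) (verdierW J) _ (.of _ ⟨_, _, _, hd₁, hZ₁⟩)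
    have e : f = a.inv ≫ (stableFunctor B).map f₀ ≫ b.hom := by rw [hf, Iso.inv_hom_id_assoc]
    rw [e, Functor.map_comp, Functor.map_comp]
    infer_instance
  intro X Y f hf
  induction hf with
  | of f hf => exact key f hf
  | id X => infer_instance
  | comp_of f g _ hg ih =>
    rw [Functor.map_comp]
    exact IsIso.comp_isIso' ih (key g hg)

/-- The functor between Verdier quotients induced by the quotient functor `π`. -/
def verdierComparison (hB : J.obj B) (hJ : ∀ X, J'.obj ((stableFunctor B).obj X) ↔ J.obj X) :
    VerdierQuotient J ⥤ VerdierQuotient J' :=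
  Localization.lift _ (verdierW_stable_inverted hB hJ) (verdierFunctor J)

variable (hB : J.obj B) (hJ : ∀ X, J'.obj ((stableFunctor B).obj X) ↔ J.obj X)

instance : Localization.Lifting (verdierFunctor J) (verdierW J)
    (stableFunctor B ⋙ verdierFunctor J') (verdierComparison hB hJ) :=
  Localization.liftingLift _ (verdierW_stable_inverted hB hJ) (verdierFunctor J)

instance : (verdierComparison hB hJ).Monoidal :=
  Localization.Monoidal.functorMonoidalOfComp (verdierFunctor J) (verdierW J) _
    (stableFunctor B ⋙ verdierFunctor J')

/-- The compatibility of `verdierComparison` with the quotient functors. -/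
def verdierComparisonIso : verdierFunctor J ⋙ verdierComparison hB hJ ≅
    stableFunctor B ⋙ verdierFunctor J' :=
  Localization.Lifting.iso (verdierFunctor J) (verdierW J)
    (stableFunctor B ⋙ verdierFunctor J') (verdierComparison hB hJ)

instance : NatTrans.IsMonoidal (verdierComparisonIso hB hJ).hom :=
  Localization.Monoidal.lifting_isMonoidal (verdierFunctor J) (verdierW J) _
    (stableFunctor B ⋙ verdierFunctor J')

instance : (verdierComparison hB hJ).IsEquivalence := by
  let G : VerdierQuotient J' ⥤ VerdierQuotient J :=
    Localization.lift _ (stableToVerdier_inverts hB hJ) (verdierFunctor J')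
  let η : verdierFunctor J' ⋙ G ≅ stableToVerdier J hB :=
    Localization.fac _ (stableToVerdier_inverts hB hJ) (verdierFunctor J')
  let θ := verdierComparisonIso hB hJ
  -- Both composites are compared after restriction along the quotient functors. The functor `π`
  -- followed by `stableToVerdier` is definitionally the localization functor of `K`, and this
  -- reduces both comparisons to `θ` and `η`.
  let e₁ : verdierFunctor J ⋙ verdierComparison hB hJ ⋙ G ≅ verdierFunctor J ⋙ 𝟭 _ :=
    Functor.isoWhiskerRight θ G ≪≫ Functor.isoWhiskerLeft (stableFunctor B) η
  let e₂ : verdierFunctor J' ⋙ G ⋙ verdierComparison hB hJ ≅ verdierFunctor J' ⋙ 𝟭 _ :=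
    Functor.isoWhiskerRight η (verdierComparison hB hJ) ≪≫
      CategoryTheory.Quotient.natIsoLift _ θ
  let unit : 𝟭 _ ≅ verdierComparison hB hJ ⋙ G :=
    (Localization.liftNatIso (verdierFunctor J) (verdierW J) _ _ _ _ e₁).symm
  let counit : G ⋙ verdierComparison hB hJ ≅ 𝟭 _ :=
    Localization.liftNatIso (verdierFunctor J') (verdierW J') _ _ _ _ e₂
  exact
    (CategoryTheory.Equivalence.mk (verdierComparison hB hJ) G unit counit).isEquivalence_functor

end Comparison

/-! ### Symmetry, suspension and triangles under the comparison functor. -/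

section Braided

open Functor.LaxMonoidal Functor.OplaxMonoidal

/-- To check that a monoidal functor is braided, it suffices to consider the objects in the image of
an essentially surjective functor. -/
lemma braided_of_essSurj {C D E : Type*} [Category* C] [Category* D] [Category* E]
    [MonoidalCategory D] [MonoidalCategory E] [BraidedCategory D] [BraidedCategory E]
    (L : C ⥤ D) [L.EssSurj] (F : D ⥤ E) [F.Monoidal]
    (h : ∀ X Y : C, μ F (L.obj X) (L.obj Y) ≫ F.map (β_ (L.obj X) (L.obj Y)).hom =
      (β_ (F.obj (L.obj X)) (F.obj (L.obj Y))).hom ≫ μ F (L.obj Y) (L.obj X)) (X Y : D) :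
    μ F X Y ≫ F.map (β_ X Y).hom = (β_ (F.obj X) (F.obj Y)).hom ≫ μ F Y X := by
  let a := L.objObjPreimageIso X
  let b := L.objObjPreimageIso Y
  rw [← cancel_epi (F.map a.hom ⊗ₘ F.map b.hom), μ_natural_assoc, ← Functor.map_comp,
    BraidedCategory.braiding_naturality, Functor.map_comp, reassoc_of% h,
    BraidedCategory.braiding_naturality_assoc, μ_natural]

end Braided

section Comparison

set_option linter.unusedSectionVars false

variable {K : Type u} [Category.{v} K] [Preadditive K] [HasZeroObject K]
  [HasShift K ℤ] [∀ n : ℤ, (shiftFunctor K n).Additive] [Pretriangulated K]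
  [MonoidalCategory K] [MonoidalPreadditive K] [SymmetricCategory K]
  [TensorTriangulated K] {B : K} [HasLeftDual B]
  {J : ThickTensorIdeal K} [IsTriangulated K] {J' : ThickTensorIdeal (StableCategory B)}
  (hB : J.obj B) (hJ : ∀ X, J'.obj ((stableFunctor B).obj X) ↔ J.obj X)

open Functor.LaxMonoidal Functor.OplaxMonoidal

/-- On objects coming from `K`, the tensor constraint is by construction assembled from those of
`verdierFunctor J` and of `stableFunctor B ⋙ verdierFunctor J'`, both of which are braided. -/
lemma verdierComparison_braided (X Y : VerdierQuotient J) :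
    μ (verdierComparison hB hJ) X Y ≫ (verdierComparison hB hJ).map (β_ X Y).hom =
      (β_ _ _).hom ≫ μ (verdierComparison hB hJ) Y X := by
  refine braided_of_essSurj (verdierFunctor J) _ (fun X Y => ?_) X Y
  have hμ (X Y : K) := Localization.Monoidal.functorMonoidalOfComp_μ (verdierFunctor J)
    (verdierW J) (verdierComparison hB hJ) (stableFunctor B ⋙ verdierFunctor J') X Y
  have h₁ : (verdierComparison hB hJ).map (δ (verdierFunctor J) X Y) ≫
      (verdierComparison hB hJ).map (β_ ((verdierFunctor J).obj X) ((verdierFunctor J).obj Y)).hom =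
      (verdierComparison hB hJ).map ((verdierFunctor J).map (β_ X Y).hom) ≫
      (verdierComparison hB hJ).map (δ (verdierFunctor J) Y X) := by
    rw [← Functor.map_comp, ← Functor.map_comp, Functor.map_braiding]
    simp
  have h₂ := (verdierComparisonIso hB hJ).inv.naturality (β_ X Y).hom
  dsimp [verdierComparisonIso] at h₂
  refine (congrArg (· ≫ _) (hμ X Y)).trans (Eq.trans ?_ (congrArg (_ ≫ ·) (hμ Y X)).symm)
  simp only [assoc, h₁]
  rw [← reassoc_of% h₂, ← BraidedCategory.braiding_naturality_assoc]
  have h₃ : μ (stableFunctor B ⋙ verdierFunctor J') X Y ≫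
      (verdierFunctor J').map ((stableFunctor B).map (β_ X Y).hom) =
        (β_ _ _).hom ≫ μ (stableFunctor B ⋙ verdierFunctor J') Y X :=
    Functor.LaxBraided.braided (F := stableFunctor B ⋙ verdierFunctor J') X Y
  rw [reassoc_of% h₃]
  rfl

instance : (verdierComparison hB hJ).Braided where
  braided := verdierComparison_braided hB hJ

variable (B) in
/-- The opposites of the connecting morphisms, as a natural transformation. -/
def negPreenvelopeConn : tensorLeft (coevCone B) ⟶ shiftFunctor K (1 : ℤ) where
  app X := -preenvelopeConn B X
  naturality X Y f := by
    dsimp [preenvelopeConn]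
    rw [Preadditive.comp_neg, Preadditive.neg_comp, whisker_exchange_assoc]
    simp only [assoc, ← Functor.map_comp, ← leftUnitor_naturality]
    rw [reassoc_of% TensorTriangulated.shiftTensor_natural_right, Functor.map_comp]

/-- After passing to Verdier quotients in which `B` vanishes, the suspension of the stable
category agrees with that of `K`. -/
def suspComparisonIso : tensorLeft (coevCone B) ⋙ stableFunctor B ⋙ verdierFunctor J' ≅
    shiftFunctor K (1 : ℤ) ⋙ stableFunctor B ⋙ verdierFunctor J' := by
  have (X : K) : IsIso ((Functor.whiskerRight (negPreenvelopeConn B)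
      (stableFunctor B ⋙ verdierFunctor J')).app X) :=
    verdierW_stable_inverted hB hJ _ (.of _ (neg_preenvelopeConn_mem hB X))
  have := NatIso.isIso_of_isIso_app (Functor.whiskerRight (negPreenvelopeConn B)
    (stableFunctor B ⋙ verdierFunctor J'))
  exact asIso (Functor.whiskerRight (negPreenvelopeConn B)
    (stableFunctor B ⋙ verdierFunctor J'))

/-- The components of `verdierComparisonSuspIso` on the image of `K`. -/
def verdierComparisonSuspIso₀ :
    verdierFunctor J ⋙ verdierSusp J ⋙ verdierComparison hB hJ ≅
      verdierFunctor J ⋙ verdierComparison hB hJ ⋙ verdierSusp J' :=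
  Functor.isoWhiskerRight (verdierSuspIso J) (verdierComparison hB hJ) ≪≫
    Functor.isoWhiskerLeft (shiftFunctor K (1 : ℤ)) (verdierComparisonIso hB hJ) ≪≫
    (suspComparisonIso hB hJ).symm ≪≫
    Functor.isoWhiskerLeft (stableFunctor B) (verdierSuspIso J').symm ≪≫
    Functor.isoWhiskerRight (verdierComparisonIso hB hJ).symm (verdierSusp J')

/-- The comparison of Verdier quotients commutes with suspensions. -/
def verdierComparisonSuspIso :
    verdierSusp J ⋙ verdierComparison hB hJ ≅ verdierComparison hB hJ ⋙ verdierSusp J' :=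
  Localization.liftNatIso (verdierFunctor J) (verdierW J) _ _ _ _
    (verdierComparisonSuspIso₀ hB hJ)

lemma verdierComparisonSuspIso_hom_app (X : K) :
    (verdierComparisonSuspIso hB hJ).hom.app ((verdierFunctor J).obj X) =
      (verdierComparison hB hJ).map ((verdierSuspIso J).hom.app X) ≫
        (verdierComparisonIso hB hJ).hom.app (X⟦(1 : ℤ)⟧) ≫
        (suspComparisonIso hB hJ).inv.app X ≫
        (verdierSuspIso J').inv.app ((stableFunctor B).obj X) ≫
        (verdierSusp J').map ((verdierComparisonIso hB hJ).inv.app X) := by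
  refine (Localization.liftNatTrans_app _ _ _ _ _ _ _ _).trans ?_
  exact (id_comp _).trans (comp_id _)

/-- The image of a distinguished triangle in the Verdier quotient of the stable category. -/
lemma verdierComparison_triangleIso {X Y Z Z' : K} {f : X ⟶ Y} {g : Y ⟶ Z} {h : Z ⟶ X⟦(1 : ℤ)⟧}
    (hd : Triangle.mk f g h ∈ distTriang K) {g' : Y ⟶ Z'} {h' : Z' ⟶ coevCone B ⊗ X}
    (hd' : Triangle.mk g' h' (preenvelopeConn B X ≫ f⟦(1 : ℤ)⟧') ∈ distTriang K) :
    TriangleIso ((verdierFunctor J').map ((stableFunctor B).map f))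
      ((verdierFunctor J').map ((stableFunctor B).map g'))
      ((verdierFunctor J').map ((stableFunctor B).map h') ≫
        (verdierSuspIso J').inv.app ((stableFunctor B).obj X))
      ((verdierComparison hB hJ).map ((verdierFunctor J).map f))
      ((verdierComparison hB hJ).map ((verdierFunctor J).map g))
      ((verdierComparison hB hJ).map ((verdierFunctor J).map h ≫ (verdierSuspIso J).inv.app X) ≫
        (verdierComparisonSuspIso hB hJ).hom.app ((verdierFunctor J).obj X)) := by
  obtain ⟨m, w, hw₁, hw₂, hm⟩ := exists_pushout_comparison hd (preenvelope_distinguished B X) hd'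
  let θ := verdierComparisonIso hB hJ
  let L₂ := stableFunctor B ⋙ verdierFunctor J'
  -- The cone of `w` is the suspension of an envelope, hence is in `J`.
  have : IsIso (L₂.map w) := verdierW_stable_inverted hB hJ _
    (.of _ ⟨_, _, _, rot_of_distTriang _ hm,
      (J.isThickTensorIdeal.susp_iff _).2 (envelope_mem hB X)⟩)
  have nat {X Y : K} (f : X ⟶ Y) : L₂.map f ≫ θ.inv.app Y =
      θ.inv.app X ≫ (verdierComparison hB hJ).map ((verdierFunctor J).map f) :=
    θ.inv.naturality f
  refine ⟨(θ.app X).symm, (θ.app Y).symm, asIso (L₂.map w) ≪≫ (θ.app Z).symm, nat f, ?_, ?_⟩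
  · change L₂.map g' ≫ L₂.map w ≫ θ.inv.app Z = θ.inv.app Y ≫ _
    rw [← Functor.map_comp_assoc, hw₁, nat]
  -- The sign in `hw₂` is absorbed by `suspComparisonIso`, which is induced by the opposite of the
  -- connecting morphism.
  · have hconn : L₂.map w ≫ L₂.map h = L₂.map h' ≫ (suspComparisonIso hB hJ).hom.app X := by
      rw [← Functor.map_comp, hw₂, ← Preadditive.comp_neg, Functor.map_comp]
      rfl
    rw [verdierComparisonSuspIso_hom_app]
    change (L₂.map h' ≫ (verdierSuspIso J').inv.app ((stableFunctor B).obj X)) ≫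
      (verdierSusp J').map (θ.inv.app X) = (L₂.map w ≫ θ.inv.app Z) ≫ _
    have h₁ : (verdierComparison hB hJ).map ((verdierSuspIso J).inv.app X) ≫
        (verdierComparison hB hJ).map ((verdierSuspIso J).hom.app X) = 𝟙 _ := by
      rw [← Functor.map_comp, Iso.inv_hom_id_app, CategoryTheory.Functor.map_id]
    rw [Functor.map_comp]
    simp only [assoc]
    rw [reassoc_of% h₁, ← reassoc_of% nat h, Iso.inv_hom_id_app_assoc, reassoc_of% hconn,
      Iso.hom_inv_id_app_assoc]

/-- The tensor-triangulated equivalence between Verdier quotients induced by the quotient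
functor `π`. -/
def verdierEquivalence : TTEquivalence (VerdierQuotient J) (VerdierQuotient J') where
  functor := verdierComparison hB hJ
  isEquivalence := inferInstance
  suspIso := verdierComparisonSuspIso hB hJ
  dist_iff {X Y Z} f g h := by
    rw [verdier_dist_iff, verdier_dist_iff]
    constructor
    · rintro ⟨X', Y', Z', f', g', h', ⟨X₀, Y₀, Z₀, f₀, g₀, h₀, a, b, c, hd, hf, hg, hh⟩, H⟩
      -- The stable triangle over `f₀` is replaced by a triangle of `K` over the same `f₀`. Their
      -- images in the quotient are isomorphic, and full faithfulness reflects the isomorphism of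
      -- triangles.
      obtain ⟨Z₁, g₁, h₁, hd₁⟩ := distinguished_cocone_triangle f₀
      refine ⟨X₀, Y₀, Z₁, f₀, g₁, h₁, hd₁, TriangleIso.of_map (verdierComparison hB hJ)
        (verdierComparisonSuspIso hB hJ)
        ((verdierComparison_triangleIso hB hJ hd₁ hd).symm.trans (TriangleIso.trans ?_ H))⟩
      exact TriangleIso.map (verdierFunctor J') (verdierSuspIso J').inv ⟨a, b, c, hf, hg, hh⟩
    · rintro ⟨X₀, Y₀, Z₀, f₀, g₀, h₀, hd, H⟩
      obtain ⟨Z₁, g₁, h₁, hd₁⟩ := exists_stable_cone B f₀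
      exact ⟨_, _, _, _, _, _, stable_dist hd₁, (verdierComparison_triangleIso hB hJ hd hd₁).trans
        (H.map (verdierComparison hB hJ) (verdierComparisonSuspIso hB hJ).hom)⟩

end Comparison

/-! ### Functoriality of idempotent completions -/

section Karoubi

variable {C D : Type*} [Category* C] [Category* D]

/-- The functor between idempotent completions induced by a functor. -/
abbrev karoubiMap (F : C ⥤ D) : Karoubi C ⥤ Karoubi D := (functorExtension₂ C D).obj F

@[simp] lemma karoubiMap_obj_X (F : C ⥤ D) (P : Karoubi C) :
    ((karoubiMap F).obj P).X = F.obj P.X := rfl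

@[simp] lemma karoubiMap_obj_p (F : C ⥤ D) (P : Karoubi C) :
    ((karoubiMap F).obj P).p = F.map P.p := rfl

@[simp] lemma karoubiMap_map_f (F : C ⥤ D) {P Q : Karoubi C} (f : P ⟶ Q) :
    ((karoubiMap F).map f).f = F.map f.f := rfl

instance (F : C ⥤ D) [F.Faithful] : (karoubiMap F).Faithful where
  map_injective {P Q f g} h := by
    ext
    exact F.map_injective ((Karoubi.hom_ext_iff).1 h)

instance (F : C ⥤ D) [F.Full] [F.Faithful] : (karoubiMap F).Full where
  map_surjective {P Q} f := by
    obtain ⟨g, hg⟩ : ∃ g : P.X ⟶ Q.X, F.map g = f.f := F.map_surjective _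
    refine ⟨{ f := g, comm := F.map_injective ?_ }, by ext; exact hg⟩
    rw [Functor.map_comp, Functor.map_comp, hg]
    exact f.comm

instance (F : C ⥤ D) [F.IsEquivalence] : (karoubiMap F).EssSurj where
  mem_essImage P := by
    let e := F.objObjPreimageIso P.X
    have hp : F.map (F.preimage (e.hom ≫ P.p ≫ e.inv)) = e.hom ≫ P.p ≫ e.inv := F.map_preimage _
    refine ⟨⟨F.objPreimage P.X, F.preimage (e.hom ≫ P.p ≫ e.inv), F.map_injective ?_⟩, ⟨?_⟩⟩
    · rw [Functor.map_comp, hp]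
      simp only [assoc, Iso.inv_hom_id_assoc, Karoubi.idem_assoc]
    · exact
        { hom :=
            { f := e.hom ≫ P.p
              comm := by
                dsimp
                rw [hp]
                simp only [assoc, Iso.inv_hom_id_assoc, Karoubi.idem] }
          inv :=
            { f := P.p ≫ e.inv
              comm := by
                dsimp
                rw [hp]
                simp only [assoc, Iso.inv_hom_id_assoc, Karoubi.idem_assoc] }
          hom_inv_id := by
            ext
            dsimp
            rw [hp]
            simp only [assoc, Karoubi.idem_assoc]
          inv_hom_id := by
            ext
            dsimp
            simp only [assoc, Iso.inv_hom_id_assoc, Karoubi.idem] }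

instance (F : C ⥤ D) [F.IsEquivalence] : (karoubiMap F).IsEquivalence where

/-- The functor induced on idempotent completions by a natural isomorphism. -/
def karoubiMapCompToKaroubi (F : C ⥤ D) : toKaroubi C ⋙ karoubiMap F ≅ F ⋙ toKaroubi D :=
  NatIso.ofComponents (fun X =>
    { hom := { f := 𝟙 _ }
      inv := { f := 𝟙 _ } })

end Karoubi

/-! ### Monoidal structure of the functors induced on idempotent completions. -/

section Monoidal

open Functor.LaxMonoidal Functor.OplaxMonoidal Functor.Monoidal

variable {C D : Type*} [Category* C] [Category* D] [MonoidalCategory C] [MonoidalCategory D]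

/-- The unit constraint of the functor between idempotent completions. -/
def karoubiMapεIso (F : C ⥤ D) [F.Monoidal] :
    𝟙_ (Karoubi D) ≅ (karoubiMap F).obj (𝟙_ (Karoubi C)) where
  hom := { f := ε F }
  inv := { f := η F }

/-- The tensor constraint of the functor between idempotent completions. -/
def karoubiMapμIso (F : C ⥤ D) [F.Monoidal] (P Q : Karoubi C) :
    (karoubiMap F).obj P ⊗ (karoubiMap F).obj Q ≅ (karoubiMap F).obj (P ⊗ Q) where
  hom :=
    { f := μ F P.X Q.X ≫ F.map (P.p ⊗ₘ Q.p)
      comm := by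
        change (F.map P.p ⊗ₘ F.map Q.p) ≫ (μ F P.X Q.X ≫ F.map (P.p ⊗ₘ Q.p)) ≫
          F.map (P.p ⊗ₘ Q.p) = μ F P.X Q.X ≫ F.map (P.p ⊗ₘ Q.p)
        simp only [assoc, μ_natural_assoc, ← Functor.map_comp, tensorHom_comp_tensorHom,
          Karoubi.idem] }
  inv :=
    { f := F.map (P.p ⊗ₘ Q.p) ≫ δ F P.X Q.X
      comm := by
        change F.map (P.p ⊗ₘ Q.p) ≫ (F.map (P.p ⊗ₘ Q.p) ≫ δ F P.X Q.X) ≫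
          (F.map P.p ⊗ₘ F.map Q.p) = F.map (P.p ⊗ₘ Q.p) ≫ δ F P.X Q.X
        simp only [assoc, δ_natural, ← Functor.map_comp_assoc, tensorHom_comp_tensorHom,
          Karoubi.idem] }
  hom_inv_id := by
    ext
    change (μ F P.X Q.X ≫ F.map (P.p ⊗ₘ Q.p)) ≫ F.map (P.p ⊗ₘ Q.p) ≫ δ F P.X Q.X =
      F.map P.p ⊗ₘ F.map Q.p
    simp only [assoc, ← Functor.map_comp_assoc, tensorHom_comp_tensorHom, Karoubi.idem]
    rw [← δ_natural, μ_δ_assoc]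
  inv_hom_id := by
    ext
    change (F.map (P.p ⊗ₘ Q.p) ≫ δ F P.X Q.X) ≫ μ F P.X Q.X ≫ F.map (P.p ⊗ₘ Q.p) =
      F.map (P.p ⊗ₘ Q.p)
    simp only [assoc, δ_μ_assoc, ← Functor.map_comp, tensorHom_comp_tensorHom, Karoubi.idem]

instance (F : C ⥤ D) [F.Monoidal] : (karoubiMap F).Monoidal :=
  Functor.CoreMonoidal.toMonoidal
    { εIso := karoubiMapεIso F
      μIso := karoubiMapμIso F
      μIso_hom_natural_left := fun {P Q} f R => by
        ext
        change (F.map f.f ⊗ₘ F.map R.p) ≫ μ F Q.X R.X ≫ F.map (Q.p ⊗ₘ R.p) =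
          (μ F P.X R.X ≫ F.map (P.p ⊗ₘ R.p)) ≫ F.map (f.f ⊗ₘ R.p)
        simp only [assoc, μ_natural_assoc, ← Functor.map_comp, tensorHom_comp_tensorHom,
          Karoubi.idem, Karoubi.comp_p, Karoubi.p_comp]
      μIso_hom_natural_right := fun {P Q} R f => by
        ext
        change (F.map R.p ⊗ₘ F.map f.f) ≫ μ F R.X Q.X ≫ F.map (R.p ⊗ₘ Q.p) =
          (μ F R.X P.X ≫ F.map (R.p ⊗ₘ P.p)) ≫ F.map (R.p ⊗ₘ f.f)
        simp only [assoc, μ_natural_assoc, ← Functor.map_comp, tensorHom_comp_tensorHom,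
          Karoubi.idem, Karoubi.comp_p, Karoubi.p_comp]
      associativity := fun P Q R => by
        ext
        change ((μ F P.X Q.X ≫ F.map (P.p ⊗ₘ Q.p)) ⊗ₘ F.map R.p) ≫
            (μ F (P.X ⊗ Q.X) R.X ≫ F.map ((P.p ⊗ₘ Q.p) ⊗ₘ R.p)) ≫
              F.map ((α_ P.X Q.X R.X).hom ≫ (P.p ⊗ₘ (Q.p ⊗ₘ R.p))) =
          ((α_ (F.obj P.X) (F.obj Q.X) (F.obj R.X)).hom ≫
            (F.map P.p ⊗ₘ (F.map Q.p ⊗ₘ F.map R.p))) ≫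
            (F.map P.p ⊗ₘ (μ F Q.X R.X ≫ F.map (Q.p ⊗ₘ R.p))) ≫
              μ F P.X (Q.X ⊗ R.X) ≫ F.map (P.p ⊗ₘ (Q.p ⊗ₘ R.p))
        have h : (F.map P.p ⊗ₘ (F.map Q.p ⊗ₘ F.map R.p)) ≫ F.obj P.X ◁ μ F Q.X R.X =
            F.obj P.X ◁ μ F Q.X R.X ≫ (F.map P.p ⊗ₘ F.map (Q.p ⊗ₘ R.p)) := by
          rw [← tensorHom_comp', ← μ_natural, ← id_tensorHom, tensorHom_comp_tensorHom, comp_id]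
        simp only [comp_tensorHom', tensorHom_comp', assoc, reassoc_of% h, μ_natural_assoc,
          ← Functor.map_comp, tensorHom_comp_tensorHom, Karoubi.idem,
          associator_naturality_assoc]
        rw [Functor.map_comp, Functor.LaxMonoidal.associativity_assoc]
      left_unitality := fun P => by
        ext
        change (λ_ (F.obj P.X)).hom ≫ F.map P.p = (ε F ⊗ₘ F.map P.p) ≫
          (μ F (𝟙_ C) P.X ≫ F.map (𝟙 _ ⊗ₘ P.p)) ≫ F.map ((λ_ P.X).hom ≫ P.p)
        simp only [assoc, ← Functor.map_comp, id_tensorHom, leftUnitor_naturality_assoc,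
          Karoubi.idem]
        rw [MonoidalCategory.tensorHom_def, assoc, Functor.map_comp,
          Functor.LaxMonoidal.μ_natural_right_assoc]
        simp only [← Functor.map_comp, leftUnitor_naturality_assoc, Karoubi.idem]
        rw [Functor.map_comp, Functor.LaxMonoidal.left_unitality, assoc, assoc]
      right_unitality := fun P => by
        ext
        change (ρ_ (F.obj P.X)).hom ≫ F.map P.p = (F.map P.p ⊗ₘ ε F) ≫
          (μ F P.X (𝟙_ C) ≫ F.map (P.p ⊗ₘ 𝟙 _)) ≫ F.map ((ρ_ P.X).hom ≫ P.p)
        simp only [assoc, ← Functor.map_comp, tensorHom_id, rightUnitor_naturality_assoc,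
          Karoubi.idem]
        rw [MonoidalCategory.tensorHom_def', assoc, Functor.map_comp,
          Functor.LaxMonoidal.μ_natural_left_assoc]
        simp only [← Functor.map_comp, rightUnitor_naturality_assoc, Karoubi.idem]
        rw [Functor.map_comp, Functor.LaxMonoidal.right_unitality, assoc, assoc] }

instance [BraidedCategory C] [BraidedCategory D] (F : C ⥤ D) [F.Braided] :
    (karoubiMap F).Braided where
  braided P Q := by
    ext
    change (μ F P.X Q.X ≫ F.map (P.p ⊗ₘ Q.p)) ≫ F.map ((β_ P.X Q.X).hom ≫ (Q.p ⊗ₘ P.p)) =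
      ((β_ (F.obj P.X) (F.obj Q.X)).hom ≫ (F.map Q.p ⊗ₘ F.map P.p)) ≫
        μ F Q.X P.X ≫ F.map (Q.p ⊗ₘ P.p)
    simp only [assoc, μ_natural_assoc, ← Functor.map_comp, tensorHom_comp_tensorHom,
      Karoubi.idem, BraidedCategory.braiding_naturality_assoc]
    rw [Functor.map_comp, Functor.LaxBraided.braided_assoc]

end Monoidal

/-! ### Maps of spectra -/

section SpcHomeomorph

variable {C D : Type*} [Category* C] [Category* D] [MonoidalCategory C] [MonoidalCategory D]
  [TriangleStructure C] [TriangleStructure D]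

lemma Spc.mem_iff_of_iso (P : Spc C) {X Y : C} (e : X ≅ Y) : P.1 X ↔ P.1 Y :=
  P.2.toIsThickTensorIdeal.iso_iff e

/-- A functor induces a homeomorphism of the spectrum of its target onto a subset `S` of the
spectrum of its source as soon as the primes correspond to each other and each object of the target
has the support of an object of the source. -/
lemma exists_homeomorph_of_isSpcMap (F : C ⥤ D) (S : Set (Spc C))
    (h₁ : ∀ Q : Spc D, ∃ P ∈ S, ∀ X, P.1 X ↔ Q.1 (F.obj X))
    (h₂ : ∀ P ∈ S, ∃ Q : Spc D, ∀ X, P.1 X ↔ Q.1 (F.obj X))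
    (h₃ : ∀ Y : D, ∃ X, ∀ Q : Spc D, Q.1 Y ↔ Q.1 (F.obj X)) :
    ∃ ρ : Spc D ≃ₜ S, IsSpcMap F (fun P => (ρ P : Spc C)) := by
  choose f hfS hf using h₁
  choose g hg using h₂
  -- A prime of `D` is determined by its preimage, since membership of any `Y` can be tested on some
  -- `F.obj X`.
  have hinj : ∀ Q Q' : Spc D, (∀ X, Q.1 (F.obj X) ↔ Q'.1 (F.obj X)) → Q = Q' := by
    refine fun Q Q' h => Subtype.ext (funext fun Y => propext ?_)
    obtain ⟨X, hX⟩ := h₃ Y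
    rw [hX, hX, h]
  let e : Spc D ≃ S :=
    { toFun Q := ⟨f Q, hfS Q⟩
      invFun P := g P.1 P.2
      left_inv Q := hinj _ _ fun X => by rw [← hg, hf]
      right_inv P := Subtype.ext (Subtype.ext (funext fun X => propext (by rw [hf, ← hg]))) }
  refine ⟨{ toEquiv := e, continuous_toFun := ?_, continuous_invFun := ?_ }, hf⟩
  · refine continuous_induced_rng.2 (continuous_generateFrom_iff.2 ?_)
    rintro _ ⟨X, rfl⟩
    convert isOpen_supp_compl (F.obj X) using 1
    ext Q
    simp only [Set.mem_preimage, Set.mem_compl_iff, supp, Set.mem_ofPred_eq, not_not]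
    exact hf Q X
  -- Every basic open subset of `Spc D` is given by an object of the form `F.obj X`, so it is the
  -- trace of a basic open subset of `Spc C`.
  · refine continuous_generateFrom_iff.2 ?_
    rintro _ ⟨Y, rfl⟩
    obtain ⟨X, hX⟩ := h₃ Y
    convert (isOpen_supp_compl X).preimage continuous_subtype_val using 1
    ext P
    simp only [Set.mem_preimage, Set.mem_compl_iff, supp, Set.mem_ofPred_eq, not_not, hX]
    exact (hg P.1 P.2 X).symm

end SpcHomeomorph

/-! ### Preimages of prime ideals under exact monoidal functors. -/

section Comap

variable {C D : Type*} [Category* C] [Category* D] [MonoidalCategory C] [MonoidalCategory D]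
  [TriangleStructure C] [TriangleStructure D]

/-- The preimage of a prime ideal under an exact monoidal functor. -/
lemma IsPrimeIdeal.comap (F : C ⥤ D) [F.Monoidal] (hzero : ∀ X, IsZero X → IsZero (F.obj X))
    (hsusp : ∀ X, Nonempty (F.obj (susp.obj X) ≅ susp.obj (F.obj X)))
    (hdist : ∀ {X Y Z : C} {f : X ⟶ Y} {g : Y ⟶ Z} {h : Z ⟶ susp.obj X}, dist f g h →
      ∃ h', dist (F.map f) (F.map g) h') (Q : Spc D) :
    IsPrimeIdeal C (fun X => Q.1 (F.obj X)) where
  zero X hX := Q.2.zero _ (hzero X hX)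
  susp_iff X := (Q.mem_iff_of_iso (hsusp X).some).trans (Q.2.susp_iff _)
  two_of_three₁ hd := Q.2.two_of_three₁ (hdist hd).choose_spec
  two_of_three₂ hd := Q.2.two_of_three₂ (hdist hd).choose_spec
  two_of_three₃ hd := Q.2.two_of_three₃ (hdist hd).choose_spec
  retract r := Q.2.retract (r.map F)
  tensor_left A X h := (Q.mem_iff_of_iso (Functor.Monoidal.μIso F A X)).1
    (Q.2.tensor_left _ _ h)
  tensor_right X A h := (Q.mem_iff_of_iso (Functor.Monoidal.μIso F X A)).1
    (Q.2.tensor_right _ _ h)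
  proper := by
    obtain ⟨Y, hY⟩ := Q.2.proper
    exact ⟨𝟙_ C, fun h => hY ((Q.mem_iff_of_iso (λ_ Y)).1 (Q.2.tensor_right _ _
      ((Q.mem_iff_of_iso (Functor.Monoidal.εIso F)).2 h)))⟩
  prime X Y h := Q.2.prime _ _ ((Q.mem_iff_of_iso (Functor.Monoidal.μIso F X Y)).2 h)

end Comap

variable (C : Type*) [Category* C] [TriangleStructure C] in
/-- The class of distinguished triangles is stable under isomorphisms of triangles. -/
def DistRespectsIso : Prop :=
  ∀ {X Y Z X' Y' Z' : C} {f : X ⟶ Y} {g : Y ⟶ Z} {h : Z ⟶ susp.obj X} {f' : X' ⟶ Y'}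
    {g' : Y' ⟶ Z'} {h' : Z' ⟶ susp.obj X'},
    dist f g h → TriangleIso f g h f' g' h' → dist f' g' h'

/-! ### Direct summands of triangles -/

section Summand

variable {C : Type*} [Category* C]

/-- A splitting of an idempotent endomorphism of `X` as a direct summand of `X₀`. -/
structure IdemSplit {X : C} (p : X ⟶ X) (X₀ : C) where
  /-- the inclusion -/
  i : X ⟶ X₀
  /-- the projection -/
  r : X₀ ⟶ X
  i_r : i ≫ r = p
  p_i : p ≫ i = i
  r_p : r ≫ p = r

/-- Direct summands in the idempotent completion of objects of `C`. -/
def IdemSplit.equivRetract (P : Karoubi C) (X₀ : C) :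
    IdemSplit P.p X₀ ≃ Retract P ((toKaroubi C).obj X₀) where
  toFun s :=
    { i := { f := s.i, comm := (congrArg (P.p ≫ ·) (comp_id s.i)).trans s.p_i }
      r := { f := s.r, comm := (id_comp (s.r ≫ P.p)).trans s.r_p }
      retract := by ext; exact s.i_r }
  invFun r :=
    { i := r.i.f
      r := r.r.f
      i_r := congrArg Karoubi.Hom.f r.retract
      p_i := Karoubi.p_comp r.i
      r_p := Karoubi.comp_p r.r }

/-- The image of a splitting under a functor. -/
@[simps]
def IdemSplit.map {D : Type*} [Category* D] (F : C ⥤ D) {X : C} {p : X ⟶ X} {X₀ : C}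
    (s : IdemSplit p X₀) : IdemSplit (F.map p) (F.obj X₀) where
  i := F.map s.i
  r := F.map s.r
  i_r := by rw [← Functor.map_comp, s.i_r]
  p_i := by rw [← Functor.map_comp, s.p_i]
  r_p := by rw [← Functor.map_comp, s.r_p]

/-- Lifting of a splitting along a fully faithful functor. -/
@[simps]
def IdemSplit.lift {D : Type*} [Category* D] (F : C ⥤ D) [F.Full] [F.Faithful] {X : C} {p : X ⟶ X}
    {X₀ : C} {X₁ : D} (s : IdemSplit (F.map p) X₁) (e : F.obj X₀ ≅ X₁) : IdemSplit p X₀ where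
  i := F.preimage (s.i ≫ e.inv)
  r := F.preimage (e.hom ≫ s.r)
  i_r := F.map_injective (by simp [s.i_r])
  p_i := F.map_injective (by simp [reassoc_of% s.p_i])
  r_p := F.map_injective (by simp [s.r_p])

/-- Transport of a splitting along an isomorphism in the idempotent completion. -/
@[simps]
def IdemSplit.ofIso {P Q : Karoubi C} {X₀ : C} (s : IdemSplit P.p X₀) (e : P ≅ Q) :
    IdemSplit Q.p X₀ where
  i := e.inv.f ≫ s.i
  r := s.r ≫ e.hom.f
  i_r := by
    rw [assoc, reassoc_of% s.i_r, Karoubi.p_comp]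
    exact congrArg Karoubi.Hom.f e.inv_hom_id
  p_i := by rw [Karoubi.p_comp_assoc]
  r_p := by rw [assoc, Karoubi.comp_p]

variable [TriangleStructure C]

/-- The first triangle, restricted by means of the given idempotents, is a direct summand of the
second triangle. -/
def TriangleSummand {X Y Z X₀ Y₀ Z₀ : C} (p : X ⟶ X) (q : Y ⟶ Y) (t : Z ⟶ Z)
    (f : X ⟶ Y) (g : Y ⟶ Z) (h : Z ⟶ susp.obj X)
    (f₀ : X₀ ⟶ Y₀) (g₀ : Y₀ ⟶ Z₀) (h₀ : Z₀ ⟶ susp.obj X₀) : Prop :=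
  ∃ (a : IdemSplit p X₀) (b : IdemSplit q Y₀) (c : IdemSplit t Z₀),
    f ≫ b.i = a.i ≫ f₀ ∧ f₀ ≫ b.r = a.r ≫ f ∧ g ≫ c.i = b.i ≫ g₀ ∧ g₀ ≫ c.r = b.r ≫ g ∧
      h ≫ susp.map a.i = c.i ≫ h₀ ∧ h₀ ≫ susp.map a.r = c.r ≫ h

/-- In this form only morphisms of `C` occur, so that functors can be applied to the splittings or
used to lift them. -/
lemma karoubi_dist_iff {X Y Z : Karoubi C} (f : X ⟶ Y) (g : Y ⟶ Z) (h : Z ⟶ susp.obj X) :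
    dist f g h ↔ ∃ (X₀ Y₀ Z₀ : C) (f₀ : X₀ ⟶ Y₀) (g₀ : Y₀ ⟶ Z₀) (h₀ : Z₀ ⟶ susp.obj X₀),
      dist f₀ g₀ h₀ ∧ TriangleSummand X.p Y.p Z.p f.f g.f h.f f₀ g₀ h₀ := by
  constructor
  · rintro ⟨X₀, Y₀, Z₀, f₀, g₀, h₀, a, b, c, hd, H⟩
    exact ⟨_, _, _, _, _, _, hd, (IdemSplit.equivRetract _ _).symm a,
      (IdemSplit.equivRetract _ _).symm b, (IdemSplit.equivRetract _ _).symm c, H⟩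
  · rintro ⟨X₀, Y₀, Z₀, f₀, g₀, h₀, hd, a, b, c, H⟩
    exact ⟨_, _, _, _, _, _, IdemSplit.equivRetract _ _ a, IdemSplit.equivRetract _ _ b,
      IdemSplit.equivRetract _ _ c, hd, H⟩

/-- The ambient triangle of `C` stays the same; only the splittings are transported. -/
lemma karoubi_distRespectsIso : DistRespectsIso (Karoubi C) := by
  rintro X Y Z X' Y' Z' f g h f' g' h' hd ⟨u, v, w, hf, hg, hh⟩
  rw [karoubi_dist_iff] at hd ⊢
  obtain ⟨X₀, Y₀, Z₀, f₀, g₀, h₀, hd, a, b, c, h₁, h₂, h₃, h₄, h₅, h₆⟩ := hd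
  have hf' : f' ≫ v.inv = u.inv ≫ f := by simp [Iso.comp_inv_eq, hf]
  have hg' : g' ≫ w.inv = v.inv ≫ g := by simp [Iso.comp_inv_eq, hg]
  have hh' : h' ≫ susp.map u.inv = w.inv ≫ h := by
    rw [← cancel_epi w.hom, ← reassoc_of% hh, ← Functor.map_comp]
    simp
  replace hf : f.f ≫ v.hom.f = u.hom.f ≫ f'.f := congrArg Karoubi.Hom.f hf
  replace hg : g.f ≫ w.hom.f = v.hom.f ≫ g'.f := congrArg Karoubi.Hom.f hg
  replace hh : h.f ≫ susp.map u.hom.f = w.hom.f ≫ h'.f := congrArg Karoubi.Hom.f hh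
  replace hf' : f'.f ≫ v.inv.f = u.inv.f ≫ f.f := congrArg Karoubi.Hom.f hf'
  replace hg' : g'.f ≫ w.inv.f = v.inv.f ≫ g.f := congrArg Karoubi.Hom.f hg'
  replace hh' : h'.f ≫ susp.map u.inv.f = w.inv.f ≫ h.f := congrArg Karoubi.Hom.f hh'
  refine ⟨X₀, Y₀, Z₀, f₀, g₀, h₀, hd, a.ofIso u, b.ofIso v, c.ofIso w, ?_, ?_, ?_, ?_, ?_, ?_⟩
  all_goals simp only [IdemSplit.ofIso_i, IdemSplit.ofIso_r, Functor.map_comp, assoc]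
  · rw [reassoc_of% hf', h₁]
  · rw [reassoc_of% h₂, hf]
  · rw [reassoc_of% hg', h₃]
  · rw [reassoc_of% h₄, hg]
  · rw [← h₅]
    exact (assoc _ _ _).symm.trans ((congrArg (· ≫ _) hh').trans (assoc _ _ _))
  · rw [reassoc_of% h₆]
    exact (assoc _ _ _).trans ((congrArg (c.r ≫ ·) hh).trans (assoc _ _ _).symm)

end Summand

/-! ### Tensor-triangulated equivalences -/

namespace TTEquivalence

variable {C D : Type*} [Category* C] [Category* D] [MonoidalCategory C]
  [MonoidalCategory D] [SymmetricCategory C] [SymmetricCategory D] [TriangleStructure C]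
  [TriangleStructure D] (E : TTEquivalence C D)

instance : E.functor.IsEquivalence := E.isEquivalence

/-- Distinguished triangles can be lifted along a tensor-triangulated equivalence. -/
lemma dist_preimage (hD : DistRespectsIso D) {X Y Z : D} {f : X ⟶ Y} {g : Y ⟶ Z}
    {h : Z ⟶ susp.obj X} (hd : dist f g h) {X' Y' Z' : C} (a : E.functor.obj X' ≅ X)
    (b : E.functor.obj Y' ≅ Y) (c : E.functor.obj Z' ≅ Z) :
    dist (E.functor.preimage (a.hom ≫ f ≫ b.inv)) (E.functor.preimage (b.hom ≫ g ≫ c.inv))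
      (E.functor.preimage (c.hom ≫ h ≫ susp.map a.inv ≫ E.suspIso.inv.app X')) := by
  refine (E.dist_iff _ _ _).1 (hD hd (TriangleIso.symm ⟨a, b, c, ?_, ?_, ?_⟩))
  · simp
  · simp
  · simp [← Functor.map_comp]

lemma isZero_map_iff (X : C) : IsZero (E.functor.obj X) ↔ IsZero X := by
  refine ⟨fun h => ⟨fun Y => ?_, fun Y => ?_⟩, fun h => ⟨fun Y => ?_, fun Y => ?_⟩⟩
  · exact ⟨⟨⟨E.functor.preimage (h.to_ _)⟩, fun f => E.functor.map_injective (h.eq_of_src _ _)⟩⟩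
  · exact ⟨⟨⟨E.functor.preimage (h.from_ _)⟩, fun f => E.functor.map_injective (h.eq_of_tgt _ _)⟩⟩
  · let e := E.functor.objObjPreimageIso Y
    refine ⟨⟨⟨E.functor.map (h.to_ _) ≫ e.hom⟩, fun f => ?_⟩⟩
    refine (Iso.comp_inv_eq e).1 ?_
    rw [← E.functor.map_preimage (f ≫ e.inv)]
    exact congrArg _ (h.eq_of_src _ _)
  · let e := E.functor.objObjPreimageIso Y
    refine ⟨⟨⟨e.inv ≫ E.functor.map (h.from_ _)⟩, fun f => ?_⟩⟩
    refine (Iso.eq_inv_comp e).2 ?_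
    rw [← E.functor.map_preimage (e.hom ≫ f)]
    exact congrArg _ (h.eq_of_tgt _ _)

/-- The preimage of a prime ideal under a tensor-triangulated equivalence. -/
lemma isPrimeIdeal_comap (Q : Spc D) : IsPrimeIdeal C (fun X => Q.1 (E.functor.obj X)) :=
  IsPrimeIdeal.comap E.functor (fun X hX => (E.isZero_map_iff X).2 hX)
    (fun X => ⟨E.suspIso.app X⟩) (fun hd => ⟨_, (E.dist_iff _ _ _).2 hd⟩) Q

/-- Membership does not depend on the chosen preimage, because full faithfulness makes any two
preimages isomorphic. -/
lemma mem_objPreimage_iff (P : Spc C) {X : C} {Y : D} (e : E.functor.obj X ≅ Y) :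
    P.1 (E.functor.objPreimage Y) ↔ P.1 X :=
  P.mem_iff_of_iso (E.functor.preimageIso (E.functor.objObjPreimageIso Y ≪≫ e.symm))

/-- The image of a prime ideal under a tensor-triangulated equivalence. -/
lemma isPrimeIdeal_map (hD : DistRespectsIso D) (P : Spc C) :
    IsPrimeIdeal D (fun Y => P.1 (E.functor.objPreimage Y)) where
  zero Y hY := P.2.zero _ ((E.isZero_map_iff _).1 (hY.of_iso (E.functor.objObjPreimageIso Y)))
  susp_iff Y := (E.mem_objPreimage_iff P (E.suspIso.app (E.functor.objPreimage Y) ≪≫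
    susp.mapIso (E.functor.objObjPreimageIso Y))).trans (P.2.susp_iff _)
  two_of_three₁ hd := P.2.two_of_three₁ (E.dist_preimage hD hd (E.functor.objObjPreimageIso _)
    (E.functor.objObjPreimageIso _) (E.functor.objObjPreimageIso _))
  two_of_three₂ hd := P.2.two_of_three₂ (E.dist_preimage hD hd (E.functor.objObjPreimageIso _)
    (E.functor.objObjPreimageIso _) (E.functor.objObjPreimageIso _))
  two_of_three₃ hd := P.2.two_of_three₃ (E.dist_preimage hD hd (E.functor.objObjPreimageIso _)
    (E.functor.objObjPreimageIso _) (E.functor.objObjPreimageIso _))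
  retract {X Y} r := P.2.retract
    { i := E.functor.preimage ((E.functor.objObjPreimageIso X).hom ≫ r.i ≫
        (E.functor.objObjPreimageIso Y).inv)
      r := E.functor.preimage ((E.functor.objObjPreimageIso Y).hom ≫ r.r ≫
        (E.functor.objObjPreimageIso X).inv)
      retract := E.functor.map_injective (by simp) }
  tensor_left A X h := (E.mem_objPreimage_iff P ((Functor.Monoidal.μIso E.functor _ _).symm ≪≫
    (E.functor.objObjPreimageIso A ⊗ᵢ E.functor.objObjPreimageIso X))).2 (P.2.tensor_left _ _ h)
  tensor_right X A h := (E.mem_objPreimage_iff P ((Functor.Monoidal.μIso E.functor _ _).symm ≪≫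
    (E.functor.objObjPreimageIso X ⊗ᵢ E.functor.objObjPreimageIso A))).2 (P.2.tensor_right _ _ h)
  proper := by
    obtain ⟨X, hX⟩ := P.2.proper
    exact ⟨_, fun h => hX ((E.mem_objPreimage_iff P (Iso.refl (E.functor.obj X))).1 h)⟩
  prime X Y h := P.2.prime _ _
    ((E.mem_objPreimage_iff P ((Functor.Monoidal.μIso E.functor _ _).symm ≪≫
      (E.functor.objObjPreimageIso X ⊗ᵢ E.functor.objObjPreimageIso Y))).1 h)

/-- The homeomorphism induced on spectra by a tensor-triangulated equivalence. -/
lemma exists_spc_homeomorph (hD : DistRespectsIso D) :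
    ∃ φ : Spc D ≃ₜ Spc C, IsSpcMap E.functor φ := by
  obtain ⟨ρ, hρ⟩ := exists_homeomorph_of_isSpcMap E.functor Set.univ
    (fun Q => ⟨⟨_, E.isPrimeIdeal_comap Q⟩, trivial, fun X => Iff.rfl⟩)
    (fun P _ => ⟨⟨_, E.isPrimeIdeal_map hD P⟩, fun X =>
      (E.mem_objPreimage_iff P (Iso.refl _)).symm⟩)
    (fun Y => ⟨E.functor.objPreimage Y, fun Q =>
      (Q.mem_iff_of_iso (E.functor.objObjPreimageIso Y)).symm⟩)
  exact ⟨ρ.trans (Homeomorph.Set.univ _), hρ⟩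

section Karoubi

/-- The functor induced on idempotent completions commutes with suspensions. -/
def karoubiSuspIso : susp ⋙ karoubiMap E.functor ≅ karoubiMap E.functor ⋙ susp :=
  (functorExtension₂ C D).mapIso E.suspIso

/-- From `D` to `C`, the ambient triangle is lifted by essential surjectivity and the splittings by
full faithfulness. The other direction applies `E`. -/
lemma exists_triangleSummand_map_iff (hD : DistRespectsIso D) {X Y Z : C} (p : X ⟶ X)
    (q : Y ⟶ Y) (t : Z ⟶ Z) (f : X ⟶ Y) (g : Y ⟶ Z) (h : Z ⟶ susp.obj X) :
    (∃ (X₀ Y₀ Z₀ : D) (f₀ : X₀ ⟶ Y₀) (g₀ : Y₀ ⟶ Z₀) (h₀ : Z₀ ⟶ susp.obj X₀), dist f₀ g₀ h₀ ∧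
      TriangleSummand (E.functor.map p) (E.functor.map q) (E.functor.map t) (E.functor.map f)
        (E.functor.map g) (E.functor.map h ≫ E.suspIso.hom.app X) f₀ g₀ h₀) ↔
    ∃ (X₀ Y₀ Z₀ : C) (f₀ : X₀ ⟶ Y₀) (g₀ : Y₀ ⟶ Z₀) (h₀ : Z₀ ⟶ susp.obj X₀), dist f₀ g₀ h₀ ∧
      TriangleSummand p q t f g h f₀ g₀ h₀ := by
  have nat {A A' : C} (k : A ⟶ A') : E.functor.map (susp.map k) ≫ E.suspIso.hom.app A' =
    E.suspIso.hom.app A ≫ susp.map (E.functor.map k) := E.suspIso.hom.naturality k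
  constructor
  · rintro ⟨X₀, Y₀, Z₀, f₀, g₀, h₀, hd, a, b, c, hf, hf', hg, hg', hh, hh'⟩
    let eX := E.functor.objObjPreimageIso X₀
    let eY := E.functor.objObjPreimageIso Y₀
    let eZ := E.functor.objObjPreimageIso Z₀
    refine ⟨_, _, _, _, _, _, E.dist_preimage hD hd eX eY eZ, a.lift _ eX, b.lift _ eY,
      c.lift _ eZ, ?_, ?_, ?_, ?_, ?_, ?_⟩
    all_goals
      refine E.functor.map_injective ?_
      simp only [IdemSplit.lift_i, IdemSplit.lift_r, Functor.map_comp, Functor.map_preimage,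
        assoc, Iso.inv_hom_id_assoc]
    · rw [reassoc_of% hf]
    · rw [hf']
    · rw [reassoc_of% hg]
    · rw [hg']
    · rw [← cancel_mono (E.suspIso.hom.app _)]
      simp only [assoc, nat, Functor.map_preimage, Functor.map_comp, Iso.inv_hom_id_app,
        Functor.comp_obj, comp_id]
      rw [← reassoc_of% hh]
    · rw [← cancel_mono (E.suspIso.hom.app _)]
      simp only [assoc, ← hh', nat, Functor.map_preimage, Functor.map_comp,
        Iso.inv_hom_id_app_assoc]
      rw [← Functor.map_comp_assoc, Iso.inv_hom_id]
      simp
  · rintro ⟨X₀, Y₀, Z₀, f₀, g₀, h₀, hd, a, b, c, hf, hf', hg, hg', hh, hh'⟩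
    refine ⟨_, _, _, _, _, _, (E.dist_iff _ _ _).2 hd, a.map _, b.map _, c.map _,
      ?_, ?_, ?_, ?_, ?_, ?_⟩
    all_goals
      simp only [IdemSplit.map_i, IdemSplit.map_r, ← Functor.map_comp, ← Functor.map_comp_assoc]
    · rw [hf]
    · rw [hf']
    · rw [hg]
    · rw [hg']
    · rw [assoc, ← nat, ← Functor.map_comp_assoc, hh, Functor.map_comp_assoc]
    · rw [assoc, ← nat, ← Functor.map_comp_assoc, hh', Functor.map_comp_assoc]

/-- The tensor-triangulated equivalence between idempotent completions. -/
def karoubi (hD : DistRespectsIso D) : TTEquivalence (Karoubi C) (Karoubi D) where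
  functor := karoubiMap E.functor
  isEquivalence := inferInstance
  suspIso := E.karoubiSuspIso
  dist_iff {X Y Z} f g h := by
    -- In the idempotent completion, the suspension isomorphism carries an extra idempotent, which
    -- `h` absorbs.
    have hσ : ((karoubiMap E.functor).map h ≫ E.karoubiSuspIso.hom.app X).f =
        E.functor.map h.f ≫ E.suspIso.hom.app X.X := by
      have := Karoubi.comp_p h
      refine Eq.trans ?_ (congrArg (fun k => E.functor.map k ≫ E.suspIso.hom.app X.X) this)
      exact ((congrArg (· ≫ _) (E.functor.map_comp _ _)).trans (assoc _ _ _)).symm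
    rw [karoubi_dist_iff, karoubi_dist_iff, hσ]
    exact E.exists_triangleSummand_map_iff hD X.p Y.p Z.p f.f g.f h.f

end Karoubi

end TTEquivalence

/-! ### Compatibility of the comparison with the canonical functors, as a monoidal isomorphism. -/

section Monoidal

open Functor.LaxMonoidal Functor.OplaxMonoidal Functor.Monoidal

variable {C D : Type*} [Category* C] [Category* D] [MonoidalCategory C] [MonoidalCategory D]

instance (F : C ⥤ D) [F.Monoidal] : NatTrans.IsMonoidal (karoubiMapCompToKaroubi F).hom where
  unit := by
    ext
    change (ε F ≫ F.map (𝟙 _)) ≫ 𝟙 _ = 𝟙 _ ≫ ε F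
    simp
  tensor X Y := by
    ext
    change ((μ F X Y ≫ F.map (𝟙 X ⊗ₘ 𝟙 Y)) ≫ F.map (𝟙 _)) ≫ 𝟙 _ = (𝟙 _ ⊗ₘ 𝟙 _) ≫ 𝟙 _ ≫ μ F X Y
    simp

end Monoidal

section Comparison

variable {K : Type u} [Category.{v} K] [Preadditive K] [HasZeroObject K]
  [HasShift K ℤ] [∀ n : ℤ, (shiftFunctor K n).Additive] [Pretriangulated K]
  [MonoidalCategory K] [MonoidalPreadditive K] [SymmetricCategory K]
  [TensorTriangulated K] {B : K} [HasLeftDual B]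
  {J : ThickTensorIdeal K} [IsTriangulated K] {J' : ThickTensorIdeal (StableCategory B)}
  (hB : J.obj B) (hJ : ∀ X, J'.obj ((stableFunctor B).obj X) ↔ J.obj X)

/-- The comparison of idempotent completions of Verdier quotients is compatible with the
canonical functors. -/
def karoubiComparisonIso :
    (verdierFunctor J ⋙ toKaroubi _) ⋙ karoubiMap (verdierComparison hB hJ) ≅
      stableFunctor B ⋙ verdierFunctor J' ⋙ toKaroubi _ :=
  Functor.associator _ _ _ ≪≫
    Functor.isoWhiskerLeft (verdierFunctor J) (karoubiMapCompToKaroubi _) ≪≫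
    (Functor.associator _ _ _).symm ≪≫
    Functor.isoWhiskerRight (verdierComparisonIso hB hJ) (toKaroubi _) ≪≫
    Functor.associator _ _ _

instance : NatTrans.IsMonoidal (karoubiComparisonIso hB hJ).hom := by
  have h₁ : NatTrans.IsMonoidal ((verdierFunctor J).associator (toKaroubi _)
    (karoubiMap (verdierComparison hB hJ))).hom := inferInstance
  have h₂ : NatTrans.IsMonoidal ((verdierFunctor J).isoWhiskerLeft
    (karoubiMapCompToKaroubi (verdierComparison hB hJ))).hom :=
    NatTrans.IsMonoidal.whiskerLeft _
  have h₃ : NatTrans.IsMonoidal ((verdierFunctor J).associator (verdierComparison hB hJ)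
    (toKaroubi _)).symm.hom := inferInstanceAs (NatTrans.IsMonoidal (Iso.inv _))
  have h₄ : NatTrans.IsMonoidal (Functor.isoWhiskerRight (verdierComparisonIso hB hJ)
    (toKaroubi _)).hom := NatTrans.IsMonoidal.whiskerRight _
  exact @NatTrans.IsMonoidal.comp _ _ _ _ _ _ _ _ _ _ _ _ _ _ h₁
    (@NatTrans.IsMonoidal.comp _ _ _ _ _ _ _ _ _ _ _ _ _ _ h₂
      (@NatTrans.IsMonoidal.comp _ _ _ _ _ _ _ _ _ _ _ _ _ _ h₃
        (@NatTrans.IsMonoidal.comp _ _ _ _ _ _ _ _ _ _ _ _ _ _ h₄ inferInstance)))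

end Comparison

/-! ### The spectrum of an open subset -/

section Additive

variable {K : Type u} [Category.{v} K] [Preadditive K] [HasZeroObject K]
  [HasShift K ℤ] [∀ n : ℤ, (shiftFunctor K n).Additive] [Pretriangulated K]
  [MonoidalCategory K] [MonoidalPreadditive K] [SymmetricCategory K]
  [TensorTriangulated K] [IsTriangulated K] (J : ThickTensorIdeal K)

instance : J.obj.IsTriangulated := J.isThickTensorIdeal.isTriangulated

set_option linter.unusedSectionVars false in
-- For triangulated `K`, the morphisms with cone in `J` are already closed under composition.
-- Calculus of fractions, additivity and exactness of the localization thus apply to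
-- `VerdierQuotient J`.
lemma verdierW_eq : verdierW J = J.obj.trW := by
  have h : coneIn J = J.obj.trW := by
    ext X Y f
    exact ⟨fun ⟨Z, g, h, hd, hZ⟩ => ⟨Z, g, h, hd, hZ⟩, fun ⟨Z, g, h, hd, hZ⟩ => ⟨Z, g, h, hd, hZ⟩⟩
  rw [verdierW, h, MorphismProperty.multiplicativeClosure_eq_self]

instance : (verdierW J).HasLeftCalculusOfFractions := by
  rw [verdierW_eq]; infer_instance

instance : (verdierW J).IsCompatibleWithShift ℤ := by
  rw [verdierW_eq]; infer_instance

instance : (verdierW J).IsCompatibleWithTriangulation := by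
  rw [verdierW_eq]; infer_instance

instance : Preadditive (VerdierQuotient J) :=
  inferInstanceAs (Preadditive (verdierW J).Localization)

instance : (verdierFunctor J).Additive :=
  inferInstanceAs ((verdierW J).Q.Additive)

variable {X Y Z : K} {f : X ⟶ Y} {g : Y ⟶ Z} {h : Z ⟶ X⟦(1 : ℤ)⟧}

/-- The exactness comes from the pretriangulated structure on the localization, for which the
localization functor is triangulated. -/
lemma verdier_yoneda_exact₂ (hd : Triangle.mk f g h ∈ distTriang K) {A : VerdierQuotient J}
    (t : (verdierFunctor J).obj Y ⟶ A) (ht : (verdierFunctor J).map f ≫ t = 0) :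
    ∃ t' : (verdierFunctor J).obj Z ⟶ A, t = (verdierFunctor J).map g ≫ t' :=
  Triangle.yoneda_exact₂ _ ((verdierW J).Q.map_distinguished _ hd) t ht

lemma verdier_yoneda_exact₃ (hd : Triangle.mk f g h ∈ distTriang K) {A : VerdierQuotient J}
    (t : (verdierFunctor J).obj Z ⟶ A) (ht : (verdierFunctor J).map g ≫ t = 0) :
    ∃ t' : (verdierFunctor J).obj (X⟦(1 : ℤ)⟧) ⟶ A, t = (verdierFunctor J).map h ≫ t' :=
  verdier_yoneda_exact₂ J (rot_of_distTriang _ hd) t ht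

lemma verdier_additive_iff {E : Type*} [Category* E] [Preadditive E] (G : VerdierQuotient J ⥤ E) :
    G.Additive ↔ (verdierFunctor J ⋙ G).Additive :=
  Localization.functor_additive_iff (verdierFunctor J) (verdierW J) G

instance : (verdierSusp J).Additive := by
  rw [verdier_additive_iff]
  exact Functor.additive_of_iso (verdierSuspIso J).symm

/-- Additivity can be tested after restriction to `K`. Up to isomorphism `A` comes from `K`, and the
restricted functor is then a tensor product of `K` followed by localization. -/
instance (A : VerdierQuotient J) : (tensorLeft A).Additive := by
  have : (verdierFunctor J ⋙ tensorLeft ((verdierFunctor J).obj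
      ((verdierFunctor J).objPreimage A))).Additive :=
    Functor.additive_of_iso (Functor.Monoidal.commTensorLeft (verdierFunctor J) _).symm
  have := (verdier_additive_iff J _).2 this
  exact Functor.additive_of_iso ((curriedTensor _).mapIso ((verdierFunctor J).objObjPreimageIso A))

instance (A : VerdierQuotient J) : (tensorRight A).Additive :=
  Functor.additive_of_iso (BraidedCategory.tensorLeftIsoTensorRight A)

instance : MonoidalPreadditive (VerdierQuotient J) where
  whiskerLeft_zero {X _ _} := (tensorLeft X).map_zero _ _
  zero_whiskerRight {X _ _} := (tensorRight X).map_zero _ _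
  whiskerLeft_add {X _ _} _ _ := (tensorLeft X).map_add
  add_whiskerRight {X _ _} _ _ := (tensorRight X).map_add

/-- The suspension of `K` is the tensor product with the suspension of the unit. -/
def tensorLeftShiftUnitIso (K : Type u) [Category.{v} K] [Preadditive K] [HasZeroObject K]
    [HasShift K ℤ] [∀ n : ℤ, (shiftFunctor K n).Additive] [Pretriangulated K]
    [MonoidalCategory K] [SymmetricCategory K] [TensorTriangulated K] :
    tensorLeft ((𝟙_ K)⟦(1 : ℤ)⟧) ≅ shiftFunctor K (1 : ℤ) :=
  NatIso.ofComponents (fun X => TensorTriangulated.shiftTensor (𝟙_ K) X ≪≫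
    (shiftFunctor K (1 : ℤ)).mapIso (λ_ X)) (fun f => by
      dsimp
      rw [reassoc_of% TensorTriangulated.shiftTensor_natural_right, assoc, ← Functor.map_comp,
        leftUnitor_naturality, Functor.map_comp])

/-- The suspension of the Verdier quotient is the tensor product with the suspension of the
unit. -/
def verdierSuspTensorIso :
    verdierSusp J ≅ tensorLeft ((verdierFunctor J).obj ((𝟙_ K)⟦(1 : ℤ)⟧)) :=
  Localization.liftNatIso (verdierFunctor J) (verdierW J) _ _ _ _
    (verdierSuspIso J ≪≫ Functor.isoWhiskerRight (tensorLeftShiftUnitIso K).symm _ ≪≫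
      (Functor.Monoidal.commTensorLeft (verdierFunctor J) _).symm)

/-- If `X` becomes zero, the calculus of fractions gives a zero morphism out of `X` whose cone is in
`J`. The cone of a zero morphism contains `ΣX` as a direct summand, and `J` is thick. -/
lemma isZero_verdierFunctor_obj_iff (X : K) :
    IsZero ((verdierFunctor J).obj X) ↔ J.obj X := by
  constructor
  · intro h
    have h₀ : (verdierFunctor J).map (𝟙 X) = (verdierFunctor J).map 0 := h.eq_of_src _ _
    obtain ⟨Z, s, hs, h₀⟩ :=
      (MorphismProperty.map_eq_iff_postcomp (verdierFunctor J) (verdierW J) _ _).1 h₀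
    rw [id_comp, zero_comp] at h₀
    subst h₀
    rw [verdierW_eq] at hs
    obtain ⟨N, g, k, hd, hN⟩ := hs
    obtain ⟨r, hr⟩ := Triangle.coyoneda_exact₁ _ hd (𝟙 (X⟦(1 : ℤ)⟧))
      ((id_comp _).trans (Functor.map_zero _ _ _))
    exact (J.isThickTensorIdeal.susp_iff X).1 (J.isThickTensorIdeal.retract ⟨r, k, hr.symm⟩ hN)
  · intro h
    obtain ⟨Z, hZ⟩ := HasZeroObject.zero (C := K)
    obtain ⟨N, g, k, hd⟩ := distinguished_cocone_triangle (0 : X ⟶ Z)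
    have := Localization.inverts (verdierFunctor J) (verdierW J) _
      (.of _ ⟨N, g, k, hd,
        J.isThickTensorIdeal.two_of_three₃ hd h (J.isThickTensorIdeal.zero _ hZ)⟩)
    exact ((verdierFunctor J).map_isZero hZ).of_iso (asIso ((verdierFunctor J).map 0))

end Additive

/-! ### Replacing an object of the idempotent completion by one coming from `K`. -/

section Decomposition

variable {K : Type u} [Category.{v} K] [Preadditive K] [HasZeroObject K]
  [HasShift K ℤ] [∀ n : ℤ, (shiftFunctor K n).Additive] [Pretriangulated K]
  [MonoidalCategory K] [MonoidalPreadditive K] [SymmetricCategory K]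
  [TensorTriangulated K] [IsTriangulated K] {J : ThickTensorIdeal K}

/-- The cone of the idempotent `1 - p` is the sum of the image of `p` and of its suspension. -/
lemma exists_cone_of_idempotent {X₀ : VerdierQuotient J} (p : X₀ ⟶ X₀) (hp : p ≫ p = p) :
    ∃ (N : K) (g : X₀ ⟶ (verdierFunctor J).obj N) (h : (verdierFunctor J).obj N ⟶ susp.obj X₀)
      (t : (verdierFunctor J).obj N ⟶ X₀) (s : susp.obj X₀ ⟶ (verdierFunctor J).obj N),
      dist (𝟙 X₀ - p) g h ∧ p ≫ g = g ∧ h ≫ susp.map p = h ∧ g ≫ t = p ∧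
        t ≫ p ≫ g + h ≫ susp.map p ≫ s = 𝟙 _ := by
  have := Localization.essSurj (verdierFunctor J) (verdierW J)
  let X := (verdierFunctor J).objPreimage X₀
  let e : (verdierFunctor J).obj X ≅ X₀ := (verdierFunctor J).objObjPreimageIso X₀
  let σ := verdierSuspIso J
  -- Write `1 - p` as a left fraction; the object `N` is the cone in `K` of its numerator `a`.
  obtain ⟨Y, a, w, hw, ha⟩ : ∃ (Y : K) (a w : X ⟶ Y), verdierW J w ∧
      e.hom ≫ (𝟙 X₀ - p) ≫ e.inv ≫ (verdierFunctor J).map w = (verdierFunctor J).map a := by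
    obtain ⟨φ, hφ⟩ := Localization.exists_leftFraction (verdierFunctor J) (verdierW J)
      (e.hom ≫ (𝟙 X₀ - p) ≫ e.inv)
    refine ⟨φ.Y', φ.f, φ.s, φ.hs, ?_⟩
    rw [← φ.map_comp_map_s (verdierFunctor J) (Localization.inverts _ _), ← hφ]
    simp only [assoc]
  have := Localization.inverts (verdierFunctor J) (verdierW J) _ hw
  let W := asIso ((verdierFunctor J).map w)
  obtain ⟨N, b, k, hd⟩ := distinguished_cocone_triangle a
  have hab : (verdierFunctor J).map a ≫ (verdierFunctor J).map b = 0 := by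
    rw [← Functor.map_comp, show a ≫ b = 0 from comp_distTriang_mor_zero₁₂ _ hd, Functor.map_zero]
  have hka : (verdierFunctor J).map k ≫ (verdierFunctor J).map (a⟦(1 : ℤ)⟧') = 0 := by
    rw [← Functor.map_comp, show k ≫ a⟦(1 : ℤ)⟧' = 0 from comp_distTriang_mor_zero₃₁ _ hd,
      Functor.map_zero]
  let g := e.inv ≫ W.hom ≫ (verdierFunctor J).map b
  let h := (verdierFunctor J).map k ≫ σ.inv.app X ≫ susp.map e.hom
  have hpg : p ≫ g = g := by
    have : (𝟙 X₀ - p) ≫ g = 0 := by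
      rw [← cancel_epi e.hom, comp_zero, ← hab, ← ha]
      simp [g, W]
    rwa [Preadditive.sub_comp, id_comp, sub_eq_zero, eq_comm] at this
  have hhp : h ≫ susp.map p = h := by
    have : h ≫ susp.map (𝟙 X₀ - p) = 0 := by
      have nat {A A' : K} (f : A ⟶ A') : (verdierFunctor J).map (f⟦(1 : ℤ)⟧') ≫ σ.inv.app A' =
        σ.inv.app A ≫ susp.map ((verdierFunctor J).map f) := σ.inv.naturality f
      rw [← cancel_mono (susp.map (e.inv ≫ W.hom)), zero_comp, assoc, ← Functor.map_comp]
      simp only [h, assoc]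
      rw [← Functor.map_comp]
      have ha' : e.hom ≫ (𝟙 X₀ - p) ≫ e.inv ≫ W.hom = (verdierFunctor J).map a := ha
      rw [ha', ← nat, reassoc_of% hka, zero_comp]
    have hsub : susp.map (𝟙 X₀ - p) = 𝟙 _ - susp.map p :=
      ((verdierSusp J).map_sub).trans (by rw [CategoryTheory.Functor.map_id]; rfl)
    rwa [hsub, Preadditive.comp_sub, comp_id, sub_eq_zero, eq_comm] at this
  have hpp : (𝟙 X₀ - p) ≫ p = 0 := by rw [Preadditive.sub_comp, id_comp, hp, sub_self]
  -- Since `(1 - p) ≫ p = 0`, the idempotent `p` factors through `g`.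
  obtain ⟨t, ht⟩ := verdier_yoneda_exact₂ J hd (W.inv ≫ e.hom ≫ p) (by
    rw [← ha]
    change (e.hom ≫ (𝟙 X₀ - p) ≫ e.inv ≫ W.hom) ≫ _ = 0
    simp only [assoc, Iso.hom_inv_id_assoc, Iso.inv_hom_id_assoc, hpp, comp_zero])
  have hgt : g ≫ t = p := by
    simp only [g, assoc, ← ht, Iso.hom_inv_id_assoc, Iso.inv_hom_id_assoc]
  -- The remainder `1 - t ≫ p ≫ g` vanishes on the image of `b`, so it factors through `k`. Thus the
  -- identity of `N` is a sum of one map through `p` and one through the suspension of `p`.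
  obtain ⟨s, hs⟩ := verdier_yoneda_exact₃ J hd (𝟙 _ - t ≫ p ≫ g) (by
    rw [Preadditive.comp_sub, comp_id, ← reassoc_of% ht, hpg, hpg]
    simp [g])
  refine ⟨N, g, h, t, susp.map e.inv ≫ σ.hom.app X ≫ s, ?_, hpg, hhp, hgt, ?_⟩
  · rw [verdier_dist_iff]
    refine ⟨_, _, _, _, _, _, hd, e, W.symm ≪≫ e, Iso.refl _, ?_, ?_, ?_⟩
    · rw [← ha]
      simp [W]
    · simp [g]
    · simp [h, σ]
  · rw [reassoc_of% hhp]
    have : h ≫ susp.map e.inv ≫ σ.hom.app X ≫ s = (verdierFunctor J).map k ≫ s := by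
      simp only [h, assoc]
      rw [← Functor.map_comp_assoc, Iso.hom_inv_id, CategoryTheory.Functor.map_id, id_comp,
        Iso.inv_hom_id_app_assoc]
    rw [this]
    exact (add_comm _ _).trans (sub_eq_iff_eq_add.1 hs).symm

/-- A thick tensor-ideal of the idempotent completion is determined by the objects of `K` whose
image it contains. -/
lemma IsThickTensorIdeal.exists_mem_karoubi_iff (Z : Karoubi (VerdierQuotient J)) :
    ∃ N : K, ∀ Q : ObjectProperty (Karoubi (VerdierQuotient J)), IsThickTensorIdeal _ Q →
      (Q Z ↔ Q ((toKaroubi _).obj ((verdierFunctor J).obj N))) := by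
  obtain ⟨N, g, h, t, s, hd, hpg, hhp, hgt, -⟩ := exists_cone_of_idempotent Z.p Z.idem
  let g' : Z ⟶ (toKaroubi _).obj ((verdierFunctor J).obj N) :=
    { f := g
      comm := (congrArg (Z.p ≫ ·) (comp_id g)).trans hpg }
  let h' : (toKaroubi _).obj ((verdierFunctor J).obj N) ⟶ susp.obj Z :=
    { f := h
      comm := (id_comp _).trans hhp }
  -- Cutting the source and target of `1 - p` down by `p` turns it into `0`. So the triangle over `0
  -- : Z ⟶ Z`, with cone `Z ⊕ ΣZ`, is a summand of the triangle over `1 - p`.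
  have hd' : dist (0 : Z ⟶ Z) g' h' := by
    rw [karoubi_dist_iff]
    have hp : Z.p ≫ (𝟙 Z.X - Z.p) = 0 := by
      rw [Preadditive.comp_sub, comp_id, Z.idem, sub_self]
    have hp' : (𝟙 Z.X - Z.p) ≫ Z.p = 0 := by
      rw [Preadditive.sub_comp, id_comp, Z.idem, sub_self]
    refine ⟨_, _, _, _, _, _, hd, ⟨Z.p, Z.p, Z.idem, Z.idem, Z.idem⟩,
      ⟨Z.p, Z.p, Z.idem, Z.idem, Z.idem⟩, ⟨𝟙 _, 𝟙 _, id_comp _, id_comp _, id_comp _⟩,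
      zero_comp.trans hp.symm, hp'.trans comp_zero.symm, (comp_id g).trans hpg.symm,
      (comp_id g).trans hpg.symm, hhp.trans (id_comp h).symm, hhp.trans (id_comp h).symm⟩
  refine ⟨N, fun Q hQ => ⟨fun hZ => hQ.two_of_three₃ hd' hZ hZ, fun hN => hQ.retract
    { i := g'
      r := { f := t ≫ Z.p
             comm := (id_comp ((t ≫ Z.p) ≫ Z.p)).trans (by rw [assoc, Z.idem]) }
      retract := ?_ } hN⟩⟩
  ext
  change g ≫ t ≫ Z.p = Z.p
  rw [reassoc_of% hgt, Z.idem]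

end Decomposition

/-! ### Morphisms of `K / J` that vanish in the quotient by a larger ideal `P`. -/

section Null

variable {K : Type u} [Category.{v} K] [Preadditive K] [HasZeroObject K]
  [HasShift K ℤ] [∀ n : ℤ, (shiftFunctor K n).Additive] [Pretriangulated K]
  [MonoidalCategory K] [MonoidalPreadditive K] [SymmetricCategory K]
  [TensorTriangulated K] [IsTriangulated K] {J P : ThickTensorIdeal K}

lemma verdierW_inverted_of_le (hJP : ∀ X, J.obj X → P.obj X) :
    (verdierW J).IsInvertedBy (verdierFunctor P) := by
  intro X Y f hf
  refine Localization.inverts (verdierFunctor P) (verdierW P) _ ?_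
  rw [verdierW_eq] at hf ⊢
  obtain ⟨Z, g, h, hd, hZ⟩ := hf
  exact ⟨Z, g, h, hd, hJP _ hZ⟩

/-- The functor between Verdier quotients by an ideal and by a larger one. -/
def verdierLift (hJP : ∀ X, J.obj X → P.obj X) : VerdierQuotient J ⥤ VerdierQuotient P :=
  Localization.lift _ (verdierW_inverted_of_le hJP) (verdierFunctor J)

variable (hJP : ∀ X, J.obj X → P.obj X)

instance : Localization.Lifting (verdierFunctor J) (verdierW J) (verdierFunctor P)
    (verdierLift hJP) :=
  Localization.liftingLift _ (verdierW_inverted_of_le hJP) (verdierFunctor J)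

instance : (verdierLift hJP).Monoidal :=
  Localization.Monoidal.functorMonoidalOfComp (verdierFunctor J) (verdierW J) _
    (verdierFunctor P)

/-- The compatibility of `verdierLift` with the localization functors. -/
def verdierLiftIso : verdierFunctor J ⋙ verdierLift hJP ≅ verdierFunctor P :=
  Localization.Lifting.iso (verdierFunctor J) (verdierW J) (verdierFunctor P) (verdierLift hJP)

instance : (verdierLift hJP).Additive :=
  (verdier_additive_iff J _).2 (Functor.additive_of_iso (verdierLiftIso hJP).symm)

lemma verdierLift_yoneda_exact₂ {X Y Z : K} {f : X ⟶ Y} {g : Y ⟶ Z} {h : Z ⟶ X⟦(1 : ℤ)⟧}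
    (hd : Triangle.mk f g h ∈ distTriang K) {A : VerdierQuotient P}
    (t : (verdierLift hJP).obj ((verdierFunctor J).obj Y) ⟶ A)
    (ht : (verdierLift hJP).map ((verdierFunctor J).map f) ≫ t = 0) :
    ∃ t', t = (verdierLift hJP).map ((verdierFunctor J).map g) ≫ t' := by
  let η := verdierLiftIso hJP
  have nat {X Y : K} (f : X ⟶ Y) : (verdierLift hJP).map ((verdierFunctor J).map f) ≫
    η.hom.app Y = η.hom.app X ≫ (verdierFunctor P).map f := η.hom.naturality f
  obtain ⟨t', ht'⟩ := verdier_yoneda_exact₂ P hd (η.inv.app Y ≫ t) (by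
    rw [← cancel_epi (η.hom.app X), ← reassoc_of% nat, Iso.hom_inv_id_app_assoc]
    exact ht.trans comp_zero.symm)
  refine ⟨η.hom.app Z ≫ t', ?_⟩
  rw [reassoc_of% nat, ← ht', Iso.hom_inv_id_app_assoc]

/-- Compatible endomorphisms of the objects of a triangle: if the middle one is idempotent
and if the other ones vanish after localization, then so does the middle one. -/
lemma verdierLift_map_eq_zero {X Y Z : K} {f : X ⟶ Y} {g : Y ⟶ Z} {h : Z ⟶ X⟦(1 : ℤ)⟧}
    (hd : Triangle.mk f g h ∈ distTriang K)
    {a : (verdierFunctor J).obj X ⟶ (verdierFunctor J).obj X}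
    {b : (verdierFunctor J).obj Y ⟶ (verdierFunctor J).obj Y}
    {c : (verdierFunctor J).obj Z ⟶ (verdierFunctor J).obj Z}
    (hab : (verdierFunctor J).map f ≫ b = a ≫ (verdierFunctor J).map f)
    (hbc : (verdierFunctor J).map g ≫ c = b ≫ (verdierFunctor J).map g)
    (hb : b ≫ b = b) (ha₀ : (verdierLift hJP).map a = 0) (hc₀ : (verdierLift hJP).map c = 0) :
    (verdierLift hJP).map b = 0 := by
  -- As the image of `a` is zero, the image of `b` factors through that of `g`. Idempotence then
  -- lets a second copy of `b` be exchanged for `c`.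
  obtain ⟨t, ht⟩ := verdierLift_yoneda_exact₂ hJP hd ((verdierLift hJP).map b) (by
    rw [← Functor.map_comp, hab, Functor.map_comp, ha₀, zero_comp])
  calc _ = (verdierLift hJP).map b ≫ (verdierLift hJP).map b := by rw [← Functor.map_comp, hb]
    _ = (verdierLift hJP).map b ≫ (verdierLift hJP).map ((verdierFunctor J).map g) ≫ t := by
      rw [← ht]
    _ = 0 := by
      rw [← Functor.map_comp_assoc, ← hbc, Functor.map_comp, hc₀, comp_zero, zero_comp]

lemma verdierLift_map_whiskerLeft_eq_zero (A : VerdierQuotient J) {X Y : VerdierQuotient J}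
    {f : X ⟶ Y} (hf : (verdierLift hJP).map f = 0) : (verdierLift hJP).map (A ◁ f) = 0 := by
  rw [Functor.Monoidal.map_whiskerLeft, hf, MonoidalPreadditive.whiskerLeft_zero, zero_comp,
    comp_zero]

lemma verdierLift_map_whiskerRight_eq_zero (A : VerdierQuotient J) {X Y : VerdierQuotient J}
    {f : X ⟶ Y} (hf : (verdierLift hJP).map f = 0) : (verdierLift hJP).map (f ▷ A) = 0 := by
  rw [Functor.Monoidal.map_whiskerRight, hf, MonoidalPreadditive.zero_whiskerRight, zero_comp,
    comp_zero]

set_option linter.unusedSectionVars false in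
lemma verdierSusp_map_eq {X Y : VerdierQuotient J} (f : X ⟶ Y) :
    susp.map f = (verdierSuspTensorIso J).hom.app X ≫
      (verdierFunctor J).obj ((𝟙_ K)⟦(1 : ℤ)⟧) ◁ f ≫ (verdierSuspTensorIso J).inv.app Y := by
  have := (verdierSuspTensorIso J).hom.naturality f
  rw [← cancel_mono ((verdierSuspTensorIso J).hom.app Y)]
  simp only [assoc, Iso.inv_hom_id_app]
  exact this.trans (by simp)

/-- The suspension is tensoring with `Σ𝟙`, which is invertible with inverse `Σ⁻¹𝟙`. Hence `f` is
recovered, up to isomorphisms, by tensoring its suspension. -/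
lemma verdierLift_map_susp_eq_zero_iff {X Y : VerdierQuotient J} (f : X ⟶ Y) :
    (verdierLift hJP).map (susp.map f) = 0 ↔ (verdierLift hJP).map f = 0 := by
  let S := (verdierFunctor J).obj ((𝟙_ K)⟦(1 : ℤ)⟧)
  let S' := (verdierFunctor J).obj ((𝟙_ K)⟦(-1 : ℤ)⟧)
  constructor
  · intro h
    have h₁ : (verdierLift hJP).map (S ◁ f) = 0 := by
      have : S ◁ f = (verdierSuspTensorIso J).inv.app X ≫ susp.map f ≫
          (verdierSuspTensorIso J).hom.app Y := by
        rw [verdierSusp_map_eq]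
        simp [S]
      rw [this, Functor.map_comp, Functor.map_comp, h, zero_comp, comp_zero]
    let e : S' ⊗ S ≅ 𝟙_ (VerdierQuotient J) :=
      β_ S' S ≪≫ Functor.Monoidal.μIso (verdierFunctor J) _ _ ≪≫
        (verdierFunctor J).mapIso ((tensorLeftShiftUnitIso K).app ((𝟙_ K)⟦(-1 : ℤ)⟧) ≪≫
          (shiftNegShift (𝟙_ K) (1 : ℤ))) ≪≫ (Functor.Monoidal.εIso (verdierFunctor J)).symm
    have : f = (λ_ X).inv ≫ e.inv ▷ X ≫ (α_ _ _ _).hom ≫ S' ◁ S ◁ f ≫ (α_ _ _ _).inv ≫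
        e.hom ▷ Y ≫ (λ_ Y).hom := by
      rw [← tensor_whiskerLeft_assoc, whisker_exchange_assoc, ← comp_whiskerRight_assoc,
        Iso.inv_hom_id, id_whiskerRight, id_comp, leftUnitor_naturality, Iso.inv_hom_id_assoc]
    rw [this]
    simp only [Functor.map_comp, verdierLift_map_whiskerLeft_eq_zero hJP S' h₁, zero_comp,
      comp_zero]
  · intro h
    rw [verdierSusp_map_eq, Functor.map_comp, Functor.map_comp,
      verdierLift_map_whiskerLeft_eq_zero hJP _ h, zero_comp, comp_zero]

lemma verdierLift_map_tensorHom_symm {X Y : VerdierQuotient J} {p : X ⟶ X} {q : Y ⟶ Y}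
    (h : (verdierLift hJP).map (p ⊗ₘ q) = 0) : (verdierLift hJP).map (q ⊗ₘ p) = 0 := by
  have : q ⊗ₘ p = (β_ Y X).hom ≫ (p ⊗ₘ q) ≫ (β_ Y X).inv := by simp
  rw [this, Functor.map_comp, Functor.map_comp, h, zero_comp, comp_zero]

/-- If `p ⊗ q` vanishes after localization, then so does the tensor product of `q` with
the cone of `1 - p`. -/
lemma verdierLift_map_id_tensorHom {X Y : VerdierQuotient J} {p : X ⟶ X} {q : Y ⟶ Y}
    (h : (verdierLift hJP).map (p ⊗ₘ q) = 0) {N : VerdierQuotient J} {g : X ⟶ N}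
    {h' : N ⟶ susp.obj X} {t : N ⟶ X} {s : susp.obj X ⟶ N}
    (hN : t ≫ p ≫ g + h' ≫ susp.map p ≫ s = 𝟙 N) :
    (verdierLift hJP).map (𝟙 N ⊗ₘ q) = 0 := by
  have h₁ : (verdierLift hJP).map (susp.map p ⊗ₘ q) = 0 := by
    have : susp.map p ⊗ₘ q = (verdierSuspTensorIso J).hom.app X ▷ Y ≫ (α_ _ _ _).hom ≫
        _ ◁ (p ⊗ₘ q) ≫ (α_ _ _ _).inv ≫ (verdierSuspTensorIso J).inv.app X ▷ Y := by
      rw [verdierSusp_map_eq, ← id_tensorHom _ (p ⊗ₘ q), ← associator_naturality_assoc,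
        Iso.hom_inv_id_assoc, ← tensorHom_id, ← tensorHom_id, tensorHom_comp_tensorHom,
        tensorHom_comp_tensorHom, id_comp, comp_id, id_tensorHom]
    rw [this]
    simp only [Functor.map_comp, verdierLift_map_whiskerLeft_eq_zero hJP _ h, zero_comp,
      comp_zero]
  -- Tensor the decomposition of the identity of `N` with `q`: one term factors through `p ⊗ q`, the
  -- other through `Σp ⊗ q`.
  have : 𝟙 N ⊗ₘ q = (t ⊗ₘ 𝟙 Y) ≫ (p ⊗ₘ q) ≫ (g ⊗ₘ 𝟙 Y) +
      (h' ⊗ₘ 𝟙 Y) ≫ (susp.map p ⊗ₘ q) ≫ (s ⊗ₘ 𝟙 Y) := by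
    simp only [tensorHom_comp_tensorHom, id_comp, comp_id]
    rw [← MonoidalPreadditive.add_tensor, hN]
  rw [this, Functor.map_add]
  simp only [Functor.map_comp, h, h₁, zero_comp, comp_zero, add_zero]

end Null

/-! ### Splittings and direct summands of triangles, tested on objects of `K`. -/

section Summand

variable {C : Type*} [Category* C]

/-- Transport of a splitting along an isomorphism of the ambient object. -/
@[simps]
def IdemSplit.trans {X X₀ X₁ : C} {p : X ⟶ X} (s : IdemSplit p X₀) (e : X₀ ≅ X₁) :
    IdemSplit p X₁ where
  i := s.i ≫ e.hom
  r := e.inv ≫ s.r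
  i_r := by simp [s.i_r]
  p_i := by rw [reassoc_of% s.p_i]
  r_p := by rw [assoc, s.r_p]

lemma IdemSplit.r_i_idem {X X₀ : C} {p : X ⟶ X} (s : IdemSplit p X₀) :
    (s.r ≫ s.i) ≫ s.r ≫ s.i = s.r ≫ s.i := by
  rw [assoc, reassoc_of% s.i_r, s.p_i]

lemma TriangleSummand.of_iso [TriangleStructure C] {X Y Z X₀ Y₀ Z₀ X₁ Y₁ Z₁ : C} {p : X ⟶ X}
    {q : Y ⟶ Y} {t : Z ⟶ Z} {f : X ⟶ Y} {g : Y ⟶ Z} {h : Z ⟶ susp.obj X}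
    {f₀ : X₀ ⟶ Y₀} {g₀ : Y₀ ⟶ Z₀} {h₀ : Z₀ ⟶ susp.obj X₀}
    {f₁ : X₁ ⟶ Y₁} {g₁ : Y₁ ⟶ Z₁} {h₁ : Z₁ ⟶ susp.obj X₁}
    (H : TriangleSummand p q t f g h f₀ g₀ h₀) (H' : TriangleIso f₁ g₁ h₁ f₀ g₀ h₀) :
    TriangleSummand p q t f g h f₁ g₁ h₁ := by
  obtain ⟨a, b, c, h₁, h₂, h₃, h₄, h₅, h₆⟩ := H
  obtain ⟨u, v, w, k₁, k₂, k₃⟩ := H'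
  refine ⟨a.trans u.symm, b.trans v.symm, c.trans w.symm, ?_, ?_, ?_, ?_, ?_, ?_⟩
  all_goals simp only [IdemSplit.trans_i, IdemSplit.trans_r, Iso.symm_hom, Iso.symm_inv, assoc,
    Functor.map_comp]
  · rw [reassoc_of% h₁, ← cancel_mono v.hom]
    simp [k₁]
  · rw [reassoc_of% k₁, h₂]
  · rw [reassoc_of% h₃, ← cancel_mono w.hom]
    simp [k₂]
  · rw [reassoc_of% k₂, h₄]
  · rw [reassoc_of% h₅, ← cancel_mono (susp.map u.hom)]
    simp [k₃, ← Functor.map_comp]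
  · rw [reassoc_of% k₃, h₆]

end Summand

section Null

variable {K : Type u} [Category.{v} K] [Preadditive K] [HasZeroObject K]
  [HasShift K ℤ] [∀ n : ℤ, (shiftFunctor K n).Additive] [Pretriangulated K]
  [MonoidalCategory K] [MonoidalPreadditive K] [SymmetricCategory K]
  [TensorTriangulated K] [IsTriangulated K] {J P : ThickTensorIdeal K}
  (hJP : ∀ X, J.obj X → P.obj X)

/-- The idempotents `p = i ≫ r` and `r ≫ i` factor through each other. The second one lives on the
ambient object `X₀`; when this comes from `K`, exactness can be used. -/
lemma IdemSplit.map_eq_zero_iff {X X₀ : VerdierQuotient J} {p : X ⟶ X} (s : IdemSplit p X₀) :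
    (verdierLift hJP).map p = 0 ↔ (verdierLift hJP).map (s.r ≫ s.i) = 0 := by
  constructor
  · intro h
    rw [← s.r_p]
    simp [h]
  · intro h
    have : p = s.i ≫ (s.r ≫ s.i) ≫ s.r := by
      rw [assoc, s.i_r, s.r_p, s.i_r]
    rw [this, Functor.map_comp, Functor.map_comp, h, zero_comp, comp_zero]

variable {X Y Z : VerdierQuotient J} {p : X ⟶ X} {q : Y ⟶ Y} {t : Z ⟶ Z} {f : X ⟶ Y} {g : Y ⟶ Z}
    {h : Z ⟶ susp.obj X} {X₀ Y₀ Z₀ : K} {f₀ : X₀ ⟶ Y₀} {g₀ : Y₀ ⟶ Z₀} {h₀ : Z₀ ⟶ X₀⟦(1 : ℤ)⟧}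

/-- In a direct summand of a distinguished triangle, if two objects vanish after localization, then
so does the third one. -/
lemma TriangleSummand.map_eq_zero (hd : Triangle.mk f₀ g₀ h₀ ∈ distTriang K)
    (H : TriangleSummand p q t f g h ((verdierFunctor J).map f₀) ((verdierFunctor J).map g₀)
      ((verdierFunctor J).map h₀ ≫ (verdierSuspIso J).inv.app X₀)) :
    ((verdierLift hJP).map p = 0 → (verdierLift hJP).map t = 0 → (verdierLift hJP).map q = 0) ∧
    ((verdierLift hJP).map p = 0 → (verdierLift hJP).map q = 0 → (verdierLift hJP).map t = 0) ∧
    ((verdierLift hJP).map q = 0 → (verdierLift hJP).map t = 0 →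
      (verdierLift hJP).map p = 0) := by
  obtain ⟨a, b, c, h₁, h₂, h₃, h₄, h₅, h₆⟩ := H
  let σ := verdierSuspIso J
  have nat {A A' : K} (f : A ⟶ A') : (verdierFunctor J).map (f⟦(1 : ℤ)⟧') ≫ σ.inv.app A' =
    σ.inv.app A ≫ susp.map ((verdierFunctor J).map f) := σ.inv.naturality f
  have nat' {A A' : K} (f : A ⟶ A') : σ.hom.app A ≫ (verdierFunctor J).map (f⟦(1 : ℤ)⟧') =
    susp.map ((verdierFunctor J).map f) ≫ σ.hom.app A' := (σ.hom.naturality f).symm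
  -- The suspension of `e`, viewed as an endomorphism of the image of `A⟦1⟧`, as required by rotated
  -- triangles of `K`.
  let S {A : K} (e : (verdierFunctor J).obj A ⟶ (verdierFunctor J).obj A) :
    (verdierFunctor J).obj (A⟦(1 : ℤ)⟧) ⟶ (verdierFunctor J).obj (A⟦(1 : ℤ)⟧) :=
    σ.inv.app A ≫ susp.map e ≫ σ.hom.app A
  have hS {A : K} (e : (verdierFunctor J).obj A ⟶ (verdierFunctor J).obj A) :
      (verdierLift hJP).map (S e) = 0 ↔ (verdierLift hJP).map e = 0 := by
    rw [← verdierLift_map_susp_eq_zero_iff hJP e]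
    constructor
    · intro h
      have : susp.map e = σ.hom.app A ≫ S e ≫ σ.inv.app A := by
        simp only [S, assoc, Iso.hom_inv_id_app, Iso.hom_inv_id_app_assoc]
        exact (comp_id _).symm
      rw [this, Functor.map_comp, Functor.map_comp, h, zero_comp, comp_zero]
    · intro h
      simp only [S, Functor.map_comp, h, zero_comp, comp_zero]
  have hSS {A : K} (e : (verdierFunctor J).obj A ⟶ (verdierFunctor J).obj A) (he : e ≫ e = e) :
      S e ≫ S e = S e := by
    simp only [S, assoc, Iso.hom_inv_id_app_assoc]
    rw [← Functor.map_comp_assoc, he]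
  -- The projectors `r ≫ i` form an endomorphism of the ambient triangle; `k₁` to `k₄` are its
  -- commutation relations, including the rotated ones.
  have k₁ : (verdierFunctor J).map f₀ ≫ b.r ≫ b.i = (a.r ≫ a.i) ≫ (verdierFunctor J).map f₀ := by
    rw [reassoc_of% h₂, h₁, assoc]
  have k₂ : (verdierFunctor J).map g₀ ≫ c.r ≫ c.i = (b.r ≫ b.i) ≫ (verdierFunctor J).map g₀ := by
    rw [reassoc_of% h₄, h₃, assoc]
  have k₃ : (verdierFunctor J).map h₀ ≫ S (a.r ≫ a.i) =
      (c.r ≫ c.i) ≫ (verdierFunctor J).map h₀ := by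
    have h₆' : (verdierFunctor J).map h₀ ≫ σ.inv.app X₀ ≫ susp.map a.r = c.r ≫ h := by
      rw [← h₆, assoc]
    have h₅' : h ≫ susp.map a.i ≫ σ.hom.app X₀ = c.i ≫ (verdierFunctor J).map h₀ := by
      rw [reassoc_of% h₅, Iso.inv_hom_id_app]
      exact congrArg (c.i ≫ ·) (comp_id _)
    simp only [S, Functor.map_comp, assoc]
    rw [reassoc_of% h₆', h₅']
  have k₄ : (verdierFunctor J).map (-f₀⟦(1 : ℤ)⟧') ≫ S (b.r ≫ b.i) =
      S (a.r ≫ a.i) ≫ (verdierFunctor J).map (-f₀⟦(1 : ℤ)⟧') := by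
    rw [Functor.map_neg, Preadditive.neg_comp, Preadditive.comp_neg]
    simp only [S, assoc, nat']
    rw [reassoc_of% nat, ← Functor.map_comp_assoc, ← Functor.map_comp_assoc, k₁]
  rw [a.map_eq_zero_iff, b.map_eq_zero_iff, c.map_eq_zero_iff]
  -- The three cases are one argument applied to the triangle and to its two rotations.
  refine ⟨fun ha hc => ?_, fun ha hb => ?_, fun hb hc => ?_⟩
  · exact verdierLift_map_eq_zero hJP hd k₁ k₂ b.r_i_idem ha hc
  · exact verdierLift_map_eq_zero hJP (rot_of_distTriang _ hd) k₂ k₃ c.r_i_idem hb ((hS _).2 ha)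
  · exact (hS _).1 (verdierLift_map_eq_zero hJP (rot_of_distTriang _ (rot_of_distTriang _ hd)) k₃ k₄
      (hSS _ a.r_i_idem) hc ((hS _).2 hb))

set_option linter.unusedSectionVars false in
lemma karoubi_verdier_dist {X Y Z : Karoubi (VerdierQuotient J)} {f : X ⟶ Y} {g : Y ⟶ Z}
    {h : Z ⟶ susp.obj X} (hd : dist f g h) :
    ∃ (X₀ Y₀ Z₀ : K) (f₀ : X₀ ⟶ Y₀) (g₀ : Y₀ ⟶ Z₀) (h₀ : Z₀ ⟶ X₀⟦(1 : ℤ)⟧),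
      Triangle.mk f₀ g₀ h₀ ∈ distTriang K ∧ TriangleSummand X.p Y.p Z.p f.f g.f h.f
        ((verdierFunctor J).map f₀) ((verdierFunctor J).map g₀)
        ((verdierFunctor J).map h₀ ≫ (verdierSuspIso J).inv.app X₀) := by
  obtain ⟨_, _, _, _, _, _, hd, H⟩ := (karoubi_dist_iff _ _ _).1 hd
  obtain ⟨_, _, _, _, _, _, hd, H'⟩ := (verdier_dist_iff _ _ _ _).1 hd
  exact ⟨_, _, _, _, _, _, hd, H.of_iso H'⟩

/-- The objects of the idempotent completion of `K / J` that vanish in the idempotent completion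
of `K / P` form a thick tensor-ideal. -/
lemma isThickTensorIdeal_null : IsThickTensorIdeal (Karoubi (VerdierQuotient J))
    (fun Z => (verdierLift hJP).map Z.p = 0) where
  zero Z hZ := by
    have : Z.p = 0 := congrArg Karoubi.Hom.f (hZ.eq_of_src (𝟙 Z) 0)
    rw [this, Functor.map_zero]
  susp_iff Z := verdierLift_map_susp_eq_zero_iff hJP Z.p
  two_of_three₁ hd := by
    obtain ⟨_, _, _, _, _, _, hd, H⟩ := karoubi_verdier_dist hd
    exact (H.map_eq_zero hJP hd).2.2
  two_of_three₂ hd := by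
    obtain ⟨_, _, _, _, _, _, hd, H⟩ := karoubi_verdier_dist hd
    exact (H.map_eq_zero hJP hd).1
  two_of_three₃ hd := by
    obtain ⟨_, _, _, _, _, _, hd, H⟩ := karoubi_verdier_dist hd
    exact (H.map_eq_zero hJP hd).2.1
  retract {X Y} r h := by
    have : X.p = r.i.f ≫ Y.p ≫ r.r.f := by
      rw [Karoubi.p_comp]
      exact (congrArg Karoubi.Hom.f r.retract).symm
    rw [this, Functor.map_comp, Functor.map_comp, h, zero_comp, comp_zero]
  tensor_left A X h := by
    rw [karoubi_tensorObj_p, MonoidalCategory.tensorHom_def, Functor.map_comp,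
      verdierLift_map_whiskerLeft_eq_zero hJP _ h, comp_zero]
  tensor_right X A h := by
    rw [karoubi_tensorObj_p, MonoidalCategory.tensorHom_def, Functor.map_comp,
      verdierLift_map_whiskerRight_eq_zero hJP _ h, zero_comp]

lemma verdierLift_map_id_eq_zero_iff (X : K) :
    (verdierLift hJP).map (𝟙 ((verdierFunctor J).obj X)) = 0 ↔ P.obj X := by
  rw [← isZero_verdierFunctor_obj_iff, ((verdierLiftIso hJP).app X).symm.isZero_iff,
    CategoryTheory.Functor.map_id, IsZero.iff_id_eq_zero]
  rfl

/-- The prime ideal of the idempotent completion of `K / J` that corresponds to a prime ideal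
of `K` containing `J`. -/
lemma isPrimeIdeal_null (hP : IsPrimeIdeal K P.obj) : IsPrimeIdeal (Karoubi (VerdierQuotient J))
    (fun Z => (verdierLift hJP).map Z.p = 0) where
  toIsThickTensorIdeal := isThickTensorIdeal_null hJP
  proper := by
    obtain ⟨X, hX⟩ := hP.proper
    exact ⟨(toKaroubi _).obj ((verdierFunctor J).obj X), fun h =>
      hX ((verdierLift_map_id_eq_zero_iff hJP X).1 h)⟩
  prime Z Z' hZ := by
    -- Primality of `P` concerns objects of `K`, so both idempotents are replaced by cones in `K`.
    -- The vanishing of `Z.p ⊗ Z'.p` passes to `1_N ⊗ Z'.p`, then, after a symmetry, to `1_N' ⊗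
    -- 1_N`.
    obtain ⟨N, g, h, t, s, -, -, -, hgt, hN⟩ := exists_cone_of_idempotent Z.p Z.idem
    obtain ⟨N', g', h', t', s', -, -, -, hgt', hN'⟩ := exists_cone_of_idempotent Z'.p Z'.idem
    have h₁ := verdierLift_map_tensorHom_symm hJP (verdierLift_map_id_tensorHom hJP hZ hN)
    have h₂ := verdierLift_map_id_tensorHom hJP h₁ hN'
    have h₃ : P.obj (N' ⊗ N) := by
      rw [← verdierLift_map_id_eq_zero_iff hJP]
      have e := Functor.Monoidal.μIso (verdierFunctor J) N' N
      have : 𝟙 ((verdierFunctor J).obj (N' ⊗ N)) = e.inv ≫ (𝟙 _ ⊗ₘ 𝟙 _) ≫ e.hom := by simp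
      rw [this, Functor.map_comp, Functor.map_comp, h₂, zero_comp, comp_zero]
    -- Conversely, each idempotent `p = g ≫ t` factors through its cone, so it vanishes once the
    -- cone is in `P`.
    have key {A : VerdierQuotient J} {p : A ⟶ A} {N : K} {g : A ⟶ (verdierFunctor J).obj N}
        {t : (verdierFunctor J).obj N ⟶ A} (hgt : g ≫ t = p) (hN : P.obj N) :
        (verdierLift hJP).map p = 0 := by
      rw [← hgt, ← id_comp t, Functor.map_comp, Functor.map_comp,
        (verdierLift_map_id_eq_zero_iff hJP N).2 hN, zero_comp, comp_zero]
    exact (hP.prime _ _ h₃).symm.imp (key hgt) (key hgt')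

end Null

/-! ### The homeomorphism between `Spc K(U)` and `U`. -/

section Local

variable {K : Type u} [Category.{v} K] [Preadditive K] [HasZeroObject K]
  [HasShift K ℤ] [∀ n : ℤ, (shiftFunctor K n).Additive] [Pretriangulated K]
  [MonoidalCategory K] [MonoidalPreadditive K] [SymmetricCategory K]
  [TensorTriangulated K] [IsTriangulated K] (B : K)

set_option linter.unusedSectionVars false in
lemma verdierFunctor_toKaroubi_dist {J : ThickTensorIdeal K} {X Y Z : K} {f : X ⟶ Y} {g : Y ⟶ Z}
    {h : Z ⟶ X⟦(1 : ℤ)⟧} (hd : Triangle.mk f g h ∈ distTriang K) :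
    ∃ h', dist ((verdierFunctor J ⋙ toKaroubi _).map f) ((verdierFunctor J ⋙ toKaroubi _).map g)
      h' := by
  have hd' : dist ((verdierFunctor J).map f) ((verdierFunctor J).map g)
      ((verdierFunctor J).map h ≫ (verdierSuspIso J).inv.app X) := by
    rw [verdier_dist_iff]
    exact ⟨_, _, _, _, _, _, hd, Iso.refl _, Iso.refl _, Iso.refl _, by simp, by simp, by simp⟩
  let s (A : VerdierQuotient J) : IdemSplit (𝟙 A) A :=
    ⟨𝟙 A, 𝟙 A, id_comp _, id_comp _, id_comp _⟩
  refine ⟨{ f := (verdierFunctor J).map h ≫ (verdierSuspIso J).inv.app X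
            comm := ?_ }, (karoubi_dist_iff _ _ _).2 ⟨_, _, _, _, _, _, hd', s _, s _, s _,
    ?_, ?_, ?_, ?_, ?_, ?_⟩⟩
  · refine (id_comp _).trans ((congrArg (_ ≫ ·) ((verdierSusp J).map_id _)).trans (comp_id _))
  · exact (comp_id _).trans (id_comp _).symm
  · exact (comp_id _).trans (id_comp _).symm
  · exact (comp_id _).trans (id_comp _).symm
  · exact (comp_id _).trans (id_comp _).symm
  · exact (congrArg (_ ≫ ·) ((verdierSusp J).map_id _)).trans ((comp_id _).trans (id_comp _).symm)
  · exact (congrArg (_ ≫ ·) ((verdierSusp J).map_id _)).trans ((comp_id _).trans (id_comp _).symm)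

/-- The spectrum of `K(U)` is identified with `U`, for the complement `U` of the support of an
object. -/
lemma exists_local_homeomorph (U : Set (Spc K)) (hU : U = (supp B)ᶜ) :
    ∃ ρ : Spc (LocalCategory U) ≃ₜ U, IsSpcMap (res U) (fun P => (ρ P : Spc K)) := by
  have hB : (supportedOn Uᶜ).obj B := by
    rw [supportedOn_compl_iff]
    intro P hP
    rw [hU] at hP
    exact not_not.1 hP
  refine exists_homeomorph_of_isSpcMap _ _ (fun Q => ?_) (fun P hP => ?_) (fun Z => ?_)
  · let P : Spc K := ⟨_, IsPrimeIdeal.comap (res U) (fun X hX => ?_) (fun X => ?_)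
      verdierFunctor_toKaroubi_dist Q⟩
    · refine ⟨P, ?_, fun X => Iff.rfl⟩
      rw [hU]
      -- The preimage of a prime lies in `U` because `B` becomes zero in `K(U)`.
      exact not_not.2 (Q.2.zero _
        ((toKaroubi _).map_isZero ((isZero_verdierFunctor_obj_iff _ _).2 hB)))
    · exact (toKaroubi _).map_isZero ((verdierFunctor _).map_isZero hX)
    · exact ⟨(toKaroubi _).mapIso ((verdierSuspIso _).symm.app X) ≪≫
        (karoubiMapCompToKaroubi (verdierSusp _)).symm.app ((verdierFunctor _).obj X)⟩
  · have hle := (supportedOn_compl_iff U · |>.1 · P hP)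
    exact ⟨⟨_, isPrimeIdeal_null (P := ⟨P.1, P.2.toIsThickTensorIdeal⟩) hle P.2⟩, fun X =>
      (verdierLift_map_id_eq_zero_iff (P := ⟨P.1, P.2.toIsThickTensorIdeal⟩) hle X).symm⟩
  · obtain ⟨N, hN⟩ := IsThickTensorIdeal.exists_mem_karoubi_iff Z
    exact ⟨N, fun Q => hN _ Q.2.toIsThickTensorIdeal⟩

end Local

end TTGeom

/-! ### The birationality theorem. -/

theorem mainTheorem1 {K : Type u} [Category.{v} K] [Preadditive K] [HasZeroObject K]
    [HasShift K ℤ] [∀ n : ℤ, (shiftFunctor K n).Additive] [Pretriangulated K] [IsTriangulated K]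
    [MonoidalCategory K] [MonoidalPreadditive K] [SymmetricCategory K]
    [TTGeom.TensorTriangulated K] [LeftRigidCategory K] (B : K)
    {F : K} (ξ : F ⟶ 𝟙_ K) (κ : HasLeftDual.leftDual B ⊗ B ⟶ F⟦(1 : ℤ)⟧)
    (_ : Triangle.mk ξ (TTGeom.coev B) κ ∈ distTriang K)
    {C : K} (c : 𝟙_ K ⟶ C) (d : C ⟶ (F ⊗ F)⟦(1 : ℤ)⟧)
    (_ : Triangle.mk ((ξ ⊗ₘ ξ) ≫ (λ_ (𝟙_ K)).hom) c d ∈ distTriang K)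
    (U : Set (TTGeom.Spc K)) (_ : U = (TTGeom.supp B)ᶜ)
    (V : Set (TTGeom.Spc (TTGeom.StableCategory B)))
    (_ : V = (TTGeom.supp ((TTGeom.stableFunctor B).obj C))ᶜ) :
    ∃ E : TTGeom.TTEquivalence (TTGeom.LocalCategory U) (TTGeom.LocalCategory V),
      (∃ θ : TTGeom.res U ⋙ E.functor ≅ TTGeom.stableFunctor B ⋙ TTGeom.res V,
        NatTrans.IsMonoidal θ.hom) ∧
      ∃ (φ : TTGeom.Spc (TTGeom.LocalCategory V) ≃ₜ TTGeom.Spc (TTGeom.LocalCategory U))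
        (ρU : TTGeom.Spc (TTGeom.LocalCategory U) ≃ₜ U)
        (ρV : TTGeom.Spc (TTGeom.LocalCategory V) ≃ₜ V)
        (h : V ≃ₜ U),
        TTGeom.IsSpcMap E.functor φ ∧
        TTGeom.IsSpcMap (TTGeom.res U) (fun P => (ρU P : TTGeom.Spc K)) ∧
        TTGeom.IsSpcMap (TTGeom.res V)
          (fun P => (ρV P : TTGeom.Spc (TTGeom.StableCategory B))) ∧
        ∀ P, h (ρV P) = ρU (φ P) := by
  rename_i hξ hC hU hV
  obtain ⟨h, hh⟩ : ∃ h : V ≃ₜ U, ∀ Q X, (h Q).1.1 X ↔ Q.1.1 ((TTGeom.stableFunctor B).obj X) := by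
    subst hU hV
    exact TTGeom.exists_stableSpc_homeomorph hξ hC
  have hB : (TTGeom.supportedOn Uᶜ).obj B := by
    rw [TTGeom.supportedOn_compl_iff]
    intro P hP
    rw [hU] at hP
    exact not_not.1 hP
  -- Both sides say that `X` belongs to all primes of `V`, respectively of `U`, and `h` matches
  -- these primes compatibly with `π`.
  have hJ (X : K) : (TTGeom.supportedOn Vᶜ).obj ((TTGeom.stableFunctor B).obj X) ↔
      (TTGeom.supportedOn Uᶜ).obj X := by
    rw [TTGeom.supportedOn_compl_iff, TTGeom.supportedOn_compl_iff]
    refine ⟨fun H P hP => ?_, fun H Q hQ => (hh ⟨Q, hQ⟩ X).1 (H _ (h ⟨Q, hQ⟩).2)⟩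
    have := (hh (h.symm ⟨P, hP⟩) X).2 (H _ (h.symm ⟨P, hP⟩).2)
    rwa [h.apply_symm_apply] at this
  let E := (TTGeom.verdierEquivalence hB hJ).karoubi (TTGeom.verdier_dist_of_iso _)
  let θ : TTGeom.res U ⋙ E.functor ≅ TTGeom.stableFunctor B ⋙ TTGeom.res V :=
    TTGeom.karoubiComparisonIso hB hJ
  obtain ⟨φ, hφ⟩ := E.exists_spc_homeomorph TTGeom.karoubi_distRespectsIso
  obtain ⟨ρU, hρU⟩ := TTGeom.exists_local_homeomorph B U hU
  -- The identification of the spectrum over `V` is taken to be `ρU ∘ φ` followed by the inverse of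
  -- `h`, so its compatibility with `h` is automatic. That it is the map induced by `res V` follows
  -- from `θ` by invariance of primes under isomorphism.
  refine ⟨E, ⟨θ, inferInstanceAs (NatTrans.IsMonoidal (TTGeom.karoubiComparisonIso hB hJ).hom)⟩,
    φ, ρU, (φ.trans ρU).trans h.symm, h, hφ, hρU, fun P X => ?_, fun P => by simp⟩
  change (h.symm (ρU (φ P))).1.1 ((TTGeom.stableFunctor B).obj X.as) ↔ _
  rw [← hh, h.apply_symm_apply, hρU, hφ]
  exact P.mem_iff_of_iso (θ.app X.as)
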